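/- Let $n\ge 2$, let $\mathfrak{su}(n)$ be the Lie algebra of trace-free skew-Hermitian $n\times n$ matrices, raise and lower indices on $\mathbb R^{1+3}$ with the metric $\mathrm{diag}(-1,1,1,1)$, and write $\Box=\partial^\mu\partial_\mu=-\partial_t^2+\Delta$. For an $\mathfrak{su}(n)$-valued one-form $A=(A_\mu)$ and two-form $F=(F_{\mu\nu})$ consider the Yang–Mills system in the Lorenz gauge, $$\Box A_\nu=-2[A^\mu,\partial_\mu A_\nu]+[A^\mu,\partial_\nu A_\mu]-[A^\mu,[A_\mu,A_\nu]],$$ $$\begin{aligned}\Box F_{\mu\nu}=&-2[A^\lambda,\partial_\lambda F_{\mu\nu}]+2[\partial_\nu A^\lambda,\partial_\lambda A_\mu]-2[\partial_\mu A^\lambda,\partial_\lambda A_\nu]+2[\partial^\lambda A_\mu,\partial_\lambda A_\nu]+2[\partial_\mu A^\lambda,\partial_\nu A_\lambda]\\&-[A^\lambda,[A_\lambda,F_{\mu\nu}]]+2[F_{\lambda\mu},[A^\lambda,A_\nu]]-2[F_{\lambda\nu},[A^\lambda,A_\mu]]-2[[A^\lambda,A_\mu],[A_\lambda,A_\nu]],\end{aligned}$$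 with Cauchy data $(a,\dot a,f,\dot f)=(A,\partial_tA,F,\partial_tF)|_{t=0}$ that are compatible: with $i,j$ running over $1,2,3$, $$f_{ij}=\partial_ia_j-\partial_ja_i+[a_i,a_j],\qquad f_{0i}=\dot a_i-\partial_ia_0+[a_0,a_i],\qquad \dot a_0=\partial^ia_i,\qquad \partial^if_{0i}+[a^i,f_{0i}]=0,$$ $$\dot f_{ij}=\partial_i\dot a_j-\partial_j\dot a_i+[\dot a_i,a_j]+[a_i,\dot a_j],\qquad \dot f_{0i}=\partial^jf_{ji}+[a^\alpha,f_{\alpha i}].$$ For compatible data, $\dot a$ and $\dot f$ are determined by $(a,f)$. A smooth solution on $[-T,T]$ is a solution $(A,F)$ that is $C^\infty$ on $(-T,T)\times\mathbb R^3$ and whose components belong to $C([-T,T];H^\sigma(\mathbb R^3))$ for every $\sigma\in\mathbb R$. Let $\mathcal D_T$ be the set of pairs $(a,f)$ that are the initial values of a smooth solution on $[-T,T]$ with compatible data. **Theorem.** Let $s,r\in\mathbb R$ with $s-1>2r$ and let $T>0$. Then the data-to-solution map $(a,f)\mapsto(A(t),F(t))$ from $H^s\times H^r$ to $C([-T,T];H^s\times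 H^r)$ is not $C^2$ at the origin. More precisely, let $U$ be a neighbourhood of the origin in $H^s\times H^r$ and let $\Phi:H^s\times H^r\to C([-T,T];H^s\times H^r)$ be any map such that $\Phi(a,f)=(A,F)$ whenever $(A,F)$ is a smooth solution on $[-T,T]$ with compatible data and $(a,f)=(A(0),F(0))\in U$. Then $\Phi$ is not twice continuously (Fréchet) differentiable at the origin, not even as a map on $\mathcal D_T$: there are no relative neighbourhood $V$ of the origin in $\mathcal D_T\subset H^s\times H^r$ and maps $p_1$ and $p_2$ from $V$ to the bounded linear and bounded bilinear maps on $H^s\times H^r$, such that $p_1$ is a derivative of $\Phi$ along $V$, $p_2$ is a derivative of $p_1$ along $V$, and $p_2$ is continuous on $V$. -/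

import Mathlib

open MeasureTheory Set
open scoped SchwartzMap ContDiff Matrix

/-- Physical space `ℝ³` with its Euclidean norm. -/
abbrev Space : Type := EuclideanSpace ℝ (Fin 3)

/-- Spacetime `ℝ^{1+3}`: a point is `(t, x)`. -/
abbrev Spacetime : Type := ℝ × Space

noncomputable section SobolevSpace

/-- The complex vector space of tempered distributions `u` on `ℝ³` for which
`(1 + |ξ|²)^{s/2} û` is square integrable. -/
def sobolevSubmodule (s : ℝ) : Submodule ℂ 𝓢'(Space, ℂ) where
  carrier := {u | TemperedDistribution.MemSobolev s 2 u}
  add_mem' := fun hu hv => hu.add hv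
  zero_mem' := TemperedDistribution.memSobolev_fun_zero Space ℂ s 2
  smul_mem' := fun c _ hu => hu.smul c

/-- The Sobolev space `H^s(ℝ³; ℂ)`, for an arbitrary real `s`. -/
def SobolevH (s : ℝ) : Type := sobolevSubmodule s

namespace SobolevH

variable {s : ℝ}

instance : AddCommGroup (SobolevH s) := inferInstanceAs (AddCommGroup (sobolevSubmodule s))

instance : Module ℂ (SobolevH s) := inferInstanceAs (Module ℂ (sobolevSubmodule s))

/-- The tempered distribution underlying an element of `H^s`. -/
def toDist : SobolevH s →ₗ[ℂ] 𝓢'(Space, ℂ) := (sobolevSubmodule s).subtype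

theorem toDist_injective : Function.Injective (toDist (s := s)) :=
  Subtype.val_injective

theorem coeLp_injective {v w : Lp ℂ 2 (volume : Measure Space)}
    (h : Lp.toTemperedDistributionCLM ℂ (volume : Measure Space) 2 v =
      Lp.toTemperedDistributionCLM ℂ (volume : Measure Space) 2 w) : v = w :=
  LinearMap.ker_eq_bot.mp (Lp.ker_toTemperedDistributionCLM_eq_bot (E := Space) (F := ℂ)) h

theorem exists_L2 (u : SobolevH s) : ∃ v : Lp ℂ 2 (volume : Measure Space),
    TemperedDistribution.besselPotential Space ℂ s (toDist u) =
      Lp.toTemperedDistributionCLM ℂ (volume : Measure Space) 2 v :=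
  u.2

/-- The square integrable function `⟨D⟩^s u`, for `u` in `H^s`. -/
def besselL2 (u : SobolevH s) : Lp ℂ 2 (volume : Measure Space) := (exists_L2 u).choose

theorem besselL2_spec (u : SobolevH s) :
    Lp.toTemperedDistributionCLM ℂ (volume : Measure Space) 2 (besselL2 u) =
      TemperedDistribution.besselPotential Space ℂ s (toDist u) :=
  (exists_L2 u).choose_spec.symm

/-- The linear map `u ↦ ⟨D⟩^s u` from `H^s` to `L²`. -/
def toL2 : SobolevH s →ₗ[ℂ] Lp ℂ 2 (volume : Measure Space) where
  toFun := besselL2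
  map_add' u v := coeLp_injective (by
    rw [besselL2_spec, map_add, map_add, map_add, besselL2_spec, besselL2_spec])
  map_smul' c u := coeLp_injective (by
    rw [besselL2_spec, map_smul, map_smul, RingHom.id_apply, map_smul, besselL2_spec])

theorem toL2_injective : Function.Injective (toL2 (s := s)) := by
  intro u v h
  have h0 : besselL2 u = besselL2 v := h
  apply toDist_injective
  have h1 : TemperedDistribution.besselPotential Space ℂ s (toDist u) =
      TemperedDistribution.besselPotential Space ℂ s (toDist v) := by
    rw [← besselL2_spec, ← besselL2_spec, h0]
  rw [← (TemperedDistribution.besselPotential_neg_apply_eq_iff s _ _).mpr h1]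
  exact (TemperedDistribution.besselPotential_neg_apply_eq_iff s _ _).mpr rfl

/-- The Sobolev norm `‖u‖_{H^s} = ‖⟨D⟩^s u‖_{L²}`. -/
instance : NormedAddCommGroup (SobolevH s) :=
  NormedAddCommGroup.induced (SobolevH s) (Lp ℂ 2 (volume : Measure Space)) toL2 toL2_injective

instance : NormedSpace ℂ (SobolevH s) :=
  NormedSpace.induced ℂ (SobolevH s) (Lp ℂ 2 (volume : Measure Space)) toL2

end SobolevH

/-- The square integrable function `g` represents the distribution `u ∈ H^s`. -/
def Represents {s : ℝ} (g : Space → ℂ) (u : SobolevH s) : Prop :=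
  ∃ hg : MemLp g 2 (volume : Measure Space),
    ((hg.toLp g : Lp ℂ 2 (volume : Measure Space)) : 𝓢'(Space, ℂ)) = SobolevH.toDist u

/-- `H^s × H^r` for pairs `(a, f)` of a one-form `a = (a_μ)` and a two-tensor `f = (f_{μν})` with
values in the complex `n × n` matrices; all norms are taken componentwise. -/
abbrev DataSpace (n : ℕ) (s r : ℝ) : Type :=
  (Fin 4 → Fin n → Fin n → SobolevH s) × (Fin 4 → Fin 4 → Fin n → Fin n → SobolevH r)

end SobolevSpace

noncomputable section YangMills

variable {n : ℕ}

/-- The coordinate vectors of spacetime; the index `0` is time. -/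
def coordVec (μ : Fin 4) : Spacetime :=
  Fin.cases (1, 0) (fun k => (0, EuclideanSpace.single k 1)) μ

/-- The diagonal entries of the Minkowski metric `diag(-1, 1, 1, 1)`. -/
def minkowski (μ : Fin 4) : ℝ := if μ = 0 then -1 else 1

/-- The partial derivative `∂_μ u` of a matrix-valued function on spacetime. -/
def pd (μ : Fin 4) (u : Spacetime → Matrix (Fin n) (Fin n) ℂ) (p : Spacetime) :
    Matrix (Fin n) (Fin n) ℂ :=
  Matrix.of fun i j => fderiv ℝ (fun q => u q i j) p (coordVec μ)

/-- The d'Alembertian `∂^μ ∂_μ = -∂_t² + Δ`. -/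
def dAlembert (u : Spacetime → Matrix (Fin n) (Fin n) ℂ) (p : Spacetime) :
    Matrix (Fin n) (Fin n) ℂ :=
  ∑ μ, minkowski μ • pd μ (pd μ u) p

/-- The right-hand side of the wave equation for `A_ν`. -/
def rhsA (A : Fin 4 → Spacetime → Matrix (Fin n) (Fin n) ℂ) (ν : Fin 4) (p : Spacetime) :
    Matrix (Fin n) (Fin n) ℂ :=
  ∑ l, minkowski l •
    (-(2 : ℝ) • ⁅A l p, pd l (A ν) p⁆ + ⁅A l p, pd ν (A l) p⁆ - ⁅A l p, ⁅A l p, A ν p⁆⁆)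

/-- The right-hand side of the wave equation for `F_{μν}`. -/
def rhsF (A : Fin 4 → Spacetime → Matrix (Fin n) (Fin n) ℂ)
    (F : Fin 4 → Fin 4 → Spacetime → Matrix (Fin n) (Fin n) ℂ) (μ ν : Fin 4) (p : Spacetime) :
    Matrix (Fin n) (Fin n) ℂ :=
  ∑ l, minkowski l •
    (-(2 : ℝ) • ⁅A l p, pd l (F μ ν) p⁆
      + (2 : ℝ) • ⁅pd ν (A l) p, pd l (A μ) p⁆
      - (2 : ℝ) • ⁅pd μ (A l) p, pd l (A ν) p⁆
      + (2 : ℝ) • ⁅pd l (A μ) p, pd l (A ν) p⁆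
      + (2 : ℝ) • ⁅pd μ (A l) p, pd ν (A l) p⁆
      - ⁅A l p, ⁅A l p, F μ ν p⁆⁆
      + (2 : ℝ) • ⁅F l μ p, ⁅A l p, A ν p⁆⁆
      - (2 : ℝ) • ⁅F l ν p, ⁅A l p, A μ p⁆⁆
      - (2 : ℝ) • ⁅⁅A l p, A μ p⁆, ⁅A l p, A ν p⁆⁆)

/-- Membership in `su(n)`, the trace-free skew-Hermitian matrices. -/
def IsSu (X : Matrix (Fin n) (Fin n) ℂ) : Prop := Xᴴ = -X ∧ X.trace = 0

/-- The time slices of `u` form a continuous curve from `[-T, T]` to `H^σ` for every `σ`. -/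
def ContinuousInAllSobolev (T : ℝ) (u : Spacetime → Matrix (Fin n) (Fin n) ℂ) : Prop :=
  ∀ (σ : ℝ) (i j : Fin n), ∃ v : C(Icc (-T) T, SobolevH σ),
    ∀ t : Icc (-T) T, Represents (fun x => u ((t : ℝ), x) i j) (v t)

/-- `u` is a smooth `su(n)`-valued field on the time interval `[-T, T]`: it lies in
`C([-T, T]; H^σ)` for every `σ` and in `C^∞((-T, T) × ℝ³)`. -/
structure IsSmoothField (T : ℝ) (u : Spacetime → Matrix (Fin n) (Fin n) ℂ) : Prop where
  su : ∀ t ∈ Icc (-T) T, ∀ x, IsSu (u (t, x))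
  smooth : ∀ i j, ContDiffOn ℝ ∞ (fun p => u p i j) (Ioo (-T) T ×ˢ univ)
  sobolev : ContinuousInAllSobolev T u

/-- `(A, F)` is a smooth solution on `[-T, T]` of the Yang-Mills system in the Lorenz gauge, written
as a system of wave equations; `F` is a two-form. -/
structure IsSmoothSolution (T : ℝ) (A : Fin 4 → Spacetime → Matrix (Fin n) (Fin n) ℂ)
    (F : Fin 4 → Fin 4 → Spacetime → Matrix (Fin n) (Fin n) ℂ) : Prop where
  fieldA : ∀ μ, IsSmoothField T (A μ)
  fieldF : ∀ μ ν, IsSmoothField T (F μ ν)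
  antisymm : ∀ μ ν, ∀ t ∈ Icc (-T) T, ∀ x, F μ ν (t, x) = -F ν μ (t, x)
  waveA : ∀ ν, ∀ t ∈ Ioo (-T) T, ∀ x, dAlembert (A ν) (t, x) = rhsA A ν (t, x)
  waveF : ∀ μ ν, ∀ t ∈ Ioo (-T) T, ∀ x, dAlembert (F μ ν) (t, x) = rhsF A F μ ν (t, x)

/-- The compatibility of the Cauchy data
`(a, ȧ, f, ḟ) = (A, ∂_t A, F, ∂_t F)` at `t = 0`. They express `ȧ` and `ḟ` through `(a, f)`. -/
structure CompatibleData (A : Fin 4 → Spacetime → Matrix (Fin n) (Fin n) ℂ)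
    (F : Fin 4 → Fin 4 → Spacetime → Matrix (Fin n) (Fin n) ℂ) : Prop where
  /-- `f_{μν} = ∂_μ a_ν - ∂_ν a_μ + [a_μ, a_ν]`, where `∂_0 a_i` stands for `ȧ_i`. -/
  curvature : ∀ μ ν x, F μ ν (0, x) =
    pd μ (A ν) (0, x) - pd ν (A μ) (0, x) + ⁅A μ (0, x), A ν (0, x)⁆
  /-- `ḟ_{ij} = ∂_i ȧ_j - ∂_j ȧ_i + [ȧ_i, a_j] + [a_i, ȧ_j]`. -/
  curvature_dot : ∀ (i j : Fin 3) (x : Space), pd 0 (F i.succ j.succ) (0, x) =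
    pd i.succ (pd 0 (A j.succ)) (0, x) - pd j.succ (pd 0 (A i.succ)) (0, x)
      + ⁅pd 0 (A i.succ) (0, x), A j.succ (0, x)⁆ + ⁅A i.succ (0, x), pd 0 (A j.succ) (0, x)⁆
  /-- `ḟ_{0i} = ∂^j f_{ji} + [a^α, f_{αi}]`. -/
  ampere : ∀ (i : Fin 3) (x : Space), pd 0 (F 0 i.succ) (0, x) =
    (∑ j : Fin 3, pd j.succ (F j.succ i.succ) (0, x))
      + ∑ α, minkowski α • ⁅A α (0, x), F α i.succ (0, x)⁆
  /-- The Lorenz condition `ȧ_0 = ∂^i a_i`. -/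
  lorenz : ∀ x : Space, pd 0 (A 0) (0, x) = ∑ i : Fin 3, pd i.succ (A i.succ) (0, x)
  /-- The Gauss law `∂^i f_{0i} + [a^i, f_{0i}] = 0`. -/
  gauss : ∀ x : Space, (∑ i : Fin 3, pd i.succ (F 0 i.succ) (0, x))
    + ∑ i : Fin 3, ⁅A i.succ (0, x), F 0 i.succ (0, x)⁆ = 0

/-- The curve `y` in `H^s × H^r` is `t ↦ (A(t), F(t))` for a smooth solution `(A, F)` on `[-T, T]`
with compatible data. -/
def IsSmoothTrajectory (n : ℕ) (s r T : ℝ) (y : C(Icc (-T) T, DataSpace n s r)) : Prop :=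
  ∃ (A : Fin 4 → Spacetime → Matrix (Fin n) (Fin n) ℂ)
    (F : Fin 4 → Fin 4 → Spacetime → Matrix (Fin n) (Fin n) ℂ),
    IsSmoothSolution T A F ∧ CompatibleData A F ∧
    ∀ t : Icc (-T) T,
      (∀ μ i j, Represents (fun x => A μ ((t : ℝ), x) i j) ((y t).1 μ i j)) ∧
      (∀ μ ν i j, Represents (fun x => F μ ν ((t : ℝ), x) i j) ((y t).2 μ ν i j))

/-- The time `0` as a point of `[-T, T]`. -/
def timeZero {T : ℝ} (hT : 0 < T) : Icc (-T) T := ⟨0, by constructor <;> linarith⟩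

/-- The compatible initial data `(a, f) ∈ H^s × H^r` that launch a smooth solution on `[-T, T]`. -/
def smoothData (n : ℕ) (s r : ℝ) {T : ℝ} (hT : 0 < T) : Set (DataSpace n s r) :=
  {x | ∃ y : C(Icc (-T) T, DataSpace n s r), IsSmoothTrajectory n s r T y ∧ y (timeZero hT) = x}

/-- `Φ` is a data-to-solution map `(a, f) ↦ (A(t), F(t))` on `[-T, T]` for data in `U`: whenever
`(A, F)` is a smooth solution on `[-T, T]` with compatible data `(a, f) ∈ U`, then `Φ (a, f)` is the
curve `t ↦ (A(t), F(t))`. Nothing is asked of `Φ` at other points. -/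
def IsFlowMap (n : ℕ) (s r : ℝ) {T : ℝ} (hT : 0 < T) (U : Set (DataSpace n s r))
    (Φ : DataSpace n s r → C(Icc (-T) T, DataSpace n s r)) : Prop :=
  ∀ y : C(Icc (-T) T, DataSpace n s r), IsSmoothTrajectory n s r T y →
    y (timeZero hT) ∈ U → Φ (y (timeZero hT)) = y

end YangMills

/-! ### Inverse Fourier transforms as elements of the Sobolev spaces -/

noncomputable section SobolevFourier

open FourierTransform

/-! Take data with a = 0 and f_{ij} = 0. Then f_{0i} = ∂_t a_i = g_i, all commutators in the
constraints vanish at time 0, and the Gauss law is the linear condition div g = 0. The solution with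
data εg is ε times a free wave to first order, with free A_i = (sin t|D| / |D|) g_i and free A_0 =
0. Hence the first nonzero term of A_0 is of order ε², and it is minus the Duhamel integral of Σ_i
[A_i, ∂_t A_i] for the free A_i. If a flow map were C² at the origin along smooth data, this second
iterate would be bounded in H^s by a constant times the square of the H^r norm of g
(`ContDiffWithinAt.exists_second_variation_bound`, `exists_source_bound`).

That bound fails because of parallel interactions of high frequencies. Let the transform of g be (-ξ
1, ξ 0, 0) times a cutoff to a tube of length about N and width about √N along the first axis. For η
and η - ξ in the tube and ξ in a similar box, |η| - |η - ξ| - |ξ| stays small uniformly in N, by the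
parabolic scaling. The source at frequency ξ then drives the oscillator of frequency |ξ| nearly in
resonance, and the response contains a secular term (`abs_waveKernel_sub_le`) of size t N⁻²
|cos(2π|ξ|t)|. The product of the amplitudes has size N² and one sign, and the frequencies η fill a
volume of order N². So the output has amplitude t N² on a box of volume of order N², and H^s norm of
order N^{s+3}. The cosine may vanish at time t, but not at both t and t/2, up to errors
(`IsTubeScale.le_sum_sq`). The data have norm at most of order N^{r+2}. Comparing N^{s+3} with
N^{2r+4} for large N contradicts the bound when s - 1 > 2r (`not_exists_source_bound`).

Genuine smooth solutions on all of [-T, T] are also needed. They are built on the Fourier side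
(`exists_jet_solution`), in the space of densities bounded by e^{-|ξ|}(1 + |ξ|)^{-4}. It is a Banach
algebra under convolution, up to a constant, and lies in every H^σ. The first derivatives are
treated as further unknowns. Each is recovered from the source by a bounded multiplier, so no
derivative is lost, and the inverse function theorem solves the integral equation for small ε. How
small may depend on g, since the second variation only sees ε → 0 along a ray. -/

theorem integral_smul_fourierInv_eq {h g : Space → ℂ} (hh : Integrable h) (hg : Integrable g) :
    ∫ x, g x • 𝓕⁻ h x = ∫ ξ, 𝓕⁻ g ξ • h ξ := by
  have hc : Continuous fun p : Space × Space => (-innerₗ Space) p.1 p.2 := by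
    simp only [LinearMap.neg_apply, innerₗ_apply_apply]
    fun_prop
  have key := VectorFourier.integral_fourierIntegral_smul_eq_flip (L := -innerₗ Space)
    (μ := volume) (ν := volume) Real.continuous_fourierChar hc hg hh
  have h1 : ∀ (u : Space → ℂ), 𝓕⁻ u =
      VectorFourier.fourierIntegral Real.fourierChar volume (-innerₗ Space) u := fun u => rfl
  have h2 : (-innerₗ Space).flip = -innerₗ Space := by
    ext x y
    simp [real_inner_comm]
  rw [h2] at key
  rw [h1 h, h1 g, key]

/-- The inverse Fourier transform of an integrable, square integrable function is its inverse
Fourier transform in `L²`. -/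
theorem fourierInv_toLp_ae_eq {h : Space → ℂ} (h1 : Integrable h) (h2 : MemLp h 2) :
    ⇑(𝓕⁻ (h2.toLp h) : Lp ℂ 2 (volume : Measure Space)) =ᵐ[volume] 𝓕⁻ h := by
  have hcont : Continuous (𝓕⁻ h) := by
    have := VectorFourier.fourierIntegral_continuous (L := -innerₗ Space) (μ := volume)
      Real.continuous_fourierChar (by
        simp only [LinearMap.neg_apply, innerₗ_apply_apply]; fun_prop) h1
    exact this
  -- Both sides are locally integrable, so it suffices to test against smooth compactly supported
  -- functions. There the L² transform agrees with the distributional one, and both transforms move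
  -- onto the test function.
  apply ae_eq_of_integral_contDiff_smul_eq
  · exact (Lp.memLp _).locallyIntegrable (by norm_num)
  · exact hcont.locallyIntegrable
  · intro g gs gc
    have hg₁ : HasCompactSupport (Complex.ofRealCLM ∘ g) := gc.comp_left rfl
    have hg₂ : ContDiff ℝ ∞ (Complex.ofRealCLM ∘ g) := by fun_prop
    set G : 𝓢(Space, ℂ) := hg₁.toSchwartzMap hg₂ with hG
    have e0 : ∀ x, G x = (g x : ℂ) := fun x => by simp [hG]
    have e1 := congrArg (fun T : 𝓢'(Space, ℂ) => T G)
      (Lp.fourierInv_toTemperedDistribution_eq (h2.toLp h))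
    simp only [Lp.toTemperedDistribution_apply, TemperedDistribution.fourierInv_apply, e0,
      ← Complex.coe_smul] at e1 ⊢
    rw [← e1]
    have e2 := integral_smul_fourierInv_eq h1 G.integrable
    simp only [e0] at e2
    rw [e2]
    apply integral_congr_ae
    filter_upwards [h2.coeFn_toLp] with x hx
    rw [hx, SchwartzMap.fourierInv_coe]

theorem memLp_fourierInv {h : Space → ℂ} (h1 : Integrable h) (h2 : MemLp h 2) :
    MemLp (𝓕⁻ h) 2 :=
  (memLp_congr_ae (fourierInv_toLp_ae_eq h1 h2)).1 (Lp.memLp _)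

theorem toLp_fourierInv {h : Space → ℂ} (h1 : Integrable h) (h2 : MemLp h 2) :
    (memLp_fourierInv h1 h2).toLp (𝓕⁻ h) = 𝓕⁻ (h2.toLp h) := by
  apply Lp.ext
  exact (MemLp.coeFn_toLp _).trans (fourierInv_toLp_ae_eq h1 h2).symm

/-- The Japanese bracket power `(1 + |ξ|²)^{s/2}`. -/
def jap (s : ℝ) (ξ : Space) : ℝ := (1 + ‖ξ‖ ^ 2) ^ (s / 2)

theorem jap_pos (s : ℝ) (ξ : Space) : 0 < jap s ξ := by unfold jap; positivity

theorem continuous_jap (s : ℝ) : Continuous (jap s) := by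
  unfold jap
  exact (by fun_prop : Continuous fun ξ : Space => 1 + ‖ξ‖ ^ 2).rpow_const
    (fun ξ => Or.inl (by positivity))

namespace SobolevH

/-- The inverse of the isometry `u ↦ (1 + |ξ|²)^{s/2} û` from `H^s` to `L²`. -/
def ofWeighted (s : ℝ) : Lp ℂ 2 (volume : Measure Space) →ₗ[ℂ] SobolevH s where
  toFun v := ⟨TemperedDistribution.besselPotential Space ℂ (-s)
      (Lp.toTemperedDistributionCLM ℂ volume 2 (𝓕⁻ v)), 𝓕⁻ v, by
        rw [TemperedDistribution.besselPotential_besselPotential_apply]; simp⟩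
  map_add' u v := Subtype.ext (by
    change TemperedDistribution.besselPotential Space ℂ (-s)
        (Lp.toTemperedDistributionCLM ℂ volume 2 (𝓕⁻ (u + v))) =
      TemperedDistribution.besselPotential Space ℂ (-s) _ +
      TemperedDistribution.besselPotential Space ℂ (-s) _
    rw [fourierInv_add, map_add, map_add])
  map_smul' c v := Subtype.ext (by
    change TemperedDistribution.besselPotential Space ℂ (-s)
        (Lp.toTemperedDistributionCLM ℂ volume 2 (𝓕⁻ (c • v))) =
      c • TemperedDistribution.besselPotential Space ℂ (-s) _
    rw [fourierInv_smul, map_smul, map_smul])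

theorem toDist_ofWeighted (s : ℝ) (v : Lp ℂ 2 (volume : Measure Space)) :
    toDist (ofWeighted s v) = TemperedDistribution.besselPotential Space ℂ (-s)
      (Lp.toTemperedDistributionCLM ℂ volume 2 (𝓕⁻ v)) := rfl

theorem norm_ofWeighted (s : ℝ) (v : Lp ℂ 2 (volume : Measure Space)) :
    ‖ofWeighted s v‖ = ‖v‖ := by
  have h : besselL2 (ofWeighted s v) = 𝓕⁻ v := by
    apply coeLp_injective
    rw [besselL2_spec, toDist_ofWeighted,
      TemperedDistribution.besselPotential_besselPotential_apply]
    simp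
  have h2 : ‖ofWeighted s v‖ = ‖besselL2 (ofWeighted s v)‖ := rfl
  rw [h2, h]
  have := Lp.norm_fourier_eq (𝓕⁻ v)
  rw [← this, fourier_fourierInv_eq]

end SobolevH

/-- The weight cancels: `ofWeighted` takes the inverse transform of ⟨ξ⟩^s h and then applies
⟨D⟩^{-s}. The comparison takes place among tempered distributions, where the Bessel potential is a
Fourier multiplier by definition. -/
theorem represents_ofWeighted (s : ℝ) {h : Space → ℂ} (h1 : Integrable h) (h2 : MemLp h 2)
    (h3 : MemLp (fun ξ => (jap s ξ : ℂ) * h ξ) 2) :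
    Represents (𝓕⁻ h) (SobolevH.ofWeighted s (h3.toLp _)) := by
  have key : TemperedDistribution.smulLeftCLM ℂ
      (fun x : Space => (((1 + ‖x‖ ^ 2) ^ (s / 2) : ℝ) : ℂ))
      (Lp.toTemperedDistribution (h2.toLp h)) = Lp.toTemperedDistribution (h3.toLp _) := by
    ext g
    rw [TemperedDistribution.smulLeftCLM_apply_apply, Lp.toTemperedDistribution_apply,
      Lp.toTemperedDistribution_apply]
    apply integral_congr_ae
    filter_upwards [h2.coeFn_toLp, h3.coeFn_toLp] with x hx hx'
    rw [hx, hx', SchwartzMap.smulLeftCLM_apply_apply (by fun_prop)]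
    simp only [jap, smul_eq_mul]
    ring
  refine ⟨memLp_fourierInv h1 h2, ?_⟩
  rw [SobolevH.toDist_ofWeighted, toLp_fourierInv h1 h2, Lp.toTemperedDistributionCLM_apply]
  symm
  rw [TemperedDistribution.besselPotential_neg_apply_eq_iff, TemperedDistribution.besselPotential,
    TemperedDistribution.fourierMultiplierCLM_apply,
    ← Lp.fourierInv_toTemperedDistribution_eq, ← Lp.fourierInv_toTemperedDistribution_eq,
    fourier_fourierInv_eq, key]

end SobolevFourier

/-! ### The weighted convolution algebra and Duhamel operators -/

noncomputable section WeightedAlgebra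

open FourierTransform
open scoped BoundedContinuousFunction

/-- The integrable factor of the weight. -/
def polyWt (ξ : Space) : ℝ := ((1 + ‖ξ‖) ^ 4)⁻¹

/-- The weight `e^{-|ξ|} (1 + |ξ|)^{-4}`. -/
def wt (ξ : Space) : ℝ := Real.exp (-‖ξ‖) * polyWt ξ

theorem polyWt_pos (ξ : Space) : 0 < polyWt ξ := by unfold polyWt; positivity

theorem wt_pos (ξ : Space) : 0 < wt ξ := mul_pos (Real.exp_pos _) (polyWt_pos ξ)

theorem continuous_polyWt : Continuous polyWt := by
  unfold polyWt
  exact Continuous.inv₀ (by fun_prop) (fun ξ => by positivity)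

theorem continuous_wt : Continuous wt := by
  have := continuous_polyWt
  unfold wt
  fun_prop

theorem integrable_polyWt : Integrable polyWt := by
  have h := integrable_one_add_norm (E := Space) (μ := volume) (r := 4) (by simp; norm_num)
  refine h.congr (Filter.Eventually.of_forall fun ξ => ?_)
  have : (0 : ℝ) ≤ 1 + ‖ξ‖ := by positivity
  simp only [polyWt]
  rw [Real.rpow_neg this]
  norm_cast

theorem wt_le_polyWt (ξ : Space) : wt ξ ≤ polyWt ξ := by
  have : Real.exp (-‖ξ‖) ≤ 1 := Real.exp_le_one_iff.2 (by simp)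
  exact mul_le_of_le_one_left (polyWt_pos ξ).le this

theorem polyWt_le_one (ξ : Space) : polyWt ξ ≤ 1 := by
  unfold polyWt
  exact inv_le_one_of_one_le₀ (one_le_pow₀ (by simp))

theorem wt_le_one (ξ : Space) : wt ξ ≤ 1 := (wt_le_polyWt ξ).trans (polyWt_le_one ξ)

theorem integrable_wt : Integrable wt :=
  integrable_polyWt.mono' continuous_wt.aestronglyMeasurable
    (Filter.Eventually.of_forall fun ξ => by
      rw [Real.norm_of_nonneg (wt_pos ξ).le]; exact wt_le_polyWt ξ)

theorem wt_neg (ξ : Space) : wt (-ξ) = wt ξ := by simp [wt, polyWt]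

/-- The exponentials multiply by the triangle inequality. The larger of |η| and |ξ - η| is at least
|ξ|/2, so its polynomial factor is at most 2⁴ `polyWt ξ`. The factor of the smaller frequency
remains and is integrable. Integration in η then shows that the weight is stable under convolution.
-/
theorem wt_mul_wt_sub_le (ξ η : Space) :
    wt η * wt (ξ - η) ≤ wt ξ * (16 * (polyWt η + polyWt (ξ - η))) := by
  have htri : ‖ξ‖ ≤ ‖η‖ + ‖ξ - η‖ := by
    have := norm_add_le η (ξ - η); simpa using this
  have hexp : Real.exp (-‖η‖) * Real.exp (-‖ξ - η‖) ≤ Real.exp (-‖ξ‖) := by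
    rw [← Real.exp_add]; exact Real.exp_le_exp.2 (by linarith)
  have hpoly : polyWt η * polyWt (ξ - η) ≤ polyWt ξ * (16 * (polyWt η + polyWt (ξ - η))) := by
    have ha : (0 : ℝ) ≤ ‖η‖ := norm_nonneg _
    have hb : (0 : ℝ) ≤ ‖ξ - η‖ := norm_nonneg _
    have hc : (0 : ℝ) ≤ ‖ξ‖ := norm_nonneg _
    have key : ∀ a b c : ℝ, 0 ≤ a → 0 ≤ b → 0 ≤ c → c ≤ a + b → a ≤ b →
        ((1 + a) ^ 4)⁻¹ * ((1 + b) ^ 4)⁻¹ ≤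
          ((1 + c) ^ 4)⁻¹ * (16 * (((1 + a) ^ 4)⁻¹ + ((1 + b) ^ 4)⁻¹)) := by
      intro a b c ha hb hc habc hab
      have h1 : ((1 + b) ^ 4)⁻¹ ≤ ((1 + c) ^ 4)⁻¹ * 16 := by
        have h2 : (1 + c) ^ 4 ≤ (2 * (1 + b)) ^ 4 := by gcongr; linarith
        rw [inv_mul_eq_div, le_div_iff₀ (by positivity), inv_mul_le_iff₀ (by positivity)]
        calc (1 + c) ^ 4 ≤ (2 * (1 + b)) ^ 4 := h2
          _ = (1 + b) ^ 4 * 16 := by ring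
      calc ((1 + a) ^ 4)⁻¹ * ((1 + b) ^ 4)⁻¹
          ≤ ((1 + a) ^ 4)⁻¹ * (((1 + c) ^ 4)⁻¹ * 16) := by gcongr
        _ = ((1 + c) ^ 4)⁻¹ * (16 * (((1 + a) ^ 4)⁻¹ + 0)) := by ring
        _ ≤ _ := by gcongr; positivity
    unfold polyWt
    rcases le_total ‖η‖ ‖ξ - η‖ with h | h
    · exact key _ _ _ ha hb hc htri h
    · have := key _ _ _ hb ha hc (by linarith) h
      rw [mul_comm, add_comm (((1 + ‖η‖) ^ 4)⁻¹)]
      exact this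
  calc wt η * wt (ξ - η)
      = (Real.exp (-‖η‖) * Real.exp (-‖ξ - η‖)) * (polyWt η * polyWt (ξ - η)) := by
        unfold wt; ring
    _ ≤ Real.exp (-‖ξ‖) * (polyWt ξ * (16 * (polyWt η + polyWt (ξ - η)))) := by
        gcongr
        exact mul_nonneg (polyWt_pos _).le (polyWt_pos _).le
    _ = _ := by unfold wt; ring

/-- The constant in the algebra property of the weight. -/
def convConst : ℝ := 32 * ∫ η, polyWt η

theorem convConst_nonneg : 0 ≤ convConst :=
  mul_nonneg (by norm_num) (integral_nonneg fun η => (polyWt_pos η).le)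

theorem integral_wt_mul_wt_sub_le (ξ : Space) :
    ∫ η, wt η * wt (ξ - η) ≤ convConst * wt ξ := by
  have hi := integrable_polyWt.comp_sub_left ξ
  calc ∫ η, wt η * wt (ξ - η)
      ≤ ∫ η, wt ξ * (16 * (polyWt η + polyWt (ξ - η))) := by
        apply integral_mono_of_nonneg
        · exact Filter.Eventually.of_forall fun η => mul_nonneg (wt_pos _).le (wt_pos _).le
        · exact ((integrable_polyWt.add hi).const_mul 16).const_mul _
        · exact Filter.Eventually.of_forall fun η => wt_mul_wt_sub_le ξ η
    _ = convConst * wt ξ := by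
        rw [integral_const_mul, integral_const_mul, integral_add integrable_polyWt hi,
          integral_sub_left_eq_self polyWt volume ξ, convConst]
        ring

/-- Time-dependent densities on Fourier space, relative to the weight `wt`. -/
abbrev Alg : Type := (ℝ × Space) →ᵇ ℂ

/-- The spatial Fourier transform at time `t` encoded by `b`. -/
def dens (b : Alg) (t : ℝ) (ξ : Space) : ℂ := wt ξ * b (t, ξ)

theorem norm_dens_le (b : Alg) (t : ℝ) (ξ : Space) : ‖dens b t ξ‖ ≤ ‖b‖ * wt ξ := by
  rw [dens, norm_mul, Complex.norm_real, Real.norm_of_nonneg (wt_pos ξ).le, mul_comm]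
  gcongr
  · exact (wt_pos ξ).le
  · exact b.norm_coe_le_norm _

theorem continuous_dens (b : Alg) : Continuous fun p : ℝ × Space => dens b p.1 p.2 := by
  have := continuous_wt
  unfold dens
  fun_prop

theorem continuous_dens_comp {X : Type*} [TopologicalSpace X] (b : Alg) {f : X → ℝ} {g : X → Space}
    (hf : Continuous f) (hg : Continuous g) : Continuous fun x => dens b (f x) (g x) := by
  unfold dens
  exact (Complex.continuous_ofReal.comp (continuous_wt.comp hg)).mul
    (b.continuous.comp (hf.prodMk hg))

theorem continuous_dens_right (b : Alg) (t : ℝ) : Continuous (dens b t) :=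
  continuous_dens_comp b continuous_const continuous_id

theorem dens_ext {a b : Alg} (h : ∀ t ξ, dens a t ξ = dens b t ξ) : a = b := by
  ext ⟨t, ξ⟩
  have := h t ξ
  have hw : (wt ξ : ℂ) ≠ 0 := by exact_mod_cast (wt_pos ξ).ne'
  exact mul_left_cancel₀ hw this

theorem norm_le_of_dens {b : Alg} {C : ℝ} (hC : 0 ≤ C) (h : ∀ t ξ, ‖dens b t ξ‖ ≤ C * wt ξ) :
    ‖b‖ ≤ C := by
  rw [BoundedContinuousFunction.norm_le hC]
  rintro ⟨t, ξ⟩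
  have := h t ξ
  rw [dens, norm_mul, Complex.norm_real, Real.norm_of_nonneg (wt_pos ξ).le, mul_comm] at this
  exact le_of_mul_le_mul_right this (wt_pos ξ)

@[simp] theorem dens_add (a b : Alg) (t : ℝ) (ξ : Space) :
    dens (a + b) t ξ = dens a t ξ + dens b t ξ := by simp [dens, mul_add]

@[simp] theorem dens_sub (a b : Alg) (t : ℝ) (ξ : Space) :
    dens (a - b) t ξ = dens a t ξ - dens b t ξ := by simp [dens, mul_sub]

@[simp] theorem dens_neg (a : Alg) (t : ℝ) (ξ : Space) :
    dens (-a) t ξ = -dens a t ξ := by simp [dens]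

@[simp] theorem dens_zero (t : ℝ) (ξ : Space) : dens 0 t ξ = 0 := by simp [dens]

@[simp] theorem dens_smul (c : ℝ) (a : Alg) (t : ℝ) (ξ : Space) :
    dens (c • a) t ξ = c * dens a t ξ := by simp [dens]; ring

theorem dens_sum {ι : Type*} (s : Finset ι) (a : ι → Alg) (t : ℝ) (ξ : Space) :
    dens (∑ i ∈ s, a i) t ξ = ∑ i ∈ s, dens (a i) t ξ := by
  simp [dens, Finset.mul_sum]

/-- The element of `Alg` with a given density. -/
def ofDens (h : ℝ → Space → ℂ) (hc : Continuous fun p : ℝ × Space => h p.1 p.2)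
    (hb : ∃ C, ∀ t ξ, ‖h t ξ‖ ≤ C * wt ξ) : Alg :=
  BoundedContinuousFunction.ofNormedAddCommGroup (fun p => (wt p.2 : ℂ)⁻¹ * h p.1 p.2)
    (by
      refine Continuous.mul (Continuous.inv₀ ?_ fun p => ?_) hc
      · exact Complex.continuous_ofReal.comp (continuous_wt.comp continuous_snd)
      · exact_mod_cast (wt_pos p.2).ne') hb.choose
    (by
      intro p
      rw [norm_mul, norm_inv, Complex.norm_real, Real.norm_of_nonneg (wt_pos _).le,
        inv_mul_le_iff₀ (wt_pos _), mul_comm]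
      exact hb.choose_spec p.1 p.2)

@[simp] theorem dens_ofDens (h : ℝ → Space → ℂ) (hc hb) (t : ℝ) (ξ : Space) :
    dens (ofDens h hc hb) t ξ = h t ξ := by
  have hw : (wt ξ : ℂ) ≠ 0 := by exact_mod_cast (wt_pos ξ).ne'
  simp [dens, ofDens, hw]

theorem integrable_dens (b : Alg) (t : ℝ) : Integrable (dens b t) :=
  (integrable_wt.const_mul ‖b‖).mono' (continuous_dens_right b t).aestronglyMeasurable
    (Filter.Eventually.of_forall fun ξ => norm_dens_le b t ξ)

theorem norm_dens_mul_dens_le (a b : Alg) (t : ℝ) (ξ η : Space) :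
    ‖dens a t η * dens b t (ξ - η)‖ ≤ ‖a‖ * ‖b‖ * (wt η * wt (ξ - η)) := by
  rw [norm_mul]
  calc _ ≤ (‖a‖ * wt η) * (‖b‖ * wt (ξ - η)) := by
        gcongr
        · exact mul_nonneg (norm_nonneg _) (wt_pos _).le
        · exact norm_dens_le _ _ _
        · exact norm_dens_le _ _ _
    _ = _ := by ring

/-- The convolution of two densities. -/
def convDens (a b : Alg) (t : ℝ) (ξ : Space) : ℂ := ∫ η, dens a t η * dens b t (ξ - η)

theorem integrable_wt_mul_wt_sub (ξ : Space) : Integrable fun η => wt η * wt (ξ - η) :=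
  integrable_wt.mono'
    (continuous_wt.mul (continuous_wt.comp (by fun_prop))).aestronglyMeasurable
    (Filter.Eventually.of_forall fun η => by
      rw [Real.norm_of_nonneg (mul_nonneg (wt_pos _).le (wt_pos _).le)]
      exact mul_le_of_le_one_right (wt_pos _).le (wt_le_one _))

theorem integrable_dens_mul_dens (a b : Alg) (t : ℝ) (ξ : Space) :
    Integrable fun η => dens a t η * dens b t (ξ - η) :=
  ((integrable_wt_mul_wt_sub ξ).const_mul (‖a‖ * ‖b‖)).mono'
    ((continuous_dens_right a t).mul
      (continuous_dens_comp b continuous_const (by fun_prop))).aestronglyMeasurable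
    (Filter.Eventually.of_forall fun η => norm_dens_mul_dens_le a b t ξ η)

theorem continuous_convDens (a b : Alg) :
    Continuous fun p : ℝ × Space => convDens a b p.1 p.2 := by
  -- Estimating wt (ξ - η) by 1 makes the majorant independent of (t, ξ).
  refine continuous_of_dominated (bound := fun η => ‖a‖ * ‖b‖ * wt η) ?_ ?_ ?_ ?_
  · exact fun p => (integrable_dens_mul_dens a b p.1 p.2).aestronglyMeasurable
  · refine fun p => Filter.Eventually.of_forall fun η => ?_
    refine (norm_dens_mul_dens_le a b p.1 p.2 η).trans ?_
    gcongr
    exact mul_le_of_le_one_right (wt_pos _).le (wt_le_one _)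
  · exact integrable_wt.const_mul _
  · refine Filter.Eventually.of_forall fun η => ?_
    exact (continuous_dens_comp a (by fun_prop) (by fun_prop)).mul
      (continuous_dens_comp b (by fun_prop) (by fun_prop))

theorem norm_convDens_le (a b : Alg) (t : ℝ) (ξ : Space) :
    ‖convDens a b t ξ‖ ≤ (convConst * ‖a‖ * ‖b‖) * wt ξ := by
  calc ‖convDens a b t ξ‖ ≤ ∫ η, ‖a‖ * ‖b‖ * (wt η * wt (ξ - η)) :=
        norm_integral_le_of_norm_le ((integrable_wt_mul_wt_sub ξ).const_mul _)
          (Filter.Eventually.of_forall fun η => norm_dens_mul_dens_le a b t ξ η)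
    _ = ‖a‖ * ‖b‖ * ∫ η, wt η * wt (ξ - η) := integral_const_mul _ _
    _ ≤ ‖a‖ * ‖b‖ * (convConst * wt ξ) := by
        gcongr; exact integral_wt_mul_wt_sub_le ξ
    _ = _ := by ring

/-- Convolution of densities, which is multiplication of the functions on spacetime. -/
def convAlg (a b : Alg) : Alg :=
  ofDens (convDens a b) (continuous_convDens a b) ⟨_, norm_convDens_le a b⟩

theorem dens_convAlg (a b : Alg) (t : ℝ) (ξ : Space) :
    dens (convAlg a b) t ξ = ∫ η, dens a t η * dens b t (ξ - η) := dens_ofDens _ _ _ _ _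

/-- Convolution as a bilinear map. -/
def convBilin : Alg →ₗ[ℝ] Alg →ₗ[ℝ] Alg :=
  LinearMap.mk₂ ℝ convAlg
    (fun a a' b => dens_ext fun t ξ => by
      simp only [dens_convAlg, dens_add, add_mul]
      exact integral_add (integrable_dens_mul_dens a b t ξ) (integrable_dens_mul_dens a' b t ξ))
    (fun c a b => dens_ext fun t ξ => by
      simp only [dens_convAlg, dens_smul, mul_assoc]
      exact integral_const_mul _ _)
    (fun a b b' => dens_ext fun t ξ => by
      simp only [dens_convAlg, dens_add, mul_add]
      exact integral_add (integrable_dens_mul_dens a b t ξ) (integrable_dens_mul_dens a b' t ξ))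
    (fun c a b => dens_ext fun t ξ => by
      simp only [dens_convAlg, dens_smul, mul_left_comm _ (c : ℂ)]
      exact integral_const_mul _ _)

theorem norm_convAlg_le (a b : Alg) : ‖convAlg a b‖ ≤ convConst * ‖a‖ * ‖b‖ := by
  refine norm_le_of_dens
    (mul_nonneg (mul_nonneg convConst_nonneg (norm_nonneg _)) (norm_nonneg _)) fun t ξ => ?_
  rw [dens_convAlg]
  exact norm_convDens_le a b t ξ

/-- Convolution as a bounded bilinear map. -/
def convL : Alg →L[ℝ] Alg →L[ℝ] Alg :=
  LinearMap.mkContinuous₂ convBilin convConst norm_convAlg_le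

theorem dens_convL (a b : Alg) (t : ℝ) (ξ : Space) :
    dens (convL a b) t ξ = ∫ η, dens a t η * dens b t (ξ - η) := dens_convAlg a b t ξ

/-- The function on spacetime with spatial Fourier transform `dens b`. -/
def ev (b : Alg) (p : Spacetime) : ℂ := 𝓕⁻ (dens b p.1) p.2

/-- The convolution theorem, applied at -x because the inverse transform at x is the transform at
-x. Through it, identities in the convolution algebra become identities between pointwise products.
-/
theorem ev_convL (a b : Alg) (p : Spacetime) : ev (convL a b) p = ev a p * ev b p := by
  have h := Real.fourier_mul_convolution_eq (R := ℂ) (integrable_dens a p.1)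
    (integrable_dens b p.1) (-p.2)
  simp only [ev, Real.fourierInv_eq_fourier_neg]
  rw [← h]
  exact congrArg (fun f : Space → ℂ => 𝓕 f (-p.2)) (funext fun ξ => dens_convL a b p.1 ξ)

theorem ev_apply (b : Alg) (p : Spacetime) :
    ev b p = ∫ ξ, Real.fourierChar (inner ℝ ξ p.2) • dens b p.1 ξ :=
  Real.fourierInv_eq _ _

theorem integrable_char_smul {h : Space → ℂ} (hh : Integrable h) (x : Space) :
    Integrable fun ξ => Real.fourierChar (inner ℝ ξ x) • h ξ := by
  have := (Real.fourierIntegral_convergent_iff (μ := (volume : Measure Space)) (f := h) (-x)).2 hh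
  simpa using this

theorem ev_add (a b : Alg) (p : Spacetime) : ev (a + b) p = ev a p + ev b p := by
  simp only [ev_apply, dens_add, smul_add]
  exact integral_add (integrable_char_smul (integrable_dens a _) _)
    (integrable_char_smul (integrable_dens b _) _)

theorem ev_smul (c : ℝ) (a : Alg) (p : Spacetime) : ev (c • a) p = c * ev a p := by
  simp only [ev_apply, dens_smul]
  rw [← integral_const_mul]
  congr 1
  ext ξ
  rw [Circle.smul_def, Circle.smul_def, smul_eq_mul, smul_eq_mul]
  ring

/-- Evaluation at a point of spacetime as a linear map. -/
def evL (p : Spacetime) : Alg →ₗ[ℝ] ℂ where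
  toFun b := ev b p
  map_add' a b := ev_add a b p
  map_smul' c a := by simp [ev_smul]

/-- Truncation to the time interval `[-T, T]`. -/
def clampTime (T t : ℝ) : ℝ := max (-T) (min t T)

theorem continuous_clampTime (T : ℝ) : Continuous (clampTime T) := by
  unfold clampTime; fun_prop

theorem clampTime_of_mem {T t : ℝ} (h : t ∈ Icc (-T) T) : clampTime T t = t := by
  simp [clampTime, h.1, h.2]

theorem abs_clampTime_le {T : ℝ} (hT : 0 ≤ T) (t : ℝ) : |clampTime T t| ≤ T := by
  rw [abs_le, clampTime]
  exact ⟨le_max_left _ _, max_le (by linarith) (min_le_right _ _)⟩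

/-- The Duhamel integral with multiplier `m`. -/
def duhDens (T : ℝ) (m : ℝ → Space → ℂ) (u : Alg) (t : ℝ) (ξ : Space) : ℂ :=
  ∫ s in (0 : ℝ)..clampTime T t, m (clampTime T t - s) ξ * dens u s ξ

theorem continuous_duhDens (T : ℝ) {m : ℝ → Space → ℂ}
    (hm : Continuous fun p : ℝ × Space => m p.1 p.2) (u : Alg) :
    Continuous fun p : ℝ × Space => duhDens T m u p.1 p.2 := by
  have hc := continuous_clampTime T
  unfold duhDens
  refine intervalIntegral.continuous_parametric_intervalIntegral_of_continuous
    (f := fun (p : ℝ × Space) s => m (clampTime T p.1 - s) p.2 * dens u s p.2) ?_ (by fun_prop)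
  exact (hm.comp (by fun_prop :
      Continuous fun q : (ℝ × Space) × ℝ => (clampTime T q.1.1 - q.2, q.1.2))).mul
    (continuous_dens_comp u (by fun_prop) (by fun_prop))

/-- Both the final time and the integration variable lie in [-T, T], so the propagator is evaluated
only at |τ| ≤ 2T. The truncation of time keeps the integral bounded for all real t, as membership in
`Alg` demands. -/
theorem norm_duhDens_le {T : ℝ} (hT : 0 ≤ T) {m : ℝ → Space → ℂ} {B : ℝ}
    (hB : ∀ τ ξ, |τ| ≤ 2 * T → ‖m τ ξ‖ ≤ B) (u : Alg) (t : ℝ) (ξ : Space) :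
    ‖duhDens T m u t ξ‖ ≤ (T * B * ‖u‖) * wt ξ := by
  have hB0 : 0 ≤ B := (norm_nonneg _).trans (hB 0 0 (by simpa using hT))
  have hcl := abs_clampTime_le hT t
  have hu : 0 ≤ ‖u‖ * wt ξ := mul_nonneg (norm_nonneg _) (wt_pos ξ).le
  have h := intervalIntegral.norm_integral_le_of_norm_le_const (a := 0) (b := clampTime T t)
    (f := fun s => m (clampTime T t - s) ξ * dens u s ξ) (C := B * (‖u‖ * wt ξ)) (by
      intro s hs
      rw [norm_mul]
      have hs' : |s| ≤ T := by
        rcases le_total 0 (clampTime T t) with h0 | h0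
        · rw [uIoc_of_le h0] at hs
          rw [abs_of_pos hs.1]
          exact hs.2.trans ((le_abs_self _).trans hcl)
        · rw [uIoc_of_ge h0] at hs
          rw [abs_of_nonpos hs.2]
          rw [abs_of_nonpos h0] at hcl
          linarith [hs.1]
      gcongr
      · exact hB _ _ ((abs_sub _ _).trans (by linarith))
      · exact norm_dens_le _ _ _)
  calc ‖duhDens T m u t ξ‖ ≤ B * (‖u‖ * wt ξ) * |clampTime T t - 0| := h
    _ ≤ B * (‖u‖ * wt ξ) * T := by rw [sub_zero]; gcongr
    _ = _ := by ring

theorem intervalIntegrable_duh {m : ℝ → Space → ℂ}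
    (hm : Continuous fun p : ℝ × Space => m p.1 p.2) (u : Alg) (a b c : ℝ) (ξ : Space) :
    IntervalIntegrable (fun s => m (c - s) ξ * dens u s ξ) volume a b := by
  apply Continuous.intervalIntegrable
  exact (hm.comp (by fun_prop : Continuous fun s : ℝ => (c - s, ξ))).mul
    (continuous_dens_comp u (by fun_prop) (by fun_prop))

/-- A continuous multiplier, bounded on bounded time intervals uniformly in frequency. -/
structure IsMultiplier (m : ℝ → Space → ℂ) : Prop where
  cont : Continuous fun p : ℝ × Space => m p.1 p.2
  bdd : ∀ R : ℝ, ∃ B, ∀ τ ξ, |τ| ≤ R → ‖m τ ξ‖ ≤ B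

/-- The Duhamel integral with multiplier `m`, as an element of `Alg`. -/
def duhAlg {T : ℝ} (hT : 0 ≤ T) {m : ℝ → Space → ℂ} (hm : IsMultiplier m) (u : Alg) : Alg :=
  ofDens (duhDens T m u) (continuous_duhDens T hm.cont u)
    ⟨_, norm_duhDens_le hT (hm.bdd (2 * T)).choose_spec u⟩

theorem dens_duhAlg {T : ℝ} (hT : 0 ≤ T) {m : ℝ → Space → ℂ} (hm : IsMultiplier m) (u : Alg)
    (t : ℝ) (ξ : Space) : dens (duhAlg hT hm u) t ξ = duhDens T m u t ξ :=
  dens_ofDens (duhDens T m u) (continuous_duhDens T hm.cont u) _ t ξ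

/-- The Duhamel integral as a linear map. -/
def duhLin {T : ℝ} (hT : 0 ≤ T) {m : ℝ → Space → ℂ} (hm : IsMultiplier m) : Alg →ₗ[ℝ] Alg where
  toFun := duhAlg hT hm
  map_add' u v := dens_ext fun t ξ => by
    simp only [dens_duhAlg, duhDens, dens_add, mul_add]
    exact intervalIntegral.integral_add (intervalIntegrable_duh hm.cont u _ _ _ _)
      (intervalIntegrable_duh hm.cont v _ _ _ _)
  map_smul' c u := dens_ext fun t ξ => by
    simp only [dens_duhAlg, duhDens, dens_smul, RingHom.id_apply, mul_left_comm _ (c : ℂ)]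
    exact intervalIntegral.integral_const_mul _ _

theorem norm_duhAlg_le {T : ℝ} (hT : 0 ≤ T) {m : ℝ → Space → ℂ} (hm : IsMultiplier m) (u : Alg) :
    ‖duhAlg hT hm u‖ ≤ T * (hm.bdd (2 * T)).choose * ‖u‖ := by
  refine norm_le_of_dens (mul_nonneg (mul_nonneg hT ((norm_nonneg _).trans
    ((hm.bdd (2 * T)).choose_spec 0 0 (by simpa using hT)))) (norm_nonneg _)) fun t ξ => ?_
  rw [dens_duhAlg]
  exact norm_duhDens_le hT (hm.bdd (2 * T)).choose_spec u t ξ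

/-- The Duhamel integral with multiplier `m` as a bounded operator. -/
def duhL {T : ℝ} (hT : 0 ≤ T) {m : ℝ → Space → ℂ} (hm : IsMultiplier m) : Alg →L[ℝ] Alg :=
  LinearMap.mkContinuous (duhLin hT hm) _ (norm_duhAlg_le hT hm)

theorem dens_duhL {T : ℝ} (hT : 0 ≤ T) {m : ℝ → Space → ℂ} (hm : IsMultiplier m) (u : Alg)
    (t : ℝ) (ξ : Space) :
    dens (duhL hT hm u) t ξ =
      ∫ s in (0 : ℝ)..clampTime T t, m (clampTime T t - s) ξ * dens u s ξ :=
  dens_duhAlg hT hm u t ξ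

end WeightedAlgebra

/-! ### Time regularity of densities and smoothness in spacetime -/

noncomputable section TimeRegularity

open FourierTransform

/-- Joint continuity and rapid decay in frequency, uniformly for times in `I`. -/
structure RapidOn (I : Set ℝ) (h : ℝ → Space → ℂ) : Prop where
  cont : ContinuousOn (fun p : ℝ × Space => h p.1 p.2) (I ×ˢ univ)
  decay : ∀ k : ℕ, ∃ C, ∀ t ∈ I, ∀ ξ, (1 + ‖ξ‖) ^ k * ‖h t ξ‖ ≤ C

/-- `h` has `m` derivatives in time, all of them rapidly decaying in frequency. -/
def Reg (I : Set ℝ) : ℕ → (ℝ → Space → ℂ) → Prop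
  | 0, h => RapidOn I h
  | m + 1, h => RapidOn I h ∧ ∃ h', Reg I m h' ∧
      ∀ t ∈ I, ∀ ξ, HasDerivAt (fun τ => h τ ξ) (h' t ξ) t

variable {I : Set ℝ} {h g : ℝ → Space → ℂ}

theorem Reg.rapid {m : ℕ} (hh : Reg I m h) : RapidOn I h := by
  cases m with
  | zero => exact hh
  | succ m => exact hh.1

theorem Reg.of_succ {m : ℕ} (hh : Reg I (m + 1) h) : Reg I m h := by
  induction m generalizing h with
  | zero => exact hh.1
  | succ m ih =>
    obtain ⟨h1, h', h2, h3⟩ := hh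
    exact ⟨h1, h', ih h2, h3⟩

theorem RapidOn.contSlice (hh : RapidOn I h) {t : ℝ} (ht : t ∈ I) : Continuous (h t) := by
  have := hh.cont.comp (f := fun ξ : Space => (t, ξ)) (s := univ) (by fun_prop)
    (fun ξ _ => ⟨ht, mem_univ _⟩)
  exact continuousOn_univ.1 this

/-- Four further powers of 1 + |ξ| pay for the integrable factor. -/
theorem RapidOn.decay_polyWt (hh : RapidOn I h) (k : ℕ) :
    ∃ C, 0 ≤ C ∧ ∀ t ∈ I, ∀ ξ, (1 + ‖ξ‖) ^ k * ‖h t ξ‖ ≤ C * polyWt ξ := by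
  obtain ⟨C, hC⟩ := hh.decay (k + 4)
  refine ⟨max C 0, le_max_right _ _, fun t ht ξ => ?_⟩
  rw [polyWt, ← div_eq_mul_inv, le_div_iff₀ (by positivity)]
  calc (1 + ‖ξ‖) ^ k * ‖h t ξ‖ * (1 + ‖ξ‖) ^ 4 = (1 + ‖ξ‖) ^ (k + 4) * ‖h t ξ‖ := by ring
    _ ≤ C := hC t ht ξ
    _ ≤ _ := le_max_left _ _

theorem RapidOn.norm_le (hh : RapidOn I h) :
    ∃ C, 0 ≤ C ∧ ∀ t ∈ I, ∀ ξ, ‖h t ξ‖ ≤ C * polyWt ξ := by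
  simpa using hh.decay_polyWt 0

theorem RapidOn.integrable (hh : RapidOn I h) {t : ℝ} (ht : t ∈ I) : Integrable (h t) := by
  obtain ⟨C, -, hC⟩ := hh.norm_le
  exact (integrable_polyWt.const_mul C).mono' (hh.contSlice ht).aestronglyMeasurable
    (Filter.Eventually.of_forall fun ξ => hC t ht ξ)

theorem RapidOn.add (hh : RapidOn I h) (hg : RapidOn I g) :
    RapidOn I (fun t ξ => h t ξ + g t ξ) where
  cont := hh.cont.add hg.cont
  decay k := by
    obtain ⟨C, hC⟩ := hh.decay k
    obtain ⟨D, hD⟩ := hg.decay k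
    refine ⟨C + D, fun t ht ξ => ?_⟩
    calc _ ≤ (1 + ‖ξ‖) ^ k * (‖h t ξ‖ + ‖g t ξ‖) := by gcongr; exact norm_add_le _ _
      _ ≤ C + D := by rw [mul_add]; exact add_le_add (hC t ht ξ) (hD t ht ξ)

/-- A continuous function of frequency of polynomial growth. -/
structure PolyGrowth (q : Space → ℂ) : Prop where
  cont : Continuous q
  bound : ∃ (K : ℝ) (j : ℕ), 0 ≤ K ∧ ∀ ξ, ‖q ξ‖ ≤ K * (1 + ‖ξ‖) ^ j

theorem PolyGrowth.const (c : ℂ) : PolyGrowth (fun _ => c) :=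
  ⟨continuous_const, ‖c‖, 0, norm_nonneg _, fun ξ => by simp⟩

theorem RapidOn.mul_poly {q : Space → ℂ} (hq : PolyGrowth q) (hh : RapidOn I h) :
    RapidOn I (fun t ξ => q ξ * h t ξ) where
  cont := (hq.cont.comp continuous_snd).continuousOn.mul hh.cont
  decay k := by
    obtain ⟨K, j, hK, hb⟩ := hq.bound
    obtain ⟨C, hC⟩ := hh.decay (k + j)
    refine ⟨K * C, fun t ht ξ => ?_⟩
    rw [norm_mul]
    calc (1 + ‖ξ‖) ^ k * (‖q ξ‖ * ‖h t ξ‖)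
        ≤ (1 + ‖ξ‖) ^ k * (K * (1 + ‖ξ‖) ^ j * ‖h t ξ‖) := by gcongr; exact hb ξ
      _ = K * ((1 + ‖ξ‖) ^ (k + j) * ‖h t ξ‖) := by ring
      _ ≤ K * C := by gcongr; exact hC t ht ξ

theorem Reg.add {m : ℕ} (hh : Reg I m h) (hg : Reg I m g) :
    Reg I m (fun t ξ => h t ξ + g t ξ) := by
  induction m generalizing h g with
  | zero => exact RapidOn.add hh hg
  | succ m ih =>
    obtain ⟨h1, h', h2, h3⟩ := hh
    obtain ⟨g1, g', g2, g3⟩ := hg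
    exact ⟨h1.add g1, _, ih h2 g2, fun t ht ξ => (h3 t ht ξ).add (g3 t ht ξ)⟩

theorem Reg.mul_poly {m : ℕ} {q : Space → ℂ} (hq : PolyGrowth q) (hh : Reg I m h) :
    Reg I m (fun t ξ => q ξ * h t ξ) := by
  induction m generalizing h with
  | zero => exact RapidOn.mul_poly hq hh
  | succ m ih =>
    obtain ⟨h1, h', h2, h3⟩ := hh
    exact ⟨h1.mul_poly hq, _, ih h2, fun t ht ξ => (h3 t ht ξ).const_mul _⟩

theorem Reg.sub {m : ℕ} (hh : Reg I m h) (hg : Reg I m g) :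
    Reg I m (fun t ξ => h t ξ - g t ξ) := by
  have := hh.add (hg.mul_poly (PolyGrowth.const (-1)))
  simpa [sub_eq_add_neg] using this

theorem Reg.zero (m : ℕ) : Reg I m (fun _ _ => 0) := by
  have h0 : RapidOn I (fun _ _ => 0) := ⟨continuousOn_const, fun k => ⟨0, by simp⟩⟩
  induction m with
  | zero => exact h0
  | succ m ih => exact ⟨h0, _, ih, fun t _ _ => hasDerivAt_const t 0⟩

/-- The inequality 1 + |ξ| ≤ (1 + |η|)(1 + |ξ - η|) distributes the powers over the two factors. The
majorant is integrable in η and uniform in t and ξ, so it serves the continuity, the decay and the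
differentiation of convolutions alike. -/
theorem RapidOn.conv_bound (hh : RapidOn I h) (hg : RapidOn I g) (k : ℕ) :
    ∃ C, 0 ≤ C ∧ ∀ t ∈ I, ∀ ξ η,
      (1 + ‖ξ‖) ^ k * ‖h t η * g t (ξ - η)‖ ≤ C * polyWt η := by
  obtain ⟨C, hC0, hC⟩ := hh.decay_polyWt k
  obtain ⟨D, hD⟩ := hg.decay k
  refine ⟨C * max D 0, by positivity, fun t ht ξ η => ?_⟩
  have htri : 1 + ‖ξ‖ ≤ (1 + ‖η‖) * (1 + ‖ξ - η‖) := by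
    have h1 := norm_add_le η (ξ - η)
    rw [add_sub_cancel] at h1
    nlinarith [norm_nonneg η, norm_nonneg (ξ - η)]
  rw [norm_mul]
  calc (1 + ‖ξ‖) ^ k * (‖h t η‖ * ‖g t (ξ - η)‖)
      ≤ ((1 + ‖η‖) * (1 + ‖ξ - η‖)) ^ k * (‖h t η‖ * ‖g t (ξ - η)‖) := by gcongr
    _ = ((1 + ‖η‖) ^ k * ‖h t η‖) * ((1 + ‖ξ - η‖) ^ k * ‖g t (ξ - η)‖) := by
        rw [mul_pow]; ring
    _ ≤ (C * polyWt η) * max D 0 :=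
        mul_le_mul (hC t ht η) ((hD t ht _).trans (le_max_left _ _)) (by positivity)
          (mul_nonneg hC0 (polyWt_pos _).le)
    _ = _ := by ring

theorem RapidOn.conv_bound_zero (hh : RapidOn I h) (hg : RapidOn I g) :
    ∃ C, 0 ≤ C ∧ ∀ t ∈ I, ∀ ξ η, ‖h t η * g t (ξ - η)‖ ≤ C * polyWt η := by
  simpa using hh.conv_bound hg 0

theorem RapidOn.continuous_conv_slice (hh : RapidOn I h) (hg : RapidOn I g) {t : ℝ} (ht : t ∈ I)
    (ξ : Space) : Continuous (fun η => h t η * g t (ξ - η)) :=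
  (hh.contSlice ht).mul ((hg.contSlice ht).comp (by fun_prop))

theorem RapidOn.integrable_conv (hh : RapidOn I h) (hg : RapidOn I g) {t : ℝ} (ht : t ∈ I)
    (ξ : Space) : Integrable (fun η => h t η * g t (ξ - η)) := by
  obtain ⟨C, -, hC⟩ := hh.conv_bound_zero hg
  exact (integrable_polyWt.const_mul C).mono'
    (hh.continuous_conv_slice hg ht ξ).aestronglyMeasurable
    (Filter.Eventually.of_forall fun η => hC t ht ξ η)

theorem RapidOn.conv (hh : RapidOn I h) (hg : RapidOn I g) :
    RapidOn I (fun t ξ => ∫ η, h t η * g t (ξ - η)) where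
  cont := by
    obtain ⟨C, -, hC⟩ := hh.conv_bound_zero hg
    refine continuousOn_of_dominated (bound := fun η => C * polyWt η) ?_ ?_ ?_ ?_
    · exact fun p hp => (hh.integrable_conv hg hp.1 p.2).aestronglyMeasurable
    · exact fun p hp => Filter.Eventually.of_forall fun η => hC p.1 hp.1 p.2 η
    · exact integrable_polyWt.const_mul C
    · refine Filter.Eventually.of_forall fun η => ContinuousOn.mul ?_ ?_
      · exact hh.cont.comp (f := fun p : ℝ × Space => (p.1, η)) (by fun_prop)
          (fun p hp => ⟨hp.1, mem_univ _⟩)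
      · exact hg.cont.comp (f := fun p : ℝ × Space => (p.1, p.2 - η)) (by fun_prop)
          (fun p hp => ⟨hp.1, mem_univ _⟩)
  decay k := by
    obtain ⟨C, hC0, hC⟩ := hh.conv_bound hg k
    refine ⟨∫ η, C * polyWt η, fun t ht ξ => ?_⟩
    calc (1 + ‖ξ‖) ^ k * ‖∫ η, h t η * g t (ξ - η)‖
        = ‖∫ η, (((1 + ‖ξ‖) ^ k : ℝ) : ℂ) * (h t η * g t (ξ - η))‖ := by
          rw [integral_const_mul, norm_mul, Complex.norm_real, Real.norm_of_nonneg (by positivity)]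
      _ ≤ ∫ η, C * polyWt η := by
          refine norm_integral_le_of_norm_le (integrable_polyWt.const_mul C)
            (Filter.Eventually.of_forall fun η => ?_)
          rw [norm_mul, Complex.norm_real, Real.norm_of_nonneg (by positivity)]
          exact hC t ht ξ η

/-- The Leibniz rule under the integral sign. The two terms h' * g and h * g' have factors with m
derivatives each, so the induction closes. -/
theorem Reg.conv {m : ℕ} (hI : IsOpen I) (hh : Reg I m h) (hg : Reg I m g) :
    Reg I m (fun t ξ => ∫ η, h t η * g t (ξ - η)) := by
  induction m generalizing h g with
  | zero => exact RapidOn.conv hh hg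
  | succ m ih =>
    have hh0 := hh.of_succ
    have hg0 := hg.of_succ
    obtain ⟨h1, h', h2, h3⟩ := hh
    obtain ⟨g1, g', g2, g3⟩ := hg
    refine ⟨h1.conv g1, _, (ih h2 hg0).add (ih hh0 g2), fun t ht ξ => ?_⟩
    obtain ⟨C, -, hC⟩ := h2.rapid.conv_bound_zero g1
    obtain ⟨D, -, hD⟩ := h1.conv_bound_zero g2.rapid
    have key := hasDerivAt_integral_of_dominated_loc_of_deriv_le (μ := (volume : Measure Space))
      (F := fun t η => h t η * g t (ξ - η))
      (F' := fun t η => h' t η * g t (ξ - η) + h t η * g' t (ξ - η))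
      (bound := fun η => C * polyWt η + D * polyWt η) (hI.mem_nhds ht)
      (Filter.eventually_of_mem (hI.mem_nhds ht)
        fun τ hτ => (h1.integrable_conv g1 hτ ξ).aestronglyMeasurable)
      (h1.integrable_conv g1 ht ξ)
      ((h2.rapid.integrable_conv g1 ht ξ).add
        (h1.integrable_conv g2.rapid ht ξ)).aestronglyMeasurable
      (Filter.Eventually.of_forall fun η τ hτ =>
        (norm_add_le _ _).trans (add_le_add (hC τ hτ ξ η) (hD τ hτ ξ η)))
      ((integrable_polyWt.const_mul C).add (integrable_polyWt.const_mul D))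
      (Filter.Eventually.of_forall fun η τ hτ => (h3 τ hτ η).mul (g3 τ hτ (ξ - η)))
    have h4 := key.2
    rwa [integral_add (h2.rapid.integrable_conv g1 ht ξ)
      (h1.integrable_conv g2.rapid ht ξ)] at h4

/-- The function on spacetime whose spatial Fourier transform is `h`. -/
def synth (h : ℝ → Space → ℂ) (p : Spacetime) : ℂ :=
  ∫ ξ, Real.fourierChar (inner ℝ ξ p.2) • h p.1 ξ

/-- The frequency side of the partial derivative `∂_j`. -/
def freqMul (j : Fin 3) (ξ : Space) : ℂ := 2 * Real.pi * Complex.I * ξ j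

theorem polyGrowth_freqMul (j : Fin 3) : PolyGrowth (freqMul j) where
  cont := by unfold freqMul; fun_prop
  bound := ⟨2 * Real.pi, 1, by positivity, fun ξ => by
    have h1 : ‖ξ j‖ ≤ ‖ξ‖ := PiLp.norm_apply_le ξ j
    simp only [freqMul, norm_mul, Complex.norm_real, Complex.norm_I, Complex.norm_ofNat,
      Real.norm_of_nonneg Real.pi_pos.le, mul_one, pow_one]
    gcongr
    linarith⟩

theorem inner_space (ξ x : Space) : inner ℝ ξ x = ∑ j, ξ j * x j := by
  simp [PiLp.inner_apply, mul_comm]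

theorem hasFDerivAt_char_inner (ξ x : Space) :
    HasFDerivAt (fun y : Space => (Real.fourierChar (inner ℝ ξ y) : ℂ))
      ((innerSL ℝ ξ).smulRight
        (2 * Real.pi * Complex.I * (Real.fourierChar (inner ℝ ξ x) : ℂ))) x := by
  have h1 : HasFDerivAt (fun y : Space => inner ℝ ξ y) (innerSL ℝ ξ) x :=
    (innerSL ℝ ξ).hasFDerivAt
  have h2 := (Real.hasDerivAt_fourierChar (inner ℝ ξ x)).hasFDerivAt.comp x h1
  refine h2.congr_fderiv ?_
  ext v
  simp

/-- The total derivative of the integrand of `synth`. -/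
def synthFDeriv (h h' : ℝ → Space → ℂ) (p : Spacetime) (ξ : Space) : Spacetime →L[ℝ] ℂ :=
  (ContinuousLinearMap.fst ℝ ℝ Space).smulRight
      ((Real.fourierChar (inner ℝ ξ p.2) : ℂ) * h' p.1 ξ) +
    ∑ j : Fin 3, ((EuclideanSpace.proj j).comp (ContinuousLinearMap.snd ℝ ℝ Space)).smulRight
      ((Real.fourierChar (inner ℝ ξ p.2) : ℂ) * (freqMul j ξ * h p.1 ξ))

theorem hasFDerivAt_synth_integrand {h' : ℝ → Space → ℂ} {p : Spacetime} {ξ : Space}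
    (hd : HasDerivAt (fun τ => h τ ξ) (h' p.1 ξ) p.1) :
    HasFDerivAt (fun q : Spacetime => Real.fourierChar (inner ℝ ξ q.2) • h q.1 ξ)
      (synthFDeriv h h' p ξ) p := by
  have h1 : HasFDerivAt (fun q : Spacetime => h q.1 ξ) _ p :=
    hd.hasFDerivAt.comp p (ContinuousLinearMap.fst ℝ ℝ Space).hasFDerivAt
  have h2 : HasFDerivAt (fun q : Spacetime => (Real.fourierChar (inner ℝ ξ q.2) : ℂ)) _ p :=
    (hasFDerivAt_char_inner ξ p.2).comp p (ContinuousLinearMap.snd ℝ ℝ Space).hasFDerivAt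
  refine (h2.mul h1).congr_fderiv ?_
  ext v
  · simp [synthFDeriv]
  · simp [synthFDeriv, inner_space, freqMul, Finset.sum_mul, Finset.mul_sum]
    refine Finset.sum_congr rfl fun j _ => ?_
    ring

/-- Differentiation under the integral: a derivative in space costs one factor of frequency, which
the rapid decay absorbs. -/
theorem hasFDerivAt_synth {h' : ℝ → Space → ℂ} (hI : IsOpen I) (hh : RapidOn I h)
    (hh' : RapidOn I h') (hd : ∀ t ∈ I, ∀ ξ, HasDerivAt (fun τ => h τ ξ) (h' t ξ) t)
    {p : Spacetime} (hp : p.1 ∈ I) :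
    HasFDerivAt (synth h)
      ((ContinuousLinearMap.fst ℝ ℝ Space).smulRight (synth h' p) +
        ∑ j : Fin 3, ((EuclideanSpace.proj j).comp (ContinuousLinearMap.snd ℝ ℝ Space)).smulRight
          (synth (fun t ξ => freqMul j ξ * h t ξ) p)) p := by
  have hj : ∀ j, RapidOn I (fun t ξ => freqMul j ξ * h t ξ) :=
    fun j => hh.mul_poly (polyGrowth_freqMul j)
  have hΩ : (I ×ˢ univ : Set Spacetime) ∈ nhds p := (hI.prod isOpen_univ).mem_nhds ⟨hp, mem_univ _⟩
  obtain ⟨C, -, hC⟩ := hh'.norm_le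
  choose D hD0 hD using fun j => (hj j).norm_le
  set A := fun j : Fin 3 =>
    ((EuclideanSpace.proj j : Space →L[ℝ] ℝ).comp (ContinuousLinearMap.snd ℝ ℝ Space)) with hA
  have hmeas : ∀ (k : ℝ → Space → ℂ), RapidOn I k → ∀ q ∈ (I ×ˢ univ : Set Spacetime),
      Integrable (fun ξ => (Real.fourierChar (inner ℝ ξ q.2) : ℂ) * k q.1 ξ) := fun k hk q hq =>
    integrable_char_smul (hk.integrable hq.1) q.2
  have hint : Integrable (synthFDeriv h h' p) := by
    have e : synthFDeriv h h' p = fun ξ =>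
        (ContinuousLinearMap.smulRightL ℝ Spacetime ℂ (ContinuousLinearMap.fst ℝ ℝ Space))
          ((Real.fourierChar (inner ℝ ξ p.2) : ℂ) * h' p.1 ξ) +
        ∑ j, (ContinuousLinearMap.smulRightL ℝ Spacetime ℂ (A j))
          ((Real.fourierChar (inner ℝ ξ p.2) : ℂ) * (freqMul j ξ * h p.1 ξ)) := rfl
    rw [e]
    have i1 := (ContinuousLinearMap.smulRightL ℝ Spacetime ℂ
      (ContinuousLinearMap.fst ℝ ℝ Space)).integrable_comp (hmeas h' hh' p ⟨hp, mem_univ _⟩)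
    have i2 := fun j => (ContinuousLinearMap.smulRightL ℝ Spacetime ℂ (A j)).integrable_comp
      (hmeas _ (hj j) p ⟨hp, mem_univ _⟩)
    exact i1.add (integrable_finsetSum _ fun j _ => i2 j)
  have key := hasFDerivAt_integral_of_dominated_of_fderiv_le (μ := (volume : Measure Space))
    (F := fun (q : Spacetime) ξ => Real.fourierChar (inner ℝ ξ q.2) • h q.1 ξ)
    (F' := synthFDeriv h h')
    (bound := fun ξ => ‖ContinuousLinearMap.fst ℝ ℝ Space‖ * (C * polyWt ξ) +
      ∑ j, ‖A j‖ * (D j * polyWt ξ)) hΩ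
    (Filter.eventually_of_mem hΩ fun q hq => (hmeas h hh q hq).aestronglyMeasurable)
    (hmeas h hh p ⟨hp, mem_univ _⟩) hint.aestronglyMeasurable
    (Filter.Eventually.of_forall fun ξ q hq => by
      refine (norm_add_le _ _).trans (add_le_add ?_ ((norm_sum_le _ _).trans
        (Finset.sum_le_sum fun j _ => ?_)))
      · rw [ContinuousLinearMap.norm_smulRight_apply, norm_mul, Circle.norm_coe, one_mul]
        gcongr
        exact hC _ hq.1 ξ
      · rw [ContinuousLinearMap.norm_smulRight_apply, norm_mul, Circle.norm_coe, one_mul]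
        gcongr
        exact hD j _ hq.1 ξ)
    (((integrable_polyWt.const_mul C).const_mul _).add
      (integrable_finsetSum _ fun j _ => (integrable_polyWt.const_mul (D j)).const_mul _))
    (Filter.Eventually.of_forall fun ξ q hq => hasFDerivAt_synth_integrand (hd q.1 hq.1 ξ))
  refine key.congr_fderiv ?_
  have hadd : ∫ ξ, synthFDeriv h h' p ξ =
      (∫ ξ, (ContinuousLinearMap.smulRightL ℝ Spacetime ℂ (ContinuousLinearMap.fst ℝ ℝ Space))
        ((Real.fourierChar (inner ℝ ξ p.2) : ℂ) * h' p.1 ξ)) +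
      ∑ j, ∫ ξ, (ContinuousLinearMap.smulRightL ℝ Spacetime ℂ (A j))
        ((Real.fourierChar (inner ℝ ξ p.2) : ℂ) * (freqMul j ξ * h p.1 ξ)) := by
    rw [← integral_finsetSum, ← integral_add]
    · rfl
    · exact ContinuousLinearMap.integrable_comp _ (hmeas h' hh' p ⟨hp, mem_univ _⟩)
    · exact integrable_finsetSum _ fun j _ =>
        ContinuousLinearMap.integrable_comp _ (hmeas _ (hj j) p ⟨hp, mem_univ _⟩)
    · exact fun j _ => ContinuousLinearMap.integrable_comp _ (hmeas _ (hj j) p ⟨hp, mem_univ _⟩)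
  rw [hadd, ContinuousLinearMap.integral_comp_comm _ (hmeas h' hh' p ⟨hp, mem_univ _⟩)]
  congr 1
  refine Finset.sum_congr rfl fun j _ => ?_
  rw [ContinuousLinearMap.integral_comp_comm _ (hmeas _ (hj j) p ⟨hp, mem_univ _⟩)]
  rfl

theorem fderiv_synth_time {h' : ℝ → Space → ℂ} (hI : IsOpen I) (hh : RapidOn I h)
    (hh' : RapidOn I h') (hd : ∀ t ∈ I, ∀ ξ, HasDerivAt (fun τ => h τ ξ) (h' t ξ) t)
    {p : Spacetime} (hp : p.1 ∈ I) :
    fderiv ℝ (synth h) p (coordVec 0) = synth h' p := by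
  rw [(hasFDerivAt_synth hI hh hh' hd hp).fderiv]
  simp [coordVec]

theorem fderiv_synth_space {h' : ℝ → Space → ℂ} (hI : IsOpen I) (hh : RapidOn I h)
    (hh' : RapidOn I h') (hd : ∀ t ∈ I, ∀ ξ, HasDerivAt (fun τ => h τ ξ) (h' t ξ) t)
    {p : Spacetime} (hp : p.1 ∈ I) (j : Fin 3) :
    fderiv ℝ (synth h) p (coordVec j.succ) = synth (fun t ξ => freqMul j ξ * h t ξ) p := by
  rw [(hasFDerivAt_synth hI hh hh' hd hp).fderiv]
  simp [coordVec, PiLp.single_apply]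

/-- The derivative of `synth h` is assembled from the syntheses of h' and of frequency multiples of
h, all regular of order m. Smoothness in spacetime is thus reduced to regularity in time on the
Fourier side. -/
theorem Reg.contDiffOn_synth {m : ℕ} (hI : IsOpen I) (hh : Reg I m h) :
    ContDiffOn ℝ m (synth h) (I ×ˢ univ) := by
  induction m generalizing h with
  | zero =>
    have hh : RapidOn I h := hh
    rw [Nat.cast_zero, contDiffOn_zero]
    obtain ⟨C, -, hC⟩ := hh.norm_le
    refine continuousOn_of_dominated (bound := fun ξ => C * polyWt ξ) ?_ ?_ ?_ ?_
    · exact fun p hp => (integrable_char_smul (hh.integrable hp.1) p.2).aestronglyMeasurable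
    · refine fun p hp => Filter.Eventually.of_forall fun ξ => ?_
      rw [Circle.norm_smul]
      exact hC _ hp.1 ξ
    · exact integrable_polyWt.const_mul C
    · refine Filter.Eventually.of_forall fun ξ => ContinuousOn.smul ?_ ?_
      · have hi : Continuous fun p : Spacetime => (inner ℝ ξ p.2 : ℝ) := by fun_prop
        exact (continuous_subtype_val.comp (Real.continuous_fourierChar.comp hi)).continuousOn
      · exact hh.cont.comp (f := fun p : Spacetime => (p.1, ξ)) (by fun_prop)
          (fun p hp => ⟨hp.1, mem_univ _⟩)
  | succ m ih =>
    have hh0 := hh.of_succ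
    obtain ⟨h1, h', h2, h3⟩ := hh
    have hfd := fun (p : Spacetime) (hp : p ∈ I ×ˢ (univ : Set Space)) =>
      hasFDerivAt_synth hI h1 h2.rapid h3 (p := p) hp.1
    rw [Nat.cast_add, Nat.cast_one, contDiffOn_succ_iff_fderiv_of_isOpen (hI.prod isOpen_univ)]
    refine ⟨fun p hp => (hfd p hp).differentiableAt.differentiableWithinAt, by simp, ?_⟩
    refine ContDiffOn.congr ?_ fun p hp => (hfd p hp).fderiv
    refine ContDiffOn.add (contDiffOn_const.smulRight (ih h2)) (ContDiffOn.sum fun j _ =>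
      contDiffOn_const.smulRight (ih (hh0.mul_poly (polyGrowth_freqMul j))))

theorem ev_eq_synth (b : Alg) : ev b = synth (dens b) := by
  ext p
  exact ev_apply b p

/-- The exponential weight beats every power: x^k ≤ k! e^x at x = 1 + |ξ|. -/
theorem rapidOn_dens (I : Set ℝ) (b : Alg) : RapidOn I (dens b) where
  cont := (continuous_dens b).continuousOn
  decay k := by
    refine ⟨‖b‖ * (k.factorial * Real.exp 1), fun t _ ξ => ?_⟩
    have h1 : (1 + ‖ξ‖) ^ k ≤ k.factorial * (Real.exp 1 * Real.exp ‖ξ‖) := by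
      have := Real.pow_div_factorial_le_exp (x := 1 + ‖ξ‖) (by positivity) k
      rw [div_le_iff₀ (by positivity), Real.exp_add] at this
      linarith
    have h2 : wt ξ ≤ (Real.exp ‖ξ‖)⁻¹ := by
      rw [wt, Real.exp_neg]
      exact mul_le_of_le_one_right (by positivity) (polyWt_le_one ξ)
    calc (1 + ‖ξ‖) ^ k * ‖dens b t ξ‖
        ≤ (k.factorial * (Real.exp 1 * Real.exp ‖ξ‖)) * (‖b‖ * (Real.exp ‖ξ‖)⁻¹) := by
          gcongr
          exact (norm_dens_le b t ξ).trans (by gcongr)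
      _ = _ := by field_simp

end TimeRegularity

/-! ### Wave propagators, free waves and complex conjugation -/

noncomputable section WaveMultipliers

open FourierTransform

/-- The function `sin (l t) / l`, equal to `t` for `l = 0`. -/
def sinOver (l t : ℝ) : ℝ := t * Real.sinc (l * t)

theorem mul_sinOver (l t : ℝ) : l * sinOver l t = Real.sin (l * t) := by
  unfold sinOver
  rcases eq_or_ne (l * t) 0 with h | h
  · rw [h]
    rw [← mul_assoc, h]
    simp
  · rw [Real.sinc_of_ne_zero h]
    have : l ≠ 0 := left_ne_zero_of_mul h
    have : t ≠ 0 := right_ne_zero_of_mul h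
    field_simp

theorem sinOver_of_ne_zero {l : ℝ} (hl : l ≠ 0) (t : ℝ) : sinOver l t = Real.sin (l * t) / l := by
  rw [← mul_sinOver, mul_div_cancel_left₀ _ hl]

@[simp] theorem sinOver_zero_left (t : ℝ) : sinOver 0 t = t := by simp [sinOver]

@[simp] theorem sinOver_zero_right (l : ℝ) : sinOver l 0 = 0 := by simp [sinOver]

theorem hasDerivAt_cos_mul (l t : ℝ) :
    HasDerivAt (fun t => Real.cos (l * t)) (-(l ^ 2 * sinOver l t)) t := by
  have h := ((hasDerivAt_id t).const_mul l).cos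
  simp only [id, mul_one] at h
  rw [← mul_sinOver] at h
  convert! h using 1
  ring

theorem hasDerivAt_sinOver (l t : ℝ) : HasDerivAt (sinOver l) (Real.cos (l * t)) t := by
  rcases eq_or_ne l 0 with rfl | hl
  · have : sinOver 0 = id := by ext; simp
    rw [this]
    simpa using hasDerivAt_id t
  · have : sinOver l = fun t => Real.sin (l * t) / l := by ext; exact sinOver_of_ne_zero hl _
    rw [this]
    have h := (((hasDerivAt_id t).const_mul l).sin).div_const l
    simp only [id, mul_one] at h
    convert! h using 1
    field_simp

theorem sinOver_sub (l t s : ℝ) :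
    sinOver l (t - s) = sinOver l t * Real.cos (l * s) - Real.cos (l * t) * sinOver l s := by
  rcases eq_or_ne l 0 with rfl | hl
  · simp
  · simp only [sinOver_of_ne_zero hl, mul_sub, Real.sin_sub]
    ring

theorem cos_mul_sub (l t s : ℝ) :
    Real.cos (l * (t - s)) =
      Real.cos (l * t) * Real.cos (l * s) + l ^ 2 * (sinOver l t * sinOver l s) := by
  rw [mul_sub, Real.cos_sub, ← mul_sinOver, ← mul_sinOver]
  ring

theorem abs_sinOver_le (l t : ℝ) : |sinOver l t| ≤ |t| := by
  rw [sinOver, abs_mul]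
  exact mul_le_of_le_one_right (abs_nonneg _) (Real.abs_sinc_le_one _)

theorem continuous_sinOver : Continuous fun p : ℝ × ℝ => sinOver p.1 p.2 := by
  unfold sinOver
  exact continuous_snd.mul (Real.continuous_sinc.comp (by fun_prop))

/-- The dispersion relation `2π|ξ|`. -/
def disp (ξ : Space) : ℝ := 2 * Real.pi * ‖ξ‖

theorem disp_nonneg (ξ : Space) : 0 ≤ disp ξ := by unfold disp; positivity

theorem continuous_disp : Continuous disp := by unfold disp; fun_prop

theorem disp_neg (ξ : Space) : disp (-ξ) = disp ξ := by simp [disp]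

theorem disp_sq (ξ : Space) : ((disp ξ ^ 2 : ℝ) : ℂ) = -∑ j, freqMul j ξ ^ 2 := by
  have h : ‖ξ‖ ^ 2 = ∑ j, ξ j ^ 2 := by
    rw [← real_inner_self_eq_norm_sq, inner_space]
    simp [sq]
  rw [disp, mul_pow, h]
  push_cast
  simp only [freqMul, mul_pow, Complex.I_sq, Finset.mul_sum, ← Finset.sum_neg_distrib]
  refine Finset.sum_congr rfl fun j _ => ?_
  ring

/-- The propagator `sin (2π|ξ|t) / (2π|ξ|)`. -/
def mulSin (t : ℝ) (ξ : Space) : ℂ := (sinOver (disp ξ) t : ℝ)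

/-- The propagator `cos (2π|ξ|t)`. -/
def mulCos (t : ℝ) (ξ : Space) : ℂ := (Real.cos (disp ξ * t) : ℝ)

/-- The Fourier multipliers giving a solution of the wave equation and its first derivatives in
terms of its source. -/
def jetMul : Option (Fin 4) → ℝ → Space → ℂ
  | none => mulSin
  | some μ => Fin.cases mulCos (fun j t ξ => freqMul j ξ * mulSin t ξ) μ

theorem jetMul_none : jetMul none = mulSin := rfl

theorem jetMul_zero : jetMul (some 0) = mulCos := rfl

theorem jetMul_succ (j : Fin 3) :
    jetMul (some j.succ) = fun t ξ => freqMul j ξ * mulSin t ξ := rfl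

theorem continuous_mulSin : Continuous fun p : ℝ × Space => mulSin p.1 p.2 := by
  unfold mulSin
  exact Complex.continuous_ofReal.comp (continuous_sinOver.comp
    ((continuous_disp.comp continuous_snd).prodMk continuous_fst))

theorem continuous_mulCos : Continuous fun p : ℝ × Space => mulCos p.1 p.2 := by
  have := continuous_disp
  unfold mulCos
  fun_prop

theorem norm_freqMul_le (j : Fin 3) (ξ : Space) : ‖freqMul j ξ‖ ≤ disp ξ := by
  have h1 : ‖ξ j‖ ≤ ‖ξ‖ := PiLp.norm_apply_le ξ j
  simp only [freqMul, disp, norm_mul, Complex.norm_real, Complex.norm_I, Complex.norm_ofNat,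
    Real.norm_of_nonneg Real.pi_pos.le, mul_one]
  gcongr

theorem norm_mulSin_le (t : ℝ) (ξ : Space) : ‖mulSin t ξ‖ ≤ |t| := by
  rw [mulSin, Complex.norm_real]
  exact abs_sinOver_le _ _

theorem norm_mulCos_le (t : ℝ) (ξ : Space) : ‖mulCos t ξ‖ ≤ 1 := by
  rw [mulCos, Complex.norm_real]
  exact Real.abs_cos_le_one _

theorem norm_freqMul_mulSin_le (j : Fin 3) (t : ℝ) (ξ : Space) :
    ‖freqMul j ξ * mulSin t ξ‖ ≤ 1 := by
  rw [norm_mul]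
  calc ‖freqMul j ξ‖ * ‖mulSin t ξ‖ ≤ disp ξ * ‖mulSin t ξ‖ := by
        gcongr; exact norm_freqMul_le j ξ
    _ = |Real.sin (disp ξ * t)| := by
        rw [← mul_sinOver, abs_mul, abs_of_nonneg (disp_nonneg ξ), mulSin, Complex.norm_real,
          Real.norm_eq_abs]
    _ ≤ 1 := Real.abs_sin_le_one _

/-- The time derivative of a Duhamel integral has multiplier cos, and a space derivative has a
multiplier ξ_j sin / |ξ|; both are bounded by 1. This is why a nonlinearity containing first
derivatives can be treated without loss of derivatives. -/
theorem isMultiplier_jetMul (o : Option (Fin 4)) : IsMultiplier (jetMul o) := by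
  rcases o with _ | μ
  · exact ⟨continuous_mulSin, fun R => ⟨R, fun τ ξ h => (norm_mulSin_le τ ξ).trans h⟩⟩
  · refine Fin.cases ?_ (fun j => ?_) μ
    · exact ⟨continuous_mulCos, fun R => ⟨1, fun τ ξ _ => norm_mulCos_le τ ξ⟩⟩
    · exact ⟨((polyGrowth_freqMul j).cont.comp continuous_snd).mul continuous_mulSin,
        fun R => ⟨1, fun τ ξ _ => norm_freqMul_mulSin_le j τ ξ⟩⟩

theorem mulSin_neg (t : ℝ) (ξ : Space) : mulSin t (-ξ) = mulSin t ξ := by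
  simp [mulSin, disp_neg]

theorem mulCos_neg (t : ℝ) (ξ : Space) : mulCos t (-ξ) = mulCos t ξ := by
  simp [mulCos, disp_neg]

theorem conj_freqMul_neg (j : Fin 3) (ξ : Space) :
    (starRingEnd ℂ) (freqMul j (-ξ)) = freqMul j ξ := by
  simp [freqMul, Complex.conj_ofNat]

theorem conj_jetMul_neg (o : Option (Fin 4)) (t : ℝ) (ξ : Space) :
    (starRingEnd ℂ) (jetMul o t (-ξ)) = jetMul o t ξ := by
  have hS : (starRingEnd ℂ) (mulSin t (-ξ)) = mulSin t ξ := by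
    rw [mulSin_neg]; exact Complex.conj_ofReal _
  have hC : (starRingEnd ℂ) (mulCos t (-ξ)) = mulCos t ξ := by
    rw [mulCos_neg]; exact Complex.conj_ofReal _
  rcases o with _ | μ
  · exact hS
  · refine Fin.cases hC (fun j => ?_) μ
    rw [jetMul_succ, map_mul, hS, conj_freqMul_neg]

theorem hasDerivAt_mulSin (t : ℝ) (ξ : Space) :
    HasDerivAt (fun τ => mulSin τ ξ) (mulCos t ξ) t :=
  (hasDerivAt_sinOver (disp ξ) t).ofReal_comp

theorem hasDerivAt_mulCos (t : ℝ) (ξ : Space) :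
    HasDerivAt (fun τ => mulCos τ ξ) (-(((disp ξ ^ 2 : ℝ) : ℂ) * mulSin t ξ)) t := by
  have := (hasDerivAt_cos_mul (disp ξ) t).ofReal_comp
  convert! this using 1
  simp [mulSin]

theorem mulSin_sub (t s : ℝ) (ξ : Space) :
    mulSin (t - s) ξ = mulSin t ξ * mulCos s ξ - mulCos t ξ * mulSin s ξ := by
  simp only [mulSin, mulCos, sinOver_sub]
  push_cast
  ring

theorem mulCos_sub (t s : ℝ) (ξ : Space) :
    mulCos (t - s) ξ = mulCos t ξ * mulCos s ξ +
      ((disp ξ ^ 2 : ℝ) : ℂ) * (mulSin t ξ * mulSin s ξ) := by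
  simp only [mulSin, mulCos, cos_mul_sub]
  push_cast
  ring

/-- The addition formulas move t out of the propagator and leave integrals with integrands
independent of t, to which the fundamental theorem and the product rule apply. The boundary terms
cancel in the first derivative and, by cos² + sin² = 1, add up to g t in the second. -/
theorem hasDerivAt_duhamel {g : ℝ → ℂ} (hg : Continuous g) (ξ : Space) (t : ℝ) :
    HasDerivAt (fun t => ∫ s in (0 : ℝ)..t, mulSin (t - s) ξ * g s)
        (∫ s in (0 : ℝ)..t, mulCos (t - s) ξ * g s) t ∧
      HasDerivAt (fun t => ∫ s in (0 : ℝ)..t, mulCos (t - s) ξ * g s)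
        (g t - ((disp ξ ^ 2 : ℝ) : ℂ) * ∫ s in (0 : ℝ)..t, mulSin (t - s) ξ * g s) t := by
  have hcS : Continuous fun s => mulSin s ξ * g s :=
    (continuous_mulSin.comp (by fun_prop : Continuous fun s : ℝ => (s, ξ))).mul hg
  have hcC : Continuous fun s => mulCos s ξ * g s :=
    (continuous_mulCos.comp (by fun_prop : Continuous fun s : ℝ => (s, ξ))).mul hg
  set IS := fun t => ∫ s in (0 : ℝ)..t, mulSin s ξ * g s with hIS
  set IC := fun t => ∫ s in (0 : ℝ)..t, mulCos s ξ * g s with hIC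
  have dS : HasDerivAt IS (mulSin t ξ * g t) t :=
    intervalIntegral.integral_hasDerivAt_right (hcS.intervalIntegrable _ _)
      (hcS.stronglyMeasurableAtFilter _ _) hcS.continuousAt
  have dC : HasDerivAt IC (mulCos t ξ * g t) t :=
    intervalIntegral.integral_hasDerivAt_right (hcC.intervalIntegrable _ _)
      (hcC.stronglyMeasurableAtFilter _ _) hcC.continuousAt
  have e1 : ∀ t, ∫ s in (0 : ℝ)..t, mulSin (t - s) ξ * g s =
      mulSin t ξ * IC t - mulCos t ξ * IS t := by
    intro t
    rw [hIS, hIC]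
    simp only
    rw [← intervalIntegral.integral_const_mul, ← intervalIntegral.integral_const_mul,
      ← intervalIntegral.integral_sub ((hcC.intervalIntegrable _ _).const_mul _)
        ((hcS.intervalIntegrable _ _).const_mul _)]
    refine intervalIntegral.integral_congr fun s _ => ?_
    simp only [mulSin_sub]
    ring
  have e2 : ∀ t, ∫ s in (0 : ℝ)..t, mulCos (t - s) ξ * g s =
      mulCos t ξ * IC t + ((disp ξ ^ 2 : ℝ) : ℂ) * mulSin t ξ * IS t := by
    intro t
    rw [hIS, hIC]
    simp only
    rw [← intervalIntegral.integral_const_mul, ← intervalIntegral.integral_const_mul,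
      ← intervalIntegral.integral_add ((hcC.intervalIntegrable _ _).const_mul _)
        ((hcS.intervalIntegrable _ _).const_mul _)]
    refine intervalIntegral.integral_congr fun s _ => ?_
    simp only [mulCos_sub]
    ring
  have hpy : mulCos t ξ * mulCos t ξ + ((disp ξ ^ 2 : ℝ) : ℂ) * (mulSin t ξ * mulSin t ξ) = 1 := by
    rw [← mulCos_sub]; simp [mulCos]
  simp only [e1, e2]
  constructor
  · refine (((hasDerivAt_mulSin t ξ).mul dC).sub ((hasDerivAt_mulCos t ξ).mul dS)).congr_deriv ?_
    ring
  · refine (((hasDerivAt_mulCos t ξ).mul dC).add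
      (((hasDerivAt_mulSin t ξ).const_mul ((disp ξ ^ 2 : ℝ) : ℂ)).mul dS)).congr_deriv ?_
    linear_combination (g t) * hpy

variable {T : ℝ}

theorem eventuallyEq_clampTime {t : ℝ} (ht : t ∈ Ioo (-T) T) :
    ∀ᶠ τ in nhds t, clampTime T τ = τ :=
  Filter.eventually_of_mem (isOpen_Ioo.mem_nhds ht)
    fun _ hτ => clampTime_of_mem (Ioo_subset_Icc_self hτ)

theorem hasDerivAt_dens_duh (hT : 0 ≤ T) (G : Alg) {t : ℝ} (ht : t ∈ Ioo (-T) T) (ξ : Space) :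
    HasDerivAt (fun τ => dens (duhL hT (isMultiplier_jetMul none) G) τ ξ)
        (dens (duhL hT (isMultiplier_jetMul (some 0)) G) t ξ) t ∧
      HasDerivAt (fun τ => dens (duhL hT (isMultiplier_jetMul (some 0)) G) τ ξ)
        (dens G t ξ - ((disp ξ ^ 2 : ℝ) : ℂ) *
          dens (duhL hT (isMultiplier_jetMul none) G) t ξ) t := by
  have hg : Continuous fun s => dens G s ξ := continuous_dens_comp G continuous_id continuous_const
  obtain ⟨h1, h2⟩ := hasDerivAt_duhamel hg ξ t
  simp only [dens_duhL, jetMul_none, jetMul_zero,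
    clampTime_of_mem (Ioo_subset_Icc_self ht)]
  constructor
  · exact h1.congr_of_eventuallyEq
      ((eventuallyEq_clampTime ht).mono fun τ hτ => by simp only [hτ])
  · exact h2.congr_of_eventuallyEq
      ((eventuallyEq_clampTime ht).mono fun τ hτ => by simp only [hτ])

theorem dens_duh_space (hT : 0 ≤ T) (G : Alg) (j : Fin 3) (t : ℝ) (ξ : Space) :
    dens (duhL hT (isMultiplier_jetMul (some j.succ)) G) t ξ =
      freqMul j ξ * dens (duhL hT (isMultiplier_jetMul none) G) t ξ := by
  simp only [dens_duhL, jetMul_none, jetMul_succ, mul_assoc]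
  exact intervalIntegral.integral_const_mul _ _

/-- Continuous, compactly supported functions of frequency. -/
structure IsTestFreq (p : Space → ℂ) : Prop where
  cont : Continuous p
  supp : HasCompactSupport p

theorem IsTestFreq.zero : IsTestFreq (fun _ => 0) := ⟨continuous_const, HasCompactSupport.zero⟩

theorem IsTestFreq.mul {p q : Space → ℂ} (hp : IsTestFreq p) (hq : Continuous q) :
    IsTestFreq (fun ξ => q ξ * p ξ) := ⟨hq.mul hp.cont, hp.supp.mul_left⟩

theorem IsTestFreq.sub {p q : Space → ℂ} (hp : IsTestFreq p) (hq : IsTestFreq q) :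
    IsTestFreq (fun ξ => p ξ - q ξ) := ⟨hp.cont.sub hq.cont, by
      simpa only [sub_eq_add_neg] using! hp.supp.add hq.supp.neg⟩

/-- The inverse of the weight is bounded on a compact support. The square of 1 + `disp ξ` makes room
for the factor `disp ξ ^ 2` in the time derivative of a free wave. -/
theorem IsTestFreq.bound {p : Space → ℂ} (hp : IsTestFreq p) :
    ∃ C, 0 ≤ C ∧ ∀ ξ, (1 + disp ξ) ^ 2 * ‖p ξ‖ ≤ C * wt ξ := by
  have hc : Continuous fun ξ => ((wt ξ)⁻¹ * (1 + disp ξ) ^ 2 : ℝ) * ‖p ξ‖ := by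
    have h1 := continuous_wt.inv₀ (fun ξ => (wt_pos ξ).ne')
    have h2 := continuous_disp
    exact (h1.mul ((continuous_const.add h2).pow 2)).mul hp.cont.norm
  obtain ⟨C, hC⟩ := hc.bounded_above_of_compact_support hp.supp.norm.mul_left
  refine ⟨max C 0, le_max_right _ _, fun ξ => ?_⟩
  have h := (le_abs_self _).trans (hC ξ)
  rw [mul_assoc, inv_mul_le_iff₀ (wt_pos ξ)] at h
  rw [mul_comm (max C 0)]
  exact h.trans (mul_le_mul_of_nonneg_left (le_max_left _ _) (wt_pos ξ).le)

/-- The densities of a free wave with Cauchy data `(p, q)` and of its first derivatives. -/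
def freeDens (p q : Space → ℂ) : Option (Fin 4) → ℝ → Space → ℂ
  | none => fun t ξ => mulCos t ξ * p ξ + mulSin t ξ * q ξ
  | some μ => Fin.cases
      (fun t ξ => -(((disp ξ ^ 2 : ℝ) : ℂ) * mulSin t ξ) * p ξ + mulCos t ξ * q ξ)
      (fun j t ξ => freqMul j ξ * (mulCos t ξ * p ξ + mulSin t ξ * q ξ)) μ

theorem freeDens_none (p q : Space → ℂ) (t : ℝ) (ξ : Space) :
    freeDens p q none t ξ = mulCos t ξ * p ξ + mulSin t ξ * q ξ := rfl

theorem freeDens_zero (p q : Space → ℂ) (t : ℝ) (ξ : Space) :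
    freeDens p q (some 0) t ξ =
      -(((disp ξ ^ 2 : ℝ) : ℂ) * mulSin t ξ) * p ξ + mulCos t ξ * q ξ := rfl

theorem freeDens_succ (p q : Space → ℂ) (j : Fin 3) (t : ℝ) (ξ : Space) :
    freeDens p q (some j.succ) t ξ = freqMul j ξ * freeDens p q none t ξ := rfl

theorem continuous_freeDens {p q : Space → ℂ} (hp : Continuous p) (hq : Continuous q)
    (o : Option (Fin 4)) : Continuous fun x : ℝ × Space => freeDens p q o x.1 x.2 := by
  have h1 := continuous_mulSin
  have h2 := continuous_mulCos
  have h3 := continuous_disp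
  have h4 := fun j => (polyGrowth_freqMul j).cont
  rcases o with _ | μ
  · simp only [freeDens_none]; fun_prop
  · refine Fin.cases ?_ (fun j => ?_) μ
    · simp only [freeDens_zero]; fun_prop
    · simp only [freeDens_succ, freeDens_none]; fun_prop

theorem norm_freeDens_le (p q : Space → ℂ) (o : Option (Fin 4)) (t : ℝ) (ξ : Space) :
    ‖freeDens p q o t ξ‖ ≤ (1 + |t|) * ((1 + disp ξ) ^ 2 * ‖p ξ‖ + (1 + disp ξ) ^ 2 * ‖q ξ‖) := by
  have hl := disp_nonneg ξ
  have ht := abs_nonneg t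
  have hS := norm_mulSin_le t ξ
  have hC := norm_mulCos_le t ξ
  have h0 : ‖freeDens p q none t ξ‖ ≤ (1 + |t|) * (‖p ξ‖ + ‖q ξ‖) := by
    rw [freeDens_none]
    refine (norm_add_le _ _).trans ?_
    rw [norm_mul, norm_mul]
    have hp : ‖mulCos t ξ‖ * ‖p ξ‖ ≤ (1 + |t|) * ‖p ξ‖ := by gcongr; linarith
    have hq : ‖mulSin t ξ‖ * ‖q ξ‖ ≤ (1 + |t|) * ‖q ξ‖ := by gcongr; linarith
    linarith
  have hd : (1 : ℝ) ≤ (1 + disp ξ) ^ 2 := one_le_pow₀ (by linarith)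
  have hd1 : disp ξ ≤ (1 + disp ξ) ^ 2 := by nlinarith
  have hd2 : disp ξ ^ 2 ≤ (1 + disp ξ) ^ 2 := by nlinarith
  have hpq : 0 ≤ (1 + |t|) * (‖p ξ‖ + ‖q ξ‖) := by positivity
  rcases o with _ | μ
  · calc _ ≤ _ := h0
      _ ≤ (1 + disp ξ) ^ 2 * ((1 + |t|) * (‖p ξ‖ + ‖q ξ‖)) := le_mul_of_one_le_left hpq hd
      _ = _ := by ring
  · refine Fin.cases ?_ (fun j => ?_) μ
    · rw [freeDens_zero]
      refine (norm_add_le _ _).trans ?_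
      rw [norm_mul, norm_mul, norm_neg, norm_mul, Complex.norm_real,
        Real.norm_of_nonneg (by positivity)]
      have hp : disp ξ ^ 2 * ‖mulSin t ξ‖ * ‖p ξ‖ ≤
          (1 + disp ξ) ^ 2 * (1 + |t|) * ‖p ξ‖ := by gcongr; linarith
      have hq : ‖mulCos t ξ‖ * ‖q ξ‖ ≤ ((1 + disp ξ) ^ 2 * (1 + |t|)) * ‖q ξ‖ := by
        gcongr
        exact hC.trans (one_le_mul_of_one_le_of_one_le hd (by linarith))
      nlinarith
    · rw [freeDens_succ, norm_mul]
      calc ‖freqMul j ξ‖ * ‖freeDens p q none t ξ‖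
          ≤ (1 + disp ξ) ^ 2 * ((1 + |t|) * (‖p ξ‖ + ‖q ξ‖)) := by
            gcongr
            exact (norm_freqMul_le j ξ).trans hd1
        _ = _ := by ring

/-- The free wave with Cauchy data `(p, q)`, frozen outside `[-T, T]`, and its derivatives. -/
def freeAlg (hT : 0 ≤ T) {p q : Space → ℂ} (hp : IsTestFreq p) (hq : IsTestFreq q)
    (o : Option (Fin 4)) : Alg :=
  ofDens (fun t ξ => freeDens p q o (clampTime T t) ξ)
    ((continuous_freeDens hp.cont hq.cont o).comp
      (((continuous_clampTime T).comp continuous_fst).prodMk continuous_snd))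
    (by
      obtain ⟨C, hC0, hC⟩ := hp.bound
      obtain ⟨D, hD0, hD⟩ := hq.bound
      refine ⟨(1 + T) * (C + D), fun t ξ => (norm_freeDens_le p q o _ ξ).trans ?_⟩
      have h1 := abs_clampTime_le hT t
      calc _ ≤ (1 + T) * (C * wt ξ + D * wt ξ) := by
            refine mul_le_mul (by linarith) (add_le_add (hC ξ) (hD ξ)) ?_ (by linarith)
            have := disp_nonneg ξ
            positivity
        _ = _ := by ring)

theorem dens_freeAlg (hT : 0 ≤ T) {p q : Space → ℂ} (hp : IsTestFreq p) (hq : IsTestFreq q)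
    (o : Option (Fin 4)) (t : ℝ) (ξ : Space) :
    dens (freeAlg hT hp hq o) t ξ = freeDens p q o (clampTime T t) ξ :=
  dens_ofDens (fun t ξ => freeDens p q o (clampTime T t) ξ) _ _ t ξ

theorem hasDerivAt_dens_free (hT : 0 ≤ T) {p q : Space → ℂ} (hp : IsTestFreq p)
    (hq : IsTestFreq q) {t : ℝ} (ht : t ∈ Ioo (-T) T) (ξ : Space) :
    HasDerivAt (fun τ => dens (freeAlg hT hp hq none) τ ξ)
        (dens (freeAlg hT hp hq (some 0)) t ξ) t ∧
      HasDerivAt (fun τ => dens (freeAlg hT hp hq (some 0)) τ ξ)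
        (-(((disp ξ ^ 2 : ℝ) : ℂ) * dens (freeAlg hT hp hq none) t ξ)) t := by
  simp only [dens_freeAlg, clampTime_of_mem (Ioo_subset_Icc_self ht)]
  have e : ∀ o, (fun τ => freeDens p q o (clampTime T τ) ξ) =ᶠ[nhds t]
      fun τ => freeDens p q o τ ξ :=
    fun o => (eventuallyEq_clampTime ht).mono fun τ hτ => by simp only [hτ]
  constructor
  · refine HasDerivAt.congr_of_eventuallyEq ?_ (e none)
    exact ((hasDerivAt_mulCos t ξ).mul_const (p ξ)).add ((hasDerivAt_mulSin t ξ).mul_const (q ξ))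
  · refine HasDerivAt.congr_of_eventuallyEq ?_ (e (some 0))
    refine ((((hasDerivAt_mulSin t ξ).const_mul ((disp ξ ^ 2 : ℝ) : ℂ)).neg.mul_const (p ξ)).add
      ((hasDerivAt_mulCos t ξ).mul_const (q ξ))).congr_deriv ?_
    rw [freeDens_none]
    ring

theorem dens_free_space (hT : 0 ≤ T) {p q : Space → ℂ} (hp : IsTestFreq p) (hq : IsTestFreq q)
    (j : Fin 3) (t : ℝ) (ξ : Space) :
    dens (freeAlg hT hp hq (some j.succ)) t ξ = freqMul j ξ * dens (freeAlg hT hp hq none) t ξ := by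
  simp only [dens_freeAlg, freeDens_succ]

/-- The density of the complex conjugate function. -/
def involAlg (b : Alg) : Alg :=
  ofDens (fun t ξ => (starRingEnd ℂ) (dens b t (-ξ)))
    (Complex.continuous_conj.comp (continuous_dens_comp b continuous_fst continuous_snd.neg))
    ⟨‖b‖, fun t ξ => by rw [RCLike.norm_conj, ← wt_neg]; exact norm_dens_le b t (-ξ)⟩

theorem dens_involAlg (b : Alg) (t : ℝ) (ξ : Space) :
    dens (involAlg b) t ξ = (starRingEnd ℂ) (dens b t (-ξ)) :=
  dens_ofDens (fun t ξ => (starRingEnd ℂ) (dens b t (-ξ))) _ _ t ξ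

/-- The conjugation on `Alg` as a linear map. -/
def involLin : Alg →ₗ[ℝ] Alg where
  toFun := involAlg
  map_add' a b := dens_ext fun t ξ => by simp [dens_involAlg]
  map_smul' c a := dens_ext fun t ξ => by simp [dens_involAlg]

/-- The conjugation on `Alg`. -/
def invol : Alg →L[ℝ] Alg :=
  LinearMap.mkContinuous involLin 1 fun b => by
    rw [one_mul]
    refine norm_le_of_dens (norm_nonneg b) fun t ξ => ?_
    change ‖dens (involAlg b) t ξ‖ ≤ _
    rw [dens_involAlg, RCLike.norm_conj, ← wt_neg]
    exact norm_dens_le b t (-ξ)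

theorem dens_invol (b : Alg) (t : ℝ) (ξ : Space) :
    dens (invol b) t ξ = (starRingEnd ℂ) (dens b t (-ξ)) := dens_involAlg b t ξ

theorem invol_invol (b : Alg) : invol (invol b) = b :=
  dens_ext fun t ξ => by simp [dens_invol]

theorem invol_convL (a b : Alg) : invol (convL a b) = convL (invol a) (invol b) :=
  dens_ext fun t ξ => by
    simp only [dens_invol, dens_convL, ← map_mul]
    rw [← integral_conj, ← integral_neg_eq_self]
    refine integral_congr_ae (Filter.Eventually.of_forall fun η => ?_)
    simp only [neg_sub, sub_neg_eq_add, neg_add_eq_sub]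

theorem intervalIntegral_conj_eq (f : ℝ → ℂ) (a b : ℝ) :
    (starRingEnd ℂ) (∫ s in a..b, f s) = ∫ s in a..b, (starRingEnd ℂ) (f s) := by
  simp only [intervalIntegral, map_sub, integral_conj]

/-- The propagators are real operators: their symbols satisfy conj m(-ξ) = m(ξ). -/
theorem invol_duhL (hT : 0 ≤ T) (o : Option (Fin 4)) (G : Alg) :
    invol (duhL hT (isMultiplier_jetMul o) G) = duhL hT (isMultiplier_jetMul o) (invol G) :=
  dens_ext fun t ξ => by
    simp only [dens_invol, dens_duhL]
    rw [intervalIntegral_conj_eq]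
    refine intervalIntegral.integral_congr fun s _ => ?_
    simp only [map_mul, conj_jetMul_neg]

theorem invol_freeAlg (hT : 0 ≤ T) {p q p' q' : Space → ℂ} (hp : IsTestFreq p)
    (hq : IsTestFreq q) (hp' : IsTestFreq p') (hq' : IsTestFreq q')
    (h1 : ∀ ξ, (starRingEnd ℂ) (p (-ξ)) = -p' ξ) (h2 : ∀ ξ, (starRingEnd ℂ) (q (-ξ)) = -q' ξ)
    (o : Option (Fin 4)) : invol (freeAlg hT hp hq o) = -freeAlg hT hp' hq' o :=
  dens_ext fun t ξ => by
    rw [dens_invol, dens_neg, dens_freeAlg, dens_freeAlg]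
    have hS : ∀ t, (starRingEnd ℂ) (mulSin t (-ξ)) = mulSin t ξ :=
      fun t => conj_jetMul_neg none t ξ
    have hC : ∀ t, (starRingEnd ℂ) (mulCos t (-ξ)) = mulCos t ξ :=
      fun t => conj_jetMul_neg (some 0) t ξ
    have h0 : (starRingEnd ℂ) (freeDens p q none (clampTime T t) (-ξ)) =
        -freeDens p' q' none (clampTime T t) ξ := by
      simp only [freeDens_none, map_add, map_mul, hS, hC, h1, h2]; ring
    rcases o with _ | μ
    · exact h0
    · refine Fin.cases ?_ (fun j => ?_) μ
      · simp only [freeDens_zero, map_add, map_mul, map_neg, hS, hC, h1, h2, disp_neg,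
          Complex.conj_ofReal]
        ring
      · rw [freeDens_succ, map_mul, h0, conj_freqMul_neg, freeDens_succ]; ring

theorem ev_invol (b : Alg) (p : Spacetime) : ev (invol b) p = (starRingEnd ℂ) (ev b p) := by
  rw [ev_apply, ev_apply, ← integral_conj, ← integral_neg_eq_self]
  refine integral_congr_ae (Filter.Eventually.of_forall fun ξ => ?_)
  simp only [dens_invol, neg_neg, Circle.smul_def, smul_eq_mul, map_mul, inner_neg_left,
    AddChar.map_neg_eq_inv, Circle.coe_inv_eq_conj]

end WaveMultipliers

/-! ### The Yang-Mills nonlinearity and its integral equation -/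

noncomputable section JetSpace

variable {n : ℕ} {T : ℝ}

/-- Matrices with entries in `Alg`. -/
abbrev MatAlg (n : ℕ) : Type := Fin n → Fin n → Alg

/-- The components of `(A, F)`. -/
abbrev FieldIdx : Type := Fin 4 ⊕ Fin 4 × Fin 4

/-- Pairs `(A, F)` on the Fourier side. -/
abbrev FieldSpace (n : ℕ) : Type := FieldIdx → MatAlg n

/-- Pairs `(A, F)` together with their first derivatives. -/
abbrev JetSp (n : ℕ) : Type := Option (Fin 4) → FieldSpace n

/-- The commutator for the convolution product. -/
def brM (X Y : MatAlg n) : MatAlg n :=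
  fun i j => ∑ k, (convL (X i k) (Y k j) - convL (Y i k) (X k j))

/-- Evaluation of a matrix at a point of spacetime. -/
def evM (X : MatAlg n) (p : Spacetime) : Matrix (Fin n) (Fin n) ℂ :=
  Matrix.of fun i j => ev (X i j) p

theorem evM_apply (X : MatAlg n) (p : Spacetime) (i j : Fin n) : evM X p i j = ev (X i j) p := rfl

theorem ev_sub (a b : Alg) (p : Spacetime) : ev (a - b) p = ev a p - ev b p :=
  (evL p).map_sub a b

theorem ev_neg (a : Alg) (p : Spacetime) : ev (-a) p = -ev a p := (evL p).map_neg a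

theorem ev_zero (p : Spacetime) : ev 0 p = 0 := (evL p).map_zero

theorem ev_sum {ι : Type*} (s : Finset ι) (a : ι → Alg) (p : Spacetime) :
    ev (∑ i ∈ s, a i) p = ∑ i ∈ s, ev (a i) p := map_sum (evL p) a s

theorem evM_add (X Y : MatAlg n) (p : Spacetime) : evM (X + Y) p = evM X p + evM Y p := by
  ext i j; exact ev_add _ _ _

theorem evM_sub (X Y : MatAlg n) (p : Spacetime) : evM (X - Y) p = evM X p - evM Y p := by
  ext i j; exact ev_sub _ _ _

theorem evM_neg (X : MatAlg n) (p : Spacetime) : evM (-X) p = -evM X p := by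
  ext i j; exact ev_neg _ _

theorem evM_smul (c : ℝ) (X : MatAlg n) (p : Spacetime) : evM (c • X) p = c • evM X p := by
  ext i j
  simp [evM_apply, ev_smul]

theorem evM_sum {ι : Type*} (s : Finset ι) (X : ι → MatAlg n) (p : Spacetime) :
    evM (∑ l ∈ s, X l) p = ∑ l ∈ s, evM (X l) p := by
  ext i j
  simp [evM_apply, ev_sum, Matrix.sum_apply]

theorem evM_brM (X Y : MatAlg n) (p : Spacetime) : evM (brM X Y) p = ⁅evM X p, evM Y p⁆ := by
  ext i j
  simp [evM_apply, brM, ev_sum, ev_sub, ev_convL, Ring.lie_def, Matrix.mul_apply,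
    Finset.sum_sub_distrib]

/-- The Fourier side of skew-Hermitian matrices. -/
def IsSkewM (X : MatAlg n) : Prop := ∀ i j, invol (X j i) = -X i j

theorem IsSkewM.add {X Y : MatAlg n} (hX : IsSkewM X) (hY : IsSkewM Y) : IsSkewM (X + Y) :=
  fun i j => by simp [hX i j, hY i j]; abel

theorem IsSkewM.sub {X Y : MatAlg n} (hX : IsSkewM X) (hY : IsSkewM Y) : IsSkewM (X - Y) :=
  fun i j => by simp [hX i j, hY i j]; abel

theorem IsSkewM.smul {X : MatAlg n} (c : ℝ) (hX : IsSkewM X) : IsSkewM (c • X) :=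
  fun i j => by simp [hX i j]

theorem IsSkewM.sum {ι : Type*} (s : Finset ι) {X : ι → MatAlg n} (hX : ∀ l ∈ s, IsSkewM (X l)) :
    IsSkewM (∑ l ∈ s, X l) := fun i j => by
  simp only [Finset.sum_apply, map_sum, ← Finset.sum_neg_distrib]
  exact Finset.sum_congr rfl fun l hl => hX l hl i j

theorem convL_comm (a b : Alg) : convL a b = convL b a :=
  dens_ext fun t ξ => by
    rw [dens_convL, dens_convL, ← integral_sub_left_eq_self _ volume ξ]
    refine integral_congr_ae (Filter.Eventually.of_forall fun η => ?_)
    simp only [sub_sub_cancel]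
    ring

/-- Conjugate transposition reverses the order of a product; since convolution of entries is
commutative, the usual computation in a matrix Lie algebra goes through. -/
theorem IsSkewM.brM {X Y : MatAlg n} (hX : IsSkewM X) (hY : IsSkewM Y) : IsSkewM (brM X Y) :=
  fun i j => by
    simp only [_root_.brM, map_sum, map_sub, invol_convL, ← Finset.sum_neg_distrib]
    refine Finset.sum_congr rfl fun k _ => ?_
    rw [hX k j, hY i k, hY k j, hX i k]
    simp only [map_neg, _root_.neg_apply, neg_neg]
    rw [convL_comm (X k j), convL_comm (Y k j)]
    abel

/-- The skew-Hermitian part. -/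
def skewPart (X : MatAlg n) : MatAlg n := fun i j => (1 / 2 : ℝ) • (X i j - invol (X j i))

theorem isSkewM_skewPart (X : MatAlg n) : IsSkewM (skewPart X) := fun i j => by
  simp only [skewPart, map_smul, map_sub, invol_invol]
  rw [← smul_neg, neg_sub]

theorem skewPart_of_isSkewM {X : MatAlg n} (hX : IsSkewM X) : skewPart X = X := by
  ext1 i; ext1 j
  rw [skewPart, hX i j, sub_neg_eq_add, ← two_smul ℝ, smul_smul]
  norm_num

theorem trace_brM (X Y : MatAlg n) : ∑ i, brM X Y i i = 0 := by
  simp only [brM, Finset.sum_sub_distrib]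
  rw [sub_eq_zero, Finset.sum_comm]
  refine Finset.sum_congr rfl fun i _ => Finset.sum_congr rfl fun j _ => ?_
  exact convL_comm _ _

/-- The right-hand side of the equation for `A_ν` on the Fourier side. -/
def nlA (Z : JetSp n) (ν : Fin 4) : MatAlg n :=
  ∑ l, minkowski l •
    (-(2 : ℝ) • brM (Z none (.inl l)) (Z (some l) (.inl ν))
      + brM (Z none (.inl l)) (Z (some ν) (.inl l))
      - brM (Z none (.inl l)) (brM (Z none (.inl l)) (Z none (.inl ν))))

/-- The right-hand side of the equation for `F_{μν}` on the Fourier side. -/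
def nlF (Z : JetSp n) (μ ν : Fin 4) : MatAlg n :=
  ∑ l, minkowski l •
    (-(2 : ℝ) • brM (Z none (.inl l)) (Z (some l) (.inr (μ, ν)))
      + (2 : ℝ) • brM (Z (some ν) (.inl l)) (Z (some l) (.inl μ))
      - (2 : ℝ) • brM (Z (some μ) (.inl l)) (Z (some l) (.inl ν))
      + (2 : ℝ) • brM (Z (some l) (.inl μ)) (Z (some l) (.inl ν))
      + (2 : ℝ) • brM (Z (some μ) (.inl l)) (Z (some ν) (.inl l))
      - brM (Z none (.inl l)) (brM (Z none (.inl l)) (Z none (.inr (μ, ν))))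
      + (2 : ℝ) • brM (Z none (.inr (l, μ))) (brM (Z none (.inl l)) (Z none (.inl ν)))
      - (2 : ℝ) • brM (Z none (.inr (l, ν))) (brM (Z none (.inl l)) (Z none (.inl μ)))
      - (2 : ℝ) • brM (brM (Z none (.inl l)) (Z none (.inl μ)))
          (brM (Z none (.inl l)) (Z none (.inl ν))))

/-- The nonlinearity of the Yang-Mills system on the Fourier side. -/
def nl (Z : JetSp n) : FieldSpace n := Sum.elim (nlA Z) (fun q => nlF Z q.1 q.2)

/-- Skew-Hermitian fields with `F` a two-form. -/
structure IsSymField (G : FieldSpace n) : Prop where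
  skew : ∀ k, IsSkewM (G k)
  antisymm : ∀ μ ν, G (.inr (μ, ν)) = -G (.inr (ν, μ))

theorem brM_swap (X Y : MatAlg n) : brM X Y = -brM Y X := by
  ext1 i; ext1 j
  simp only [brM, Pi.neg_apply, ← Finset.sum_neg_distrib, neg_sub]

theorem brM_neg_right (X Y : MatAlg n) : brM X (-Y) = -brM X Y := by
  ext1 i; ext1 j
  simp only [brM, Pi.neg_apply, ← Finset.sum_neg_distrib, map_neg,
    _root_.neg_apply]
  refine Finset.sum_congr rfl fun k _ => ?_
  abel

/-- The two terms [∂A, ∂A] with mixed indices exchange places, as do the two terms [F, [A, A]]. The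
terms linear in F_{μν} change sign with F, and the remaining ones by the antisymmetry of the
bracket. -/
theorem nlF_swap {Z : JetSp n} (hZ : ∀ o, IsSymField (Z o)) (μ ν : Fin 4) :
    nlF Z μ ν = -nlF Z ν μ := by
  simp only [nlF, ← Finset.sum_neg_distrib, ← smul_neg]
  refine Finset.sum_congr rfl fun l _ => ?_
  congr 1
  rw [(hZ (some l)).antisymm μ ν, (hZ none).antisymm μ ν, brM_neg_right, brM_neg_right,
    brM_neg_right, brM_swap (Z (some l) (.inl μ)) (Z (some l) (.inl ν)),
    brM_swap (Z (some μ) (.inl l)) (Z (some ν) (.inl l)),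
    brM_swap (brM (Z none (.inl l)) (Z none (.inl μ))) (brM (Z none (.inl l)) (Z none (.inl ν)))]
  module

theorem isSkewM_nlA {Z : JetSp n} (hZ : ∀ o, IsSymField (Z o)) (ν : Fin 4) :
    IsSkewM (nlA Z ν) := by
  unfold nlA
  refine IsSkewM.sum _ fun l _ => IsSkewM.smul _ ?_
  have h := fun o k => (hZ o).skew k
  refine .sub (.add (.smul _ (.brM ?_ ?_)) (.brM ?_ ?_)) (.brM ?_ (.brM ?_ ?_)) <;> exact h _ _

theorem isSkewM_nlF {Z : JetSp n} (hZ : ∀ o, IsSymField (Z o)) (μ ν : Fin 4) :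
    IsSkewM (nlF Z μ ν) := by
  unfold nlF
  refine IsSkewM.sum _ fun l _ => IsSkewM.smul _ ?_
  have h := fun o k => (hZ o).skew k
  refine .sub (.sub (.add (.sub (.add (.add (.sub (.add ?_ ?_) ?_) ?_) ?_) ?_) ?_) ?_) ?_
  · exact .smul _ (.brM (h _ _) (h _ _))
  · exact .smul _ (.brM (h _ _) (h _ _))
  · exact .smul _ (.brM (h _ _) (h _ _))
  · exact .smul _ (.brM (h _ _) (h _ _))
  · exact .smul _ (.brM (h _ _) (h _ _))
  · exact .brM (h _ _) (.brM (h _ _) (h _ _))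
  · exact .smul _ (.brM (h _ _) (.brM (h _ _) (h _ _)))
  · exact .smul _ (.brM (h _ _) (.brM (h _ _) (h _ _)))
  · exact .smul _ (.brM (.brM (h _ _) (h _ _)) (.brM (h _ _) (h _ _)))

theorem isSymField_nl {Z : JetSp n} (hZ : ∀ o, IsSymField (Z o)) : IsSymField (nl Z) where
  skew k := by
    rcases k with ν | ⟨μ, ν⟩
    · exact isSkewM_nlA hZ ν
    · exact isSkewM_nlF hZ μ ν
  antisymm μ ν := nlF_swap hZ μ ν

/-- The projection onto skew-Hermitian fields with `F` a two-form. -/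
def projSym (G : FieldSpace n) : FieldSpace n :=
  Sum.elim (fun l => skewPart (G (.inl l)))
    (fun q => skewPart ((1 / 2 : ℝ) • (G (.inr (q.1, q.2)) - G (.inr (q.2, q.1)))))

theorem isSymField_projSym (G : FieldSpace n) : IsSymField (projSym G) where
  skew k := by
    rcases k with l | q
    · exact isSkewM_skewPart _
    · exact isSkewM_skewPart _
  antisymm μ ν := by
    ext1 i; ext1 j
    simp only [projSym, Sum.elim_inr, skewPart, Pi.neg_apply, Pi.smul_apply, Pi.sub_apply,
      map_smul, map_sub]
    module

theorem projSym_of_isSymField {G : FieldSpace n} (hG : IsSymField G) : projSym G = G := by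
  ext1 k
  rcases k with l | ⟨μ, ν⟩
  · exact skewPart_of_isSkewM (hG.skew _)
  · have : (1 / 2 : ℝ) • (G (.inr (μ, ν)) - G (.inr (ν, μ))) = G (.inr (μ, ν)) := by
      rw [hG.antisymm ν μ, sub_neg_eq_add, ← two_smul ℝ, smul_smul]
      norm_num
    simp only [projSym, Sum.elim_inr]
    rw [this]
    exact skewPart_of_isSkewM (hG.skew _)

/-- The Duhamel integrals of `G` together with their first derivatives. -/
def duhJet (hT : 0 ≤ T) (G : FieldSpace n) : JetSp n :=
  fun o k i j => duhL hT (isMultiplier_jetMul o) (G k i j)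

theorem isSymField_duhJet (hT : 0 ≤ T) {G : FieldSpace n} (hG : IsSymField G)
    (o : Option (Fin 4)) : IsSymField (duhJet hT G o) where
  skew k i j := by
    simp only [duhJet]
    rw [invol_duhL, hG.skew k i j, map_neg]
  antisymm μ ν := by
    ext1 i; ext1 j
    simp only [duhJet, Pi.neg_apply]
    rw [hG.antisymm μ ν, Pi.neg_apply, Pi.neg_apply, map_neg]

theorem IsSymField.sub {G H : FieldSpace n} (hG : IsSymField G) (hH : IsSymField H) :
    IsSymField (G - H) where
  skew k := (hG.skew k).sub (hH.skew k)
  antisymm μ ν := by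
    simp only [Pi.sub_apply]
    rw [hG.antisymm μ ν, hH.antisymm μ ν]; abel

theorem IsSymField.smul {G : FieldSpace n} (c : ℝ) (hG : IsSymField G) :
    IsSymField (c • G) where
  skew k := (hG.skew k).smul c
  antisymm μ ν := by
    simp only [Pi.smul_apply]
    rw [hG.antisymm μ ν, smul_neg]

/-! ### Maps vanishing to second order at the origin -/

section Quadratic

variable {J E E' : Type*} [NormedAddCommGroup J] [NormedSpace ℝ J] [NormedAddCommGroup E]
  [NormedSpace ℝ E] [NormedAddCommGroup E'] [NormedSpace ℝ E']

/-- A `C²` map vanishing at the origin. -/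
structure VanishAtZero (f : J → E) : Prop where
  smooth : ContDiff ℝ 2 f
  zero : f 0 = 0

/-- A `C²` map vanishing to second order at the origin. -/
structure QuadAtZero (f : J → E) : Prop extends VanishAtZero f where
  deriv : HasFDerivAt f (0 : J →L[ℝ] E) 0

theorem QuadAtZero.add {f g : J → E} (hf : QuadAtZero f) (hg : QuadAtZero g) :
    QuadAtZero (fun x => f x + g x) :=
  ⟨⟨hf.smooth.add hg.smooth, by simp [hf.zero, hg.zero]⟩, by
    simpa using! hf.deriv.add hg.deriv⟩

theorem QuadAtZero.sub {f g : J → E} (hf : QuadAtZero f) (hg : QuadAtZero g) :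
    QuadAtZero (fun x => f x - g x) :=
  ⟨⟨hf.smooth.sub hg.smooth, by simp [hf.zero, hg.zero]⟩, by
    simpa using! hf.deriv.sub hg.deriv⟩

theorem QuadAtZero.clm {f : J → E} (hf : QuadAtZero f) (L : E →L[ℝ] E') :
    QuadAtZero (fun x => L (f x)) :=
  ⟨⟨L.contDiff.comp hf.smooth, by simp [hf.zero]⟩, by
    have := L.hasFDerivAt.comp (0 : J) hf.deriv
    simpa using! this⟩

theorem QuadAtZero.smul {f : J → E} (hf : QuadAtZero f) (c : ℝ) :
    QuadAtZero (fun x => c • f x) := hf.clm (c • ContinuousLinearMap.id ℝ E)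

theorem QuadAtZero.sum {ι : Type*} (s : Finset ι) {f : ι → J → E}
    (hf : ∀ l ∈ s, QuadAtZero (f l)) : QuadAtZero (fun x => ∑ l ∈ s, f l x) :=
  ⟨⟨ContDiff.sum fun l hl => (hf l hl).smooth,
    Finset.sum_eq_zero fun l hl => (hf l hl).zero⟩, by
    have := HasFDerivAt.fun_sum fun l hl => (hf l hl).deriv
    simpa using this⟩

theorem QuadAtZero.pi {ι : Type*} [Fintype ι] {E : ι → Type*}
    [∀ i, NormedAddCommGroup (E i)] [∀ i, NormedSpace ℝ (E i)] {f : J → ∀ i, E i}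
    (hf : ∀ i, QuadAtZero (fun x => f x i)) : QuadAtZero f :=
  ⟨⟨contDiff_pi.2 fun i => (hf i).smooth, funext fun i => (hf i).zero⟩, by
    rw [hasFDerivAt_pi']
    intro i
    simpa using (hf i).deriv⟩

theorem VanishAtZero.pi_apply {ι : Type*} [Fintype ι] {E : ι → Type*}
    [∀ i, NormedAddCommGroup (E i)] [∀ i, NormedSpace ℝ (E i)] {f : J → ∀ i, E i}
    (hf : VanishAtZero f) (i : ι) : VanishAtZero (fun x => f x i) :=
  ⟨contDiff_pi.1 hf.smooth i, by simp [hf.zero]⟩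

theorem QuadAtZero.pi_apply {ι : Type*} [Fintype ι] {E : ι → Type*}
    [∀ i, NormedAddCommGroup (E i)] [∀ i, NormedSpace ℝ (E i)] {f : J → ∀ i, E i}
    (hf : QuadAtZero f) (i : ι) : QuadAtZero (fun x => f x i) :=
  hf.clm (ContinuousLinearMap.proj i)

/-- The derivative of B(f, g) at 0 is B(f 0, g' ·) + B(f' ·, g 0), and both f 0 and g 0 vanish. -/
theorem QuadAtZero.bilin {E'' : Type*} [NormedAddCommGroup E''] [NormedSpace ℝ E'']
    (B : E →L[ℝ] E' →L[ℝ] E'') {f : J → E} {g : J → E'} (hf : VanishAtZero f)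
    (hg : VanishAtZero g) : QuadAtZero (fun x => B (f x) (g x)) :=
  ⟨⟨B.isBoundedBilinearMap.contDiff.comp (hf.smooth.prodMk hg.smooth), by simp [hf.zero]⟩, by
    have h1 := (hf.smooth.differentiable (by norm_num) 0).hasFDerivAt
    have h2 := (hg.smooth.differentiable (by norm_num) 0).hasFDerivAt
    have h3 := (B.isBoundedBilinearMap.hasFDerivAt (f 0, g 0)).comp (0 : J) (h1.prodMk h2)
    refine h3.congr_fderiv ?_
    ext1 v
    simp [hf.zero, hg.zero]⟩

theorem QuadAtZero.convL {f g : J → Alg} (hf : VanishAtZero f) (hg : VanishAtZero g) :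
    QuadAtZero (fun x => _root_.convL (f x) (g x)) :=
  QuadAtZero.bilin (E := Alg) (E' := Alg) (E'' := Alg) _root_.convL hf hg

theorem QuadAtZero.brM {f g : J → MatAlg n} (hf : VanishAtZero f) (hg : VanishAtZero g) :
    QuadAtZero (fun x => brM (f x) (g x)) :=
  QuadAtZero.pi fun i => QuadAtZero.pi fun j => QuadAtZero.sum _ fun k _ =>
    (QuadAtZero.convL ((hf.pi_apply i).pi_apply k) ((hg.pi_apply k).pi_apply j)).sub
      (QuadAtZero.convL ((hg.pi_apply i).pi_apply k) ((hf.pi_apply k).pi_apply j))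

end Quadratic

theorem vanishAtZero_coord (o : Option (Fin 4)) (k : FieldIdx) :
    VanishAtZero (fun Z : JetSp n => Z o k) :=
  ⟨((ContinuousLinearMap.proj (R := ℝ) k).comp
    (ContinuousLinearMap.proj (R := ℝ) (φ := fun _ : Option (Fin 4) => FieldSpace n) o)).contDiff,
    rfl⟩

theorem quadAtZero_nlA (ν : Fin 4) : QuadAtZero (fun Z : JetSp n => nlA Z ν) := by
  unfold nlA
  refine QuadAtZero.sum _ fun l _ => QuadAtZero.smul ?_ _
  have h := vanishAtZero_coord (n := n)
  refine .sub (.add (.smul (.brM ?_ ?_) _) (.brM ?_ ?_))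
    (.brM ?_ (QuadAtZero.toVanishAtZero (.brM ?_ ?_))) <;> exact h _ _

theorem quadAtZero_nlF (μ ν : Fin 4) : QuadAtZero (fun Z : JetSp n => nlF Z μ ν) := by
  unfold nlF
  refine QuadAtZero.sum _ fun l _ => QuadAtZero.smul ?_ _
  have h := vanishAtZero_coord (n := n)
  have h2 := fun o k o' k' => (QuadAtZero.brM (h o k) (h o' k')).toVanishAtZero
  refine .sub (.sub (.add (.sub (.add (.add (.sub (.add ?_ ?_) ?_) ?_) ?_) ?_) ?_) ?_) ?_
  · exact .smul (.brM (h _ _) (h _ _)) _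
  · exact .smul (.brM (h _ _) (h _ _)) _
  · exact .smul (.brM (h _ _) (h _ _)) _
  · exact .smul (.brM (h _ _) (h _ _)) _
  · exact .smul (.brM (h _ _) (h _ _)) _
  · exact .brM (h _ _) (h2 _ _ _ _)
  · exact .smul (.brM (h _ _) (h2 _ _ _ _)) _
  · exact .smul (.brM (h _ _) (h2 _ _ _ _)) _
  · exact .smul (.brM (h2 _ _ _ _) (h2 _ _ _ _)) _

theorem quadAtZero_nl : QuadAtZero (nl : JetSp n → FieldSpace n) :=
  QuadAtZero.pi fun k => by
    rcases k with ν | ⟨μ, ν⟩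
    · exact quadAtZero_nlA ν
    · exact quadAtZero_nlF μ ν

theorem QuadAtZero.skewPart {J : Type*} [NormedAddCommGroup J] [NormedSpace ℝ J]
    {f : J → MatAlg n} (hf : QuadAtZero f) : QuadAtZero (fun x => skewPart (f x)) :=
  QuadAtZero.pi fun i => QuadAtZero.pi fun j =>
    (((hf.pi_apply i).pi_apply j).sub (((hf.pi_apply j).pi_apply i).clm invol)).smul _

theorem QuadAtZero.projSym {J : Type*} [NormedAddCommGroup J] [NormedSpace ℝ J]
    {f : J → FieldSpace n} (hf : QuadAtZero f) : QuadAtZero (fun x => projSym (f x)) :=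
  QuadAtZero.pi fun k => by
    rcases k with l | q
    · exact (hf.pi_apply _).skewPart
    · exact (((hf.pi_apply _).sub (hf.pi_apply _)).smul _).skewPart

theorem QuadAtZero.duhJet {J : Type*} [NormedAddCommGroup J] [NormedSpace ℝ J] (hT : 0 ≤ T)
    {f : J → FieldSpace n} (hf : QuadAtZero f) : QuadAtZero (fun x => duhJet hT (f x)) :=
  QuadAtZero.pi fun _ => QuadAtZero.pi fun k => QuadAtZero.pi fun i => QuadAtZero.pi fun j =>
    (((hf.pi_apply k).pi_apply i).pi_apply j).clm (duhL hT _)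

/-- Small data `ε L` launch a solution of the integral equation, differentiable in `ε` at `0`. -/
theorem exists_jet_solution (hT : 0 ≤ T) {L : JetSp n} (hL : ∀ o, IsSymField (L o)) :
    ∃ Z : ℝ → JetSp n, Z 0 = 0 ∧ HasDerivAt Z L 0 ∧
      ∀ᶠ ε in nhds (0 : ℝ), Z ε = ε • L - duhJet hT (nl (Z ε)) ∧ ∀ o, IsSymField (Z ε o) := by
  -- The projection makes every solution of the modified equation symmetric by construction, without
  -- a uniqueness argument. On symmetric jets the nonlinearity is already symmetric, so the
  -- projection can be dropped again at the end.
  set Q : JetSp n → JetSp n := fun Z => duhJet hT (projSym (nl Z)) with hQ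
  have q : QuadAtZero Q := (quadAtZero_nl.projSym).duhJet hT
  set Ψ : JetSp n → JetSp n := fun Z => Z + Q Z with hΨ
  -- As Q vanishes to second order, Ψ is tangent to the identity at 0, and so is its local inverse.
  -- This gives both the solution and its first-order expansion in ε.
  have hΨs : HasStrictFDerivAt Ψ
      ((ContinuousLinearEquiv.refl ℝ (JetSp n) : JetSp n ≃L[ℝ] JetSp n) : JetSp n →L[ℝ] JetSp n)
      0 := by
    have hc : ContDiff ℝ 2 Ψ := contDiff_id.add q.smooth
    refine hc.contDiffAt.hasStrictFDerivAt' ?_ (by norm_num)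
    have := (hasFDerivAt_id (𝕜 := ℝ) (0 : JetSp n)).add q.deriv
    exact this.congr_fderiv (add_zero _)
  have hΨ0 : Ψ 0 = 0 := by simp [hΨ, q.zero]
  set Λ := hΨs.localInverse Ψ _ 0 with hΛ
  have hΛ0 : Λ 0 = 0 := by
    have := hΨs.localInverse_apply_image
    rwa [hΨ0] at this
  have hr : ∀ᶠ y in nhds (0 : JetSp n), Ψ (Λ y) = y := by
    have := hΨs.eventually_right_inverse
    rwa [hΨ0] at this
  have hd : HasStrictFDerivAt Λ (ContinuousLinearMap.id ℝ (JetSp n)) 0 := by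
    have := hΨs.to_localInverse
    rwa [hΨ0] at this
  have hlin : HasDerivAt (fun ε : ℝ => ε • L) L 0 := by
    simpa using (hasDerivAt_id (0 : ℝ)).smul_const L
  refine ⟨fun ε => Λ (ε • L), by simp [hΛ0], ?_, ?_⟩
  · have h1 : HasFDerivAt Λ (ContinuousLinearMap.id ℝ (JetSp n)) ((0 : ℝ) • L) := by
      rw [zero_smul]; exact hd.hasFDerivAt
    simpa using! h1.comp_hasDerivAt (0 : ℝ) hlin
  · have ht : Filter.Tendsto (fun ε : ℝ => ε • L) (nhds 0) (nhds 0) := by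
      have := hlin.continuousAt.tendsto
      simpa using this
    filter_upwards [ht.eventually hr] with ε hε
    have e1 : Λ (ε • L) = ε • L - duhJet hT (projSym (nl (Λ (ε • L)))) := eq_sub_of_add_eq hε
    have hs : ∀ o, IsSymField (Λ (ε • L) o) := fun o => by
      rw [e1]
      exact ((hL o).smul ε).sub (isSymField_duhJet hT (isSymField_projSym _) o)
    refine ⟨?_, hs⟩
    rwa [projSym_of_isSymField (isSymField_nl hs)] at e1

end JetSpace

/-! ### From the integral equation to smooth solutions of the wave equations -/

noncomputable section WaveJets

variable {n : ℕ} {T : ℝ}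

/-- `Z` consists of solutions of the wave equations `□ u = nl Z` and of their first derivatives. -/
structure IsWaveJet (T : ℝ) (Z : JetSp n) : Prop where
  time : ∀ k i j, ∀ t ∈ Ioo (-T) T, ∀ ξ, HasDerivAt (fun τ => dens (Z none k i j) τ ξ)
    (dens (Z (some 0) k i j) t ξ) t
  wave : ∀ k i j, ∀ t ∈ Ioo (-T) T, ∀ ξ, HasDerivAt (fun τ => dens (Z (some 0) k i j) τ ξ)
    (-(((disp ξ ^ 2 : ℝ) : ℂ) * dens (Z none k i j) t ξ) - dens (nl Z k i j) t ξ) t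
  space : ∀ (l : Fin 3) k i j t ξ,
    dens (Z (some l.succ) k i j) t ξ = freqMul l ξ * dens (Z none k i j) t ξ

/-- All entries have `m` rapidly decaying time derivatives. -/
def RegM (I : Set ℝ) (m : ℕ) (X : MatAlg n) : Prop := ∀ i j, Reg I m (dens (X i j))

section RegM

variable {I : Set ℝ} {m : ℕ}

theorem Reg.congr {h g : ℝ → Space → ℂ} (hh : Reg I m h) (e : ∀ t ξ, g t ξ = h t ξ) :
    Reg I m g := by
  have : g = h := by ext t ξ; exact e t ξ
  rwa [this]

theorem RegM.add {X Y : MatAlg n} (hX : RegM I m X) (hY : RegM I m Y) : RegM I m (X + Y) :=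
  fun i j => ((hX i j).add (hY i j)).congr fun t ξ => dens_add _ _ t ξ

theorem RegM.sub {X Y : MatAlg n} (hX : RegM I m X) (hY : RegM I m Y) : RegM I m (X - Y) :=
  fun i j => ((hX i j).sub (hY i j)).congr fun t ξ => dens_sub _ _ t ξ

theorem RegM.smul {X : MatAlg n} (c : ℝ) (hX : RegM I m X) : RegM I m (c • X) :=
  fun i j => ((hX i j).mul_poly (PolyGrowth.const c)).congr fun t ξ => dens_smul _ _ t ξ

theorem reg_dens_sum {ι : Type*} (s : Finset ι) {a : ι → Alg} (ha : ∀ l ∈ s, Reg I m (dens (a l))) :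
    Reg I m (dens (∑ l ∈ s, a l)) := by
  classical
  induction s using Finset.induction_on with
  | empty => exact (Reg.zero m).congr fun t ξ => by simp
  | insert l s hl ih =>
    rw [Finset.sum_insert hl]
    exact ((ha l (Finset.mem_insert_self _ _)).add
      (ih fun k hk => ha k (Finset.mem_insert_of_mem hk))).congr fun t ξ => dens_add _ _ t ξ

theorem RegM.sum {ι : Type*} (s : Finset ι) {X : ι → MatAlg n} (hX : ∀ l ∈ s, RegM I m (X l)) :
    RegM I m (∑ l ∈ s, X l) := fun i j => by
  simp only [Finset.sum_apply]
  exact reg_dens_sum s fun l hl => hX l hl i j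

theorem RegM.brM (hI : IsOpen I) {X Y : MatAlg n} (hX : RegM I m X) (hY : RegM I m Y) :
    RegM I m (brM X Y) := fun i j =>
  reg_dens_sum _ fun k _ => (((hX i k).conv hI (hY k j)).sub ((hY i k).conv hI (hX k j))).congr
    fun t ξ => by rw [dens_sub, dens_convL, dens_convL]

theorem RegM.nlA (hI : IsOpen I) {Z : JetSp n} (hZ : ∀ o k, RegM I m (Z o k)) (ν : Fin 4) :
    RegM I m (nlA Z ν) := by
  unfold _root_.nlA
  refine RegM.sum _ fun l _ => RegM.smul _ ?_
  have h := fun o k o' k' => RegM.brM hI (hZ o k) (hZ o' k')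
  exact .sub (.add (.smul _ (h _ _ _ _)) (h _ _ _ _)) (.brM hI (hZ _ _) (h _ _ _ _))

theorem RegM.nlF (hI : IsOpen I) {Z : JetSp n} (hZ : ∀ o k, RegM I m (Z o k)) (μ ν : Fin 4) :
    RegM I m (nlF Z μ ν) := by
  unfold _root_.nlF
  refine RegM.sum _ fun l _ => RegM.smul _ ?_
  have h := fun o k o' k' => RegM.brM hI (hZ o k) (hZ o' k')
  refine .sub (.sub (.add (.sub (.add (.add (.sub (.add ?_ ?_) ?_) ?_) ?_) ?_) ?_) ?_) ?_
  · exact .smul _ (h _ _ _ _)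
  · exact .smul _ (h _ _ _ _)
  · exact .smul _ (h _ _ _ _)
  · exact .smul _ (h _ _ _ _)
  · exact .smul _ (h _ _ _ _)
  · exact .brM hI (hZ _ _) (h _ _ _ _)
  · exact .smul _ (.brM hI (hZ _ _) (h _ _ _ _))
  · exact .smul _ (.brM hI (hZ _ _) (h _ _ _ _))
  · exact .smul _ (.brM hI (h _ _ _ _) (h _ _ _ _))

theorem RegM.nl (hI : IsOpen I) {Z : JetSp n} (hZ : ∀ o k, RegM I m (Z o k)) (k : FieldIdx) :
    RegM I m (nl Z k) := by
  rcases k with ν | ⟨μ, ν⟩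
  · exact RegM.nlA hI hZ ν
  · exact RegM.nlF hI hZ μ ν

end RegM

theorem polyGrowth_disp_sq : PolyGrowth (fun ξ => -((disp ξ ^ 2 : ℝ) : ℂ)) where
  cont := by
    have := continuous_disp
    fun_prop
  bound := ⟨(2 * Real.pi) ^ 2, 2, by positivity, fun ξ => by
    rw [norm_neg, Complex.norm_real, Real.norm_of_nonneg (by positivity), disp, mul_pow]
    gcongr
    linarith⟩

namespace IsWaveJet

variable {Z : JetSp n}

/-- The solutions are smooth in time. -/
theorem regM (hZ : IsWaveJet T Z) (m : ℕ) : ∀ o k, RegM (Ioo (-T) T) m (Z o k) := by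
  induction m with
  | zero => exact fun o k i j => rapidOn_dens _ _
  | succ m ih =>
    -- The fields gain a time derivative because their own time derivative is a component of the
    -- jet. That component gains one through the wave equation, whose right-hand side is known to
    -- order m. The space derivatives inherit theirs from the fields.
    have h0 : ∀ k, RegM (Ioo (-T) T) (m + 1) (Z none k) := fun k i j =>
      ⟨rapidOn_dens _ _, _, ih (some 0) k i j, hZ.time k i j⟩
    intro o k i j
    rcases o with _ | μ
    · exact h0 k i j
    · refine Fin.cases ?_ (fun l => ?_) μ
      · refine ⟨rapidOn_dens _ _, _, ?_, hZ.wave k i j⟩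
        refine (((ih none k i j).mul_poly polyGrowth_disp_sq).sub
          (RegM.nl isOpen_Ioo ih k i j)).congr fun t ξ => ?_
        rw [neg_mul]
      · exact ((h0 k i j).mul_poly (polyGrowth_freqMul l)).congr (hZ.space l k i j)

theorem contDiffOn_ev (hZ : IsWaveJet T Z) (o : Option (Fin 4)) (k : FieldIdx) (i j : Fin n) :
    ContDiffOn ℝ ∞ (ev (Z o k i j)) (Ioo (-T) T ×ˢ univ) := by
  rw [contDiffOn_infty, ev_eq_synth]
  exact fun m => (hZ.regM m o k i j).contDiffOn_synth isOpen_Ioo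

theorem pd_evM (hZ : IsWaveJet T Z) (μ : Fin 4) (k : FieldIdx) {p : Spacetime}
    (hp : p.1 ∈ Ioo (-T) T) : pd μ (evM (Z none k)) p = evM (Z (some μ) k) p := by
  ext i j
  simp only [pd, Matrix.of_apply, evM_apply]
  change fderiv ℝ (ev (Z none k i j)) p (coordVec μ) = _
  simp only [ev_eq_synth]
  refine Fin.cases ?_ (fun l => ?_) μ
  · exact fderiv_synth_time isOpen_Ioo (rapidOn_dens _ _) (rapidOn_dens _ _) (hZ.time k i j) hp
  · rw [fderiv_synth_space isOpen_Ioo (rapidOn_dens _ _) (rapidOn_dens _ _) (hZ.time k i j) hp]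
    congr 1
    ext t ξ
    exact (hZ.space l k i j t ξ).symm

theorem rapidOn_wave (hZ : IsWaveJet T Z) (k : FieldIdx) (i j : Fin n) :
    RapidOn (Ioo (-T) T) fun t ξ =>
      -(((disp ξ ^ 2 : ℝ) : ℂ) * dens (Z none k i j) t ξ) - dens (nl Z k i j) t ξ := by
  have h : Reg (Ioo (-T) T) 0 fun t ξ =>
      -(((disp ξ ^ 2 : ℝ) : ℂ) * dens (Z none k i j) t ξ) - dens (nl Z k i j) t ξ :=
    (((hZ.regM 0 none k i j).mul_poly polyGrowth_disp_sq).sub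
      (RegM.nl isOpen_Ioo (hZ.regM 0) k i j)).congr fun t ξ => by rw [neg_mul]
  exact h

/-- The formula for the first derivatives is only available in the open slab, but it holds in a
neighbourhood of p, and an outer derivative sees no more than that. -/
theorem pd_pd_evM (hZ : IsWaveJet T Z) (μ μ' : Fin 4) (k : FieldIdx) {p : Spacetime}
    (hp : p.1 ∈ Ioo (-T) T) :
    pd μ (pd μ' (evM (Z none k))) p = pd μ (evM (Z (some μ') k)) p := by
  have hΩ : (Ioo (-T) T ×ˢ univ : Set Spacetime) ∈ nhds p :=
    (isOpen_Ioo.prod isOpen_univ).mem_nhds ⟨hp, mem_univ _⟩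
  ext i j
  simp only [pd, Matrix.of_apply]
  congr 1
  refine Filter.EventuallyEq.fderiv_eq (Filter.eventually_of_mem hΩ fun q hq => ?_)
  have := congrFun (congrFun (hZ.pd_evM μ' k (p := q) hq.1) i) j
  exact this

theorem pd_evM_time (hZ : IsWaveJet T Z) (l : Fin 3) (k : FieldIdx) {p : Spacetime}
    (hp : p.1 ∈ Ioo (-T) T) (i j : Fin n) :
    pd l.succ (evM (Z (some 0) k)) p i j =
      synth (fun t ξ => freqMul l ξ * dens (Z (some 0) k i j) t ξ) p := by
  simp only [pd, Matrix.of_apply]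
  change fderiv ℝ (ev (Z (some 0) k i j)) p (coordVec l.succ) = _
  rw [ev_eq_synth]
  exact fderiv_synth_space isOpen_Ioo (rapidOn_dens _ _) (hZ.rapidOn_wave k i j)
    (hZ.wave k i j) hp l

theorem pd_zero_evM_time (hZ : IsWaveJet T Z) (k : FieldIdx) {p : Spacetime}
    (hp : p.1 ∈ Ioo (-T) T) (i j : Fin n) :
    pd 0 (evM (Z (some 0) k)) p i j = synth (fun t ξ =>
      -(((disp ξ ^ 2 : ℝ) : ℂ) * dens (Z none k i j) t ξ) - dens (nl Z k i j) t ξ) p := by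
  simp only [pd, Matrix.of_apply]
  change fderiv ℝ (ev (Z (some 0) k i j)) p (coordVec 0) = _
  rw [ev_eq_synth]
  exact fderiv_synth_time isOpen_Ioo (rapidOn_dens _ _) (hZ.rapidOn_wave k i j)
    (hZ.wave k i j) hp

theorem pd_evM_space (hZ : IsWaveJet T Z) (l : Fin 3) (k : FieldIdx) {p : Spacetime}
    (hp : p.1 ∈ Ioo (-T) T) (i j : Fin n) :
    pd l.succ (evM (Z (some l.succ) k)) p i j =
      synth (fun t ξ => freqMul l ξ * (freqMul l ξ * dens (Z none k i j) t ξ)) p := by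
  have hreg := hZ.regM 1 (some l.succ) k i j
  obtain ⟨h1, h', h2, h3⟩ := hreg
  simp only [pd, Matrix.of_apply]
  change fderiv ℝ (ev (Z (some l.succ) k i j)) p (coordVec l.succ) = _
  rw [ev_eq_synth, fderiv_synth_space isOpen_Ioo h1 h2.rapid h3 hp]
  congr 1
  ext t ξ
  rw [hZ.space]

/-- The Laplacian multiplies the density by Σ `freqMul`² = -`disp`², which cancels the corresponding
term of -∂_t²; only the source is left. -/
theorem dAlembert_evM (hZ : IsWaveJet T Z) (k : FieldIdx) {p : Spacetime}
    (hp : p.1 ∈ Ioo (-T) T) : dAlembert (evM (Z none k)) p = evM (nl Z k) p := by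
  have hm0 : minkowski 0 = -1 := by simp [minkowski]
  have hms : ∀ l : Fin 3, minkowski l.succ = 1 := fun l => by
    simp [minkowski, Fin.succ_ne_zero]
  ext i j
  rw [dAlembert, Fin.sum_univ_succ]
  simp only [hm0, hms, one_smul, Matrix.add_apply, Matrix.sum_apply, neg_smul, Matrix.neg_apply]
  simp only [hZ.pd_pd_evM _ _ k hp, hZ.pd_zero_evM_time k hp, hZ.pd_evM_space _ k hp]
  rw [evM_apply, ev_eq_synth]
  have hz := rapidOn_dens (Ioo (-T) T) (Z none k i j)
  have hl : ∀ l : Fin 3, Integrable fun ξ => Real.fourierChar (inner ℝ ξ p.2) •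
      (freqMul l ξ * (freqMul l ξ * dens (Z none k i j) p.1 ξ)) := fun l =>
    integrable_char_smul (((hz.mul_poly (polyGrowth_freqMul l)).mul_poly
      (polyGrowth_freqMul l)).integrable hp) p.2
  simp only [synth]
  have h0 : Integrable fun ξ => -(Real.fourierChar (inner ℝ ξ p.2) •
      (-(((disp ξ ^ 2 : ℝ) : ℂ) * dens (Z none k i j) p.1 ξ) - dens (nl Z k i j) p.1 ξ)) :=
    (integrable_char_smul ((hZ.rapidOn_wave k i j).integrable hp) p.2).neg
  rw [← integral_finsetSum _ fun l _ => hl l, ← integral_neg, ← integral_add h0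
    (integrable_finsetSum _ fun l _ => hl l)]
  refine integral_congr_ae (Filter.Eventually.of_forall fun ξ => ?_)
  have e : -(-(((disp ξ ^ 2 : ℝ) : ℂ) * dens (Z none k i j) p.1 ξ) - dens (nl Z k i j) p.1 ξ) +
      ∑ l : Fin 3, freqMul l ξ * (freqMul l ξ * dens (Z none k i j) p.1 ξ) =
      dens (nl Z k i j) p.1 ξ := by
    simp only [disp_sq, ← mul_assoc, ← Finset.sum_mul, ← sq]
    ring
  refine Eq.trans ?_ (congrArg (Real.fourierChar (inner ℝ ξ p.2) • ·) e)
  simp only [smul_add, smul_neg, Finset.smul_sum]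

theorem evM_nl_inl (hZ : IsWaveJet T Z) (ν : Fin 4) {p : Spacetime} (hp : p.1 ∈ Ioo (-T) T) :
    evM (nl Z (.inl ν)) p = rhsA (fun μ => evM (Z none (.inl μ))) ν p := by
  simp only [nl, Sum.elim_inl, nlA, rhsA, evM_sum, evM_smul, evM_sub, evM_add, evM_brM,
    hZ.pd_evM _ _ hp]

theorem evM_nl_inr (hZ : IsWaveJet T Z) (μ ν : Fin 4) {p : Spacetime}
    (hp : p.1 ∈ Ioo (-T) T) :
    evM (nl Z (.inr (μ, ν))) p = rhsF (fun μ => evM (Z none (.inl μ)))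
      (fun μ ν => evM (Z none (.inr (μ, ν)))) μ ν p := by
  simp only [nl, Sum.elim_inr, nlF, rhsF, evM_sum, evM_smul, evM_sub, evM_add, evM_brM,
    hZ.pd_evM _ _ hp]

end IsWaveJet

end WaveJets

/-! ### Time slices in Sobolev spaces -/

noncomputable section SobolevSlices

open FourierTransform

theorem jap_le_pow {σ : ℝ} {k : ℕ} (hk : σ ≤ k) (ξ : Space) : jap σ ξ ≤ (1 + ‖ξ‖) ^ k := by
  have h1 : (1 : ℝ) ≤ 1 + ‖ξ‖ ^ 2 := by nlinarith [sq_nonneg ‖ξ‖]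
  have h0 := norm_nonneg ξ
  calc jap σ ξ ≤ (1 + ‖ξ‖ ^ 2) ^ ((k : ℝ) / 2) :=
        Real.rpow_le_rpow_of_exponent_le h1 (by linarith)
    _ ≤ ((1 + ‖ξ‖) ^ 2) ^ ((k : ℝ) / 2) :=
        Real.rpow_le_rpow (by positivity) (by nlinarith) (by positivity)
    _ = (1 + ‖ξ‖) ^ k := by
        rw [← Real.rpow_natCast (1 + ‖ξ‖) 2, ← Real.rpow_mul (by positivity),
          ← Real.rpow_natCast (1 + ‖ξ‖) k]
        congr 1
        push_cast
        ring

/-- The exponential absorbs any power of the frequency, so one element of `Alg` has slices in H^σ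
for every σ at once. -/
theorem exists_jap_mul_wt_le (σ : ℝ) : ∃ C, 0 ≤ C ∧ ∀ ξ, jap σ ξ * wt ξ ≤ C * polyWt ξ := by
  obtain ⟨k, hk⟩ := exists_nat_ge σ
  refine ⟨k.factorial * Real.exp 1, by positivity, fun ξ => ?_⟩
  have h1 : (1 + ‖ξ‖) ^ k ≤ k.factorial * (Real.exp 1 * Real.exp ‖ξ‖) := by
    have := Real.pow_div_factorial_le_exp (x := 1 + ‖ξ‖) (by positivity) k
    rw [div_le_iff₀ (by positivity), Real.exp_add] at this
    linarith
  have h2 : Real.exp ‖ξ‖ * Real.exp (-‖ξ‖) = 1 := by rw [← Real.exp_add]; simp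
  calc jap σ ξ * wt ξ ≤ (k.factorial * (Real.exp 1 * Real.exp ‖ξ‖)) * wt ξ := by
        gcongr
        · exact (wt_pos ξ).le
        · exact (jap_le_pow hk ξ).trans h1
    _ = k.factorial * Real.exp 1 * polyWt ξ * (Real.exp ‖ξ‖ * Real.exp (-‖ξ‖)) := by
        rw [wt]; ring
    _ = _ := by rw [h2, mul_one]

theorem memLp_polyWt : MemLp polyWt 2 := by
  rw [memLp_two_iff_integrable_sq continuous_polyWt.aestronglyMeasurable]
  refine integrable_polyWt.mono' (continuous_polyWt.pow 2).aestronglyMeasurable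
    (Filter.Eventually.of_forall fun ξ => ?_)
  have h1 := polyWt_le_one ξ
  have h2 := polyWt_pos ξ
  rw [Real.norm_of_nonneg (by positivity)]
  nlinarith

/-- The constant in the bound of a Sobolev norm by the norm of `Alg`. -/
def japConst (σ : ℝ) : ℝ := (exists_jap_mul_wt_le σ).choose

theorem norm_jap_mul_dens_le (σ : ℝ) (b : Alg) (t : ℝ) (ξ : Space) :
    ‖(jap σ ξ : ℂ) * dens b t ξ‖ ≤ japConst σ * ‖b‖ * polyWt ξ := by
  rw [norm_mul, Complex.norm_real, Real.norm_of_nonneg (jap_pos σ ξ).le]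
  calc jap σ ξ * ‖dens b t ξ‖ ≤ jap σ ξ * (‖b‖ * wt ξ) := by
        gcongr
        · exact (jap_pos σ ξ).le
        · exact norm_dens_le b t ξ
    _ = ‖b‖ * (jap σ ξ * wt ξ) := by ring
    _ ≤ ‖b‖ * (japConst σ * polyWt ξ) :=
        mul_le_mul_of_nonneg_left ((exists_jap_mul_wt_le σ).choose_spec.2 ξ) (norm_nonneg _)
    _ = _ := by ring

theorem memLp_jap_mul_dens (σ : ℝ) (b : Alg) (t : ℝ) :
    MemLp (fun ξ => (jap σ ξ : ℂ) * dens b t ξ) 2 :=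
  (memLp_polyWt.const_mul (japConst σ * ‖b‖)).mono'
    ((Complex.continuous_ofReal.comp (continuous_jap σ)).mul
      (continuous_dens_right b t)).aestronglyMeasurable
    (Filter.Eventually.of_forall fun ξ => norm_jap_mul_dens_le σ b t ξ)

theorem norm_toLp_sq {f : Space → ℂ} (hf : MemLp f 2) : ‖hf.toLp f‖ ^ 2 = ∫ ξ, ‖f ξ‖ ^ 2 := by
  rw [← @inner_self_eq_norm_sq ℂ, L2.inner_def]
  have e : ∫ ξ, inner ℂ ((hf.toLp f : Space → ℂ) ξ) ((hf.toLp f : Space → ℂ) ξ) =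
      ∫ ξ, ((‖f ξ‖ ^ 2 : ℝ) : ℂ) := by
    refine integral_congr_ae ?_
    filter_upwards [hf.coeFn_toLp] with ξ hξ
    rw [hξ, inner_self_eq_norm_sq_to_K]
    push_cast
    rfl
  rw [e, integral_complex_ofReal]
  exact Complex.ofReal_re _

/-- The time slice at time `t` as an element of `H^σ`, as a linear map. -/
def sobLin (σ t : ℝ) : Alg →ₗ[ℝ] SobolevH σ where
  toFun b := SobolevH.ofWeighted σ ((memLp_jap_mul_dens σ b t).toLp _)
  map_add' a b := by
    rw [← map_add, ← MemLp.toLp_add]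
    congr 1
    refine MemLp.toLp_congr _ _ (Filter.Eventually.of_forall fun ξ => ?_)
    simp [mul_add]
  map_smul' c b := by
    change _ = (c : ℂ) • SobolevH.ofWeighted σ _
    rw [← map_smul, ← MemLp.toLp_const_smul]
    congr 1
    refine MemLp.toLp_congr _ _ (Filter.Eventually.of_forall fun ξ => ?_)
    simp
    ring

theorem norm_sobLin_sq (σ t : ℝ) (b : Alg) :
    ‖sobLin σ t b‖ ^ 2 = ∫ ξ, jap σ ξ ^ 2 * ‖dens b t ξ‖ ^ 2 := by
  change ‖SobolevH.ofWeighted σ ((memLp_jap_mul_dens σ b t).toLp _)‖ ^ 2 = _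
  rw [SobolevH.norm_ofWeighted, norm_toLp_sq]
  congr 1
  ext ξ
  rw [norm_mul, Complex.norm_real, Real.norm_of_nonneg (jap_pos σ ξ).le, mul_pow]

/-- The time slice at time `t` as an element of `H^σ`. -/
def sob (σ t : ℝ) : Alg →L[ℝ] SobolevH σ :=
  LinearMap.mkContinuous (sobLin σ t)
    (japConst σ * ‖memLp_polyWt.toLp polyWt‖) fun b => by
      change ‖SobolevH.ofWeighted σ ((memLp_jap_mul_dens σ b t).toLp _)‖ ≤ _
      rw [SobolevH.norm_ofWeighted]
      have := Lp.norm_le_mul_norm_of_ae_le_mul (c := japConst σ * ‖b‖)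
        (f := (memLp_jap_mul_dens σ b t).toLp _) (g := memLp_polyWt.toLp polyWt) (by
          filter_upwards [(memLp_jap_mul_dens σ b t).coeFn_toLp, memLp_polyWt.coeFn_toLp]
            with ξ h1 h2
          rw [h1, h2, Real.norm_of_nonneg (polyWt_pos ξ).le]
          exact norm_jap_mul_dens_le σ b t ξ)
      linarith

theorem norm_sob_sq (σ t : ℝ) (b : Alg) :
    ‖sob σ t b‖ ^ 2 = ∫ ξ, jap σ ξ ^ 2 * ‖dens b t ξ‖ ^ 2 := norm_sobLin_sq σ t b

theorem jap_zero (ξ : Space) : jap 0 ξ = 1 := by simp [jap]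

theorem represents_sob (σ t : ℝ) (b : Alg) : Represents (fun x => ev b (t, x)) (sob σ t b) :=
  represents_ofWeighted σ (integrable_dens b t)
    (by simpa [jap_zero] using memLp_jap_mul_dens 0 b t) (memLp_jap_mul_dens σ b t)

theorem norm_sob_sub_sq (σ t t₀ : ℝ) (b : Alg) :
    ‖sob σ t b - sob σ t₀ b‖ ^ 2 = ∫ ξ, ‖(jap σ ξ : ℂ) * dens b t ξ - jap σ ξ * dens b t₀ ξ‖ ^ 2 := by
  change ‖SobolevH.ofWeighted σ ((memLp_jap_mul_dens σ b t).toLp _) -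
    SobolevH.ofWeighted σ ((memLp_jap_mul_dens σ b t₀).toLp _)‖ ^ 2 = _
  rw [← map_sub, SobolevH.norm_ofWeighted, ← MemLp.toLp_sub, norm_toLp_sq]
  rfl

/-- Dominated convergence for the squared H^σ distance to a fixed slice; the majorant is a multiple
of `polyWt`² that does not depend on t. -/
theorem continuous_sob (σ : ℝ) (b : Alg) : Continuous fun t => sob σ t b := by
  rw [continuous_iff_continuousAt]
  intro t₀
  have hj := continuous_jap σ
  have hc : Continuous fun t => ‖sob σ t b - sob σ t₀ b‖ ^ 2 := by
    simp only [norm_sob_sub_sq]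
    refine continuous_of_dominated
      (bound := fun ξ => (2 * (japConst σ * ‖b‖)) ^ 2 * polyWt ξ ^ 2) ?_ ?_ ?_ ?_
    · intro t
      have h1 := continuous_dens_right b t
      have h2 := continuous_dens_right b t₀
      exact Continuous.aestronglyMeasurable (by fun_prop)
    · refine fun t => Filter.Eventually.of_forall fun ξ => ?_
      rw [norm_pow, norm_norm, ← mul_pow]
      gcongr
      refine (norm_sub_le _ _).trans ?_
      linarith [norm_jap_mul_dens_le σ b t ξ, norm_jap_mul_dens_le σ b t₀ ξ]
    · exact ((memLp_two_iff_integrable_sq continuous_polyWt.aestronglyMeasurable).1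
        memLp_polyWt).const_mul _
    · refine Filter.Eventually.of_forall fun ξ => ?_
      have h1 : Continuous fun t => dens b t ξ :=
        continuous_dens_comp b continuous_id continuous_const
      fun_prop
  rw [ContinuousAt, tendsto_iff_norm_sub_tendsto_zero]
  have h := (hc.tendsto t₀).sqrt
  simpa [Real.sqrt_sq] using h

end SobolevSlices

/-! ### Divergence-free data and the solutions they launch -/

noncomputable section GaussData

variable {n : ℕ} {T : ℝ}

theorem ev_congr {a b : Alg} {t : ℝ} (h : ∀ ξ, dens a t ξ = dens b t ξ) (x : Space) :
    ev a (t, x) = ev b (t, x) := by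
  have : dens a t = dens b t := funext h
  simp only [ev, this]

theorem sob_congr {a b : Alg} {t : ℝ} (h : ∀ ξ, dens a t ξ = dens b t ξ) (σ : ℝ) :
    sob σ t a = sob σ t b := by
  rw [← sub_eq_zero, ← map_sub, ← norm_eq_zero, ← sq_eq_zero_iff, norm_sob_sq]
  simp [h]

theorem evM_congr {X Y : MatAlg n} {t : ℝ} (h : ∀ i j ξ, dens (X i j) t ξ = dens (Y i j) t ξ)
    (x : Space) : evM X (t, x) = evM Y (t, x) := by
  ext i j
  exact ev_congr (h i j) x

theorem evM_eq_zero {X : MatAlg n} {t : ℝ} (h : ∀ i j ξ, dens (X i j) t ξ = 0)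
    (x : Space) : evM X (t, x) = 0 := by
  ext i j
  rw [evM_apply, ev_congr (b := 0) (by simpa using h i j), ev_zero]
  rfl

theorem zero_bracket (X : Matrix (Fin n) (Fin n) ℂ) :
    ⁅(0 : Matrix (Fin n) (Fin n) ℂ), X⁆ = 0 := by simp [Ring.lie_def]

theorem bracket_zero (X : Matrix (Fin n) (Fin n) ℂ) :
    ⁅X, (0 : Matrix (Fin n) (Fin n) ℂ)⁆ = 0 := by simp [Ring.lie_def]

/-- The spatial Fourier transforms `g i a b` of the entries of three `su(n)`-valued functions with
vanishing divergence. -/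
structure IsGaussData (g : Fin 3 → Fin n → Fin n → Space → ℂ) : Prop where
  test : ∀ i a b, IsTestFreq (g i a b)
  skew : ∀ i a b ξ, (starRingEnd ℂ) (g i b a (-ξ)) = -g i a b ξ
  trace : ∀ i ξ, ∑ a, g i a a ξ = 0
  div : ∀ a b ξ, ∑ i, freqMul i ξ * g i a b ξ = 0

/-- The extension of `g` by zero to a one-form. -/
def spatialForm (g : Fin 3 → Fin n → Fin n → Space → ℂ) (μ : Fin 4) (a b : Fin n) (ξ : Space) : ℂ :=
  Fin.cases 0 (fun i => g i a b ξ) μ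

/-- The symbols of the spatial derivatives, with zero in place of the time derivative. -/
def spatialFreq (μ : Fin 4) (ξ : Space) : ℂ := Fin.cases 0 (fun i => freqMul i ξ) μ

/-- The initial values `(a, f)` of the fields: `f_{0i} = g_i`, and all else vanishes. -/
def initPos (g : Fin 3 → Fin n → Fin n → Space → ℂ) : FieldIdx → Fin n → Fin n → Space → ℂ :=
  Sum.elim (fun _ _ _ _ => 0) fun q a b ξ =>
    (if q.1 = 0 then 1 else 0) * spatialForm g q.2 a b ξ -
      (if q.2 = 0 then 1 else 0) * spatialForm g q.1 a b ξ

/-- The initial time derivatives of the fields belonging to `initPos g`. -/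
def initVel (g : Fin 3 → Fin n → Fin n → Space → ℂ) : FieldIdx → Fin n → Fin n → Space → ℂ :=
  Sum.elim (fun μ a b ξ => spatialForm g μ a b ξ) fun q a b ξ =>
    spatialFreq q.1 ξ * spatialForm g q.2 a b ξ - spatialFreq q.2 ξ * spatialForm g q.1 a b ξ

variable {g : Fin 3 → Fin n → Fin n → Space → ℂ}

theorem continuous_spatialFreq (μ : Fin 4) : Continuous (spatialFreq μ) := by
  refine Fin.cases ?_ (fun i => ?_) μ
  · exact continuous_const
  · exact (polyGrowth_freqMul i).cont

theorem conj_spatialFreq_neg (μ : Fin 4) (ξ : Space) :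
    (starRingEnd ℂ) (spatialFreq μ (-ξ)) = spatialFreq μ ξ := by
  refine Fin.cases ?_ (fun i => ?_) μ
  · simp [spatialFreq]
  · exact conj_freqMul_neg i ξ

namespace IsGaussData

theorem isTestFreq_form (hg : IsGaussData g) (μ : Fin 4) (a b : Fin n) :
    IsTestFreq (spatialForm g μ a b) := by
  refine Fin.cases ?_ (fun i => ?_) μ
  · exact IsTestFreq.zero
  · exact hg.test i a b

theorem skew_form (hg : IsGaussData g) (μ : Fin 4) (a b : Fin n) (ξ : Space) :
    (starRingEnd ℂ) (spatialForm g μ b a (-ξ)) = -spatialForm g μ a b ξ := by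
  refine Fin.cases ?_ (fun i => ?_) μ
  · simp [spatialForm]
  · exact hg.skew i a b ξ

theorem trace_form (hg : IsGaussData g) (μ : Fin 4) (ξ : Space) :
    ∑ a, spatialForm g μ a a ξ = 0 := by
  refine Fin.cases ?_ (fun i => ?_) μ
  · simp [spatialForm]
  · exact hg.trace i ξ

theorem isTestFreq_pos (hg : IsGaussData g) (k : FieldIdx) (a b : Fin n) :
    IsTestFreq (initPos g k a b) := by
  rcases k with μ | q
  · exact IsTestFreq.zero
  · exact ((hg.isTestFreq_form q.2 a b).mul continuous_const).sub
      ((hg.isTestFreq_form q.1 a b).mul continuous_const)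

theorem isTestFreq_vel (hg : IsGaussData g) (k : FieldIdx) (a b : Fin n) :
    IsTestFreq (initVel g k a b) := by
  rcases k with μ | q
  · exact hg.isTestFreq_form μ a b
  · exact ((hg.isTestFreq_form q.2 a b).mul (continuous_spatialFreq _)).sub
      ((hg.isTestFreq_form q.1 a b).mul (continuous_spatialFreq _))

theorem skew_pos (hg : IsGaussData g) (k : FieldIdx) (a b : Fin n) (ξ : Space) :
    (starRingEnd ℂ) (initPos g k b a (-ξ)) = -initPos g k a b ξ := by
  rcases k with μ | q
  · simp [initPos]
  · simp only [initPos, Sum.elim_inr, map_sub, map_mul, hg.skew_form, apply_ite (starRingEnd ℂ),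
      map_one, map_zero]
    ring

theorem skew_vel (hg : IsGaussData g) (k : FieldIdx) (a b : Fin n) (ξ : Space) :
    (starRingEnd ℂ) (initVel g k b a (-ξ)) = -initVel g k a b ξ := by
  rcases k with μ | q
  · exact hg.skew_form μ a b ξ
  · simp only [initVel, Sum.elim_inr, map_sub, map_mul, hg.skew_form, conj_spatialFreq_neg]
    ring

theorem trace_pos (hg : IsGaussData g) (k : FieldIdx) (ξ : Space) :
    ∑ a, initPos g k a a ξ = 0 := by
  rcases k with μ | q
  · simp [initPos]
  · simp only [initPos, Sum.elim_inr, Finset.sum_sub_distrib, ← Finset.mul_sum, hg.trace_form]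
    simp

theorem trace_vel (hg : IsGaussData g) (k : FieldIdx) (ξ : Space) :
    ∑ a, initVel g k a a ξ = 0 := by
  rcases k with μ | q
  · exact hg.trace_form μ ξ
  · simp only [initVel, Sum.elim_inr, Finset.sum_sub_distrib, ← Finset.mul_sum, hg.trace_form]
    simp

/-- The free waves with the Cauchy data given by `g`. -/
def freeJet (hg : IsGaussData g) (hT : 0 ≤ T) : JetSp n :=
  fun o k a b => freeAlg hT (hg.isTestFreq_pos k a b) (hg.isTestFreq_vel k a b) o

theorem freeDens_add_eq_zero {p q p' q' : Space → ℂ} {t : ℝ} {ξ : Space} (hp : p ξ = -p' ξ)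
    (hq : q ξ = -q' ξ) (o : Option (Fin 4)) : freeDens p q o t ξ = -freeDens p' q' o t ξ := by
  rcases o with _ | μ
  · simp only [freeDens_none, hp, hq]; ring
  · refine Fin.cases ?_ (fun j => ?_) μ
    · simp only [freeDens_zero, hp, hq]; ring
    · simp only [freeDens_succ, freeDens_none, hp, hq]; ring

theorem isSymField_freeJet (hg : IsGaussData g) (hT : 0 ≤ T) (o : Option (Fin 4)) :
    IsSymField (hg.freeJet hT o) where
  skew k i j := invol_freeAlg hT _ _ _ _ (hg.skew_pos k i j) (hg.skew_vel k i j) o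
  antisymm μ ν := by
    ext1 a; ext1 b
    refine dens_ext fun t ξ => ?_
    simp only [Pi.neg_apply, dens_neg, freeJet, dens_freeAlg]
    refine freeDens_add_eq_zero ?_ ?_ o <;> simp only [initPos, initVel, Sum.elim_inr] <;> ring

theorem trace_freeJet (hg : IsGaussData g) (hT : 0 ≤ T) (k : FieldIdx) :
    ∑ a, hg.freeJet hT none k a a = 0 := by
  refine dens_ext fun t ξ => ?_
  simp only [dens_sum, freeJet, dens_freeAlg, freeDens_none, Finset.sum_add_distrib,
    ← Finset.mul_sum, hg.trace_pos, hg.trace_vel]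
  simp

end IsGaussData

/-- The trace on the Fourier side. -/
def trM : MatAlg n →ₗ[ℝ] Alg where
  toFun X := ∑ a, X a a
  map_add' X Y := by simp [Finset.sum_add_distrib]
  map_smul' c X := by simp [Finset.smul_sum]

theorem trM_brM (X Y : MatAlg n) : trM (brM X Y) = 0 := trace_brM X Y

theorem trM_nl (Z : JetSp n) (k : FieldIdx) : trM (nl Z k) = 0 := by
  rcases k with ν | q
  · simp only [nl, Sum.elim_inl, nlA, map_sum, map_smul, map_sub, map_add, trM_brM]
    simp
  · simp only [nl, Sum.elim_inr, nlF, map_sum, map_smul, map_sub, map_add, trM_brM]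
    simp

/-- `Z` solves the Yang-Mills system on the Fourier side, with Cauchy data `ε g`. -/
structure IsJetSolution {T : ℝ} (hT : 0 < T) (hg : IsGaussData g) (ε : ℝ) (Z : JetSp n) :
    Prop where
  eq : Z = ε • hg.freeJet hT.le - duhJet hT.le (nl Z)
  sym : ∀ o, IsSymField (Z o)

namespace IsJetSolution

variable {hg : IsGaussData g} {ε : ℝ} {Z : JetSp n}

theorem dens_eq {hT : 0 < T} (h : IsJetSolution hT hg ε Z) (o : Option (Fin 4)) (k : FieldIdx)
    (a b : Fin n) (t : ℝ) (ξ : Space) : dens (Z o k a b) t ξ =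
      ε * dens (freeAlg hT.le (hg.isTestFreq_pos k a b) (hg.isTestFreq_vel k a b) o) t ξ -
        dens (duhL hT.le (isMultiplier_jetMul o) (nl Z k a b)) t ξ := by
  have e : Z o k a b = ε • hg.freeJet hT.le o k a b - duhJet hT.le (nl Z) o k a b :=
    congrFun (congrFun (congrFun (congrFun h.eq o) k) a) b
  rw [e, dens_sub, dens_smul]
  rfl

/-- The free part solves the homogeneous equation and the Duhamel part supplies the source. It
enters with a minus sign because □ = -∂_t² + Δ. -/
theorem isWaveJet {hT : 0 < T} (h : IsJetSolution hT hg ε Z) : IsWaveJet T Z where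
  time k a b t ht ξ := by
    simp only [h.dens_eq]
    exact ((hasDerivAt_dens_free hT.le _ _ ht ξ).1.const_mul _).sub
      (hasDerivAt_dens_duh hT.le _ ht ξ).1
  wave k a b t ht ξ := by
    have e : (fun τ => dens (Z (some 0) k a b) τ ξ) = _ := funext fun τ => h.dens_eq _ k a b τ ξ
    rw [e, h.dens_eq none]
    refine (((hasDerivAt_dens_free hT.le _ _ ht ξ).2.const_mul _).sub
      (hasDerivAt_dens_duh hT.le _ ht ξ).2).congr_deriv ?_
    ring
  space l k a b t ξ := by
    rw [h.dens_eq, h.dens_eq, dens_free_space, dens_duh_space]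
    ring

theorem dens_duh_zero (hT : 0 < T) (o : Option (Fin 4)) (G : Alg) (ξ : Space) :
    dens (duhL hT.le (isMultiplier_jetMul o) G) 0 ξ = 0 := by
  rw [dens_duhL, clampTime_of_mem ⟨by linarith, hT.le⟩, intervalIntegral.integral_same]

theorem dens_none_zero {hT : 0 < T} (h : IsJetSolution hT hg ε Z) (k : FieldIdx)
    (a b : Fin n) (ξ : Space) : dens (Z none k a b) 0 ξ = ε * initPos g k a b ξ := by
  rw [h.dens_eq, dens_duh_zero hT, dens_freeAlg, clampTime_of_mem ⟨by linarith, hT.le⟩, freeDens_none]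
  simp [mulCos, mulSin]

theorem dens_time_zero {hT : 0 < T} (h : IsJetSolution hT hg ε Z) (k : FieldIdx)
    (a b : Fin n) (ξ : Space) : dens (Z (some 0) k a b) 0 ξ = ε * initVel g k a b ξ := by
  rw [h.dens_eq, dens_duh_zero hT, dens_freeAlg, clampTime_of_mem ⟨by linarith, hT.le⟩, freeDens_zero]
  simp [mulCos, mulSin]

theorem dens_space_zero {hT : 0 < T} (h : IsJetSolution hT hg ε Z) (l : Fin 3) (k : FieldIdx)
    (a b : Fin n) (ξ : Space) :
    dens (Z (some l.succ) k a b) 0 ξ = freqMul l ξ * (ε * initPos g k a b ξ) := by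
  rw [h.isWaveJet.space, h.dens_none_zero]

theorem dens_A_zero {hT : 0 < T} (h : IsJetSolution hT hg ε Z) (μ ν : Fin 4)
    (a b : Fin n) (ξ : Space) : dens (Z (some μ) (.inl ν) a b) 0 ξ =
      ε * ((if μ = 0 then 1 else 0) * spatialForm g ν a b ξ) := by
  refine Fin.cases ?_ (fun l => ?_) μ
  · simp [h.dens_time_zero, initVel]
  · simp [h.dens_space_zero, initPos]

/-- The nonlinearity consists of commutators and is trace-free; the Duhamel operator acts entrywise
and commutes with the trace. -/
theorem trM_none {hT : 0 < T} (h : IsJetSolution hT hg ε Z) (k : FieldIdx) :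
    trM (Z none k) = 0 := by
  have e : Z none k = ε • hg.freeJet hT.le none k - duhJet hT.le (nl Z) none k :=
    congrFun (congrFun h.eq none) k
  have h1 : trM (hg.freeJet hT.le none k) = 0 := hg.trace_freeJet hT.le k
  have h2 : trM (duhJet hT.le (nl Z) none k) = 0 := by
    have : trM (duhJet hT.le (nl Z) none k) =
        duhL hT.le (isMultiplier_jetMul none) (trM (nl Z k)) := by
      change ∑ a, duhJet hT.le (nl Z) none k a a = duhL hT.le _ (∑ a, nl Z k a a)
      rw [map_sum]
      rfl
    rw [this, trM_nl, map_zero]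
  rw [e, map_sub, map_smul, h1, h2]
  simp

theorem isSu {hT : 0 < T} (h : IsJetSolution hT hg ε Z) (k : FieldIdx) (p : Spacetime) :
    IsSu (evM (Z none k) p) := by
  constructor
  · ext i j
    have := congrArg (fun b => ev b p) ((h.sym none).skew k i j)
    simp only [ev_invol, ev_neg] at this
    exact this
  · have := congrArg (fun b => ev b p) (h.trM_none k)
    simp only [trM, LinearMap.coe_mk, AddHom.coe_mk, ev_sum, ev_zero] at this
    exact this

theorem isSmoothField {hT : 0 < T} (h : IsJetSolution hT hg ε Z) (k : FieldIdx) :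
    IsSmoothField T (evM (Z none k)) where
  su t _ x := h.isSu k (t, x)
  smooth i j := h.isWaveJet.contDiffOn_ev none k i j
  sobolev σ i j := ⟨⟨fun t => sob σ t (Z none k i j),
    (continuous_sob σ _).comp continuous_subtype_val⟩, fun t => represents_sob σ t _⟩

theorem isSmoothSolution {hT : 0 < T} (h : IsJetSolution hT hg ε Z) :
    IsSmoothSolution T (fun μ => evM (Z none (.inl μ)))
      (fun μ ν => evM (Z none (.inr (μ, ν)))) where
  fieldA μ := h.isSmoothField _
  fieldF μ ν := h.isSmoothField _
  antisymm μ ν t _ x := by rw [(h.sym none).antisymm μ ν, evM_neg]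
  waveA ν t ht x := by rw [h.isWaveJet.dAlembert_evM _ ht, h.isWaveJet.evM_nl_inl ν ht]
  waveF μ ν t ht x := by rw [h.isWaveJet.dAlembert_evM _ ht, h.isWaveJet.evM_nl_inr μ ν ht]

/-- The potential vanishes at time 0, so every commutator drops out and the conditions become linear
in g. `initVel` is chosen to satisfy them, and the Gauss law is the vanishing divergence of g. -/
theorem compatibleData {hT : 0 < T} (h : IsJetSolution hT hg ε Z) :
    CompatibleData (fun μ => evM (Z none (.inl μ))) (fun μ ν => evM (Z none (.inr (μ, ν)))) := by
  have ht : ∀ x : Space, ((0 : ℝ), x).1 ∈ Ioo (-T) T := fun x => ⟨by simpa using hT, hT⟩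
  have hw := h.isWaveJet
  have hA : ∀ μ x, evM (Z none (.inl μ)) (0, x) = 0 := fun μ x =>
    evM_eq_zero (fun a b ξ => by rw [h.dens_none_zero]; simp [initPos]) x
  constructor
  · intro μ ν x
    rw [hw.pd_evM _ _ (ht x), hw.pd_evM _ _ (ht x), hA, zero_bracket, add_zero, ← evM_sub]
    refine evM_congr (fun a b ξ => ?_) x
    simp only [Pi.sub_apply, dens_sub, h.dens_A_zero, h.dens_none_zero, initPos, Sum.elim_inr]
    ring
  · intro i j x
    simp only [hA, bracket_zero, zero_bracket, add_zero]
    rw [hw.pd_evM _ _ (ht x)]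
    ext a b
    rw [Matrix.sub_apply, hw.pd_pd_evM _ _ _ (ht x), hw.pd_pd_evM _ _ _ (ht x),
      hw.pd_evM_time _ _ (ht x), hw.pd_evM_time _ _ (ht x), evM_apply, ev_eq_synth]
    simp only [synth]
    have hi : ∀ (l : Fin 3) (k : FieldIdx), Integrable fun ξ => Real.fourierChar (inner ℝ ξ x) •
        (freqMul l ξ * dens (Z (some 0) k a b) 0 ξ) := fun l k =>
      integrable_char_smul (((rapidOn_dens (Ioo (-T) T) _).mul_poly
        (polyGrowth_freqMul l)).integrable (ht x)) x
    rw [← integral_sub (hi _ _) (hi _ _)]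
    refine integral_congr_ae (Filter.Eventually.of_forall fun ξ => ?_)
    beta_reduce
    rw [← smul_sub]
    congr 1
    simp only [h.dens_time_zero, initVel, Sum.elim_inr, Sum.elim_inl, spatialFreq, Fin.cases_succ]
    ring
  · intro i x
    simp only [hA, zero_bracket, smul_zero, Finset.sum_const_zero, add_zero]
    rw [hw.pd_evM _ _ (ht x), evM_eq_zero, Finset.sum_eq_zero]
    · intro j _
      rw [hw.pd_evM _ _ (ht x), evM_eq_zero]
      intro a b ξ
      simp [h.dens_space_zero, initPos, Fin.succ_ne_zero]
    · intro a b ξ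
      simp [h.dens_time_zero, initVel, spatialFreq, spatialForm]
  · intro x
    rw [hw.pd_evM _ _ (ht x), evM_eq_zero, Finset.sum_eq_zero]
    · intro j _
      rw [hw.pd_evM _ _ (ht x), evM_eq_zero]
      intro a b ξ
      simp [h.dens_A_zero, Fin.succ_ne_zero]
    · intro a b ξ
      simp [h.dens_A_zero, spatialForm]
  · intro x
    simp only [hA, zero_bracket, Finset.sum_const_zero, add_zero, hw.pd_evM _ _ (ht x), ← evM_sum]
    refine evM_eq_zero (fun a b ξ => ?_) x
    have := hg.div a b ξ
    simp only [Finset.sum_apply, dens_sum, h.dens_space_zero, initPos, Sum.elim_inr,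
      Fin.succ_ne_zero, spatialForm, Fin.cases_succ, if_true, if_false, one_mul, zero_mul, sub_zero]
    rw [← mul_zero (ε : ℂ), ← this, Finset.mul_sum]
    exact Finset.sum_congr rfl fun i _ => by ring

end IsJetSolution

/-- The time slice of the fields at time `t`. -/
def slice (s r t : ℝ) (X : FieldSpace n) : DataSpace n s r :=
  (fun μ i j => sob s t (X (.inl μ) i j), fun μ ν i j => sob r t (X (.inr (μ, ν)) i j))

theorem continuous_slice (s r : ℝ) (X : FieldSpace n) : Continuous fun t => slice s r t X := by
  have := fun σ b => continuous_sob σ b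
  unfold slice
  fun_prop

/-- The curve of the time slices of the fields. -/
def trajectory (s r T : ℝ) (X : FieldSpace n) : C(Icc (-T) T, DataSpace n s r) :=
  ⟨fun t => slice s r t X, (continuous_slice s r X).comp continuous_subtype_val⟩

theorem IsJetSolution.isSmoothTrajectory {hT : 0 < T} {hg : IsGaussData g} {ε : ℝ} {Z : JetSp n}
    (h : IsJetSolution hT hg ε Z) (s r : ℝ) :
    IsSmoothTrajectory n s r T (trajectory s r T (Z none)) :=
  ⟨_, _, h.isSmoothSolution, h.compatibleData, fun t =>
    ⟨fun _ _ _ => represents_sob s t _, fun _ _ _ _ => represents_sob r t _⟩⟩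

/-- The initial data given by `g`. -/
def IsGaussData.initial (hg : IsGaussData g) (hT : 0 < T) (s r : ℝ) : DataSpace n s r :=
  slice s r 0 (hg.freeJet hT.le none)

theorem IsJetSolution.trajectory_zero {hT : 0 < T} {hg : IsGaussData g} {ε : ℝ} {Z : JetSp n}
    (h : IsJetSolution hT hg ε Z) (s r : ℝ) :
    trajectory s r T (Z none) (timeZero hT) = ε • hg.initial hT s r := by
  have key : ∀ σ k a b, sob σ 0 (Z none k a b) = ε • sob σ 0 (hg.freeJet hT.le none k a b) := by
    intro σ k a b
    rw [← map_smul]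
    refine sob_congr (fun ξ => ?_) σ
    rw [h.dens_none_zero, dens_smul, IsGaussData.freeJet, dens_freeAlg,
      clampTime_of_mem ⟨by linarith, hT.le⟩, freeDens_none]
    simp [mulCos, mulSin]
  refine Prod.ext ?_ ?_
  · ext1 μ; ext1 i; ext1 j
    exact key s _ i j
  · ext1 μ; ext1 ν; ext1 i; ext1 j
    exact key r _ i j

/-- For small `ε` there is a solution with Cauchy data `ε g`, and it is `ε` times the free solution
to first order. -/
theorem exists_isJetSolution (hT : 0 < T) (hg : IsGaussData g) :
    ∃ Z : ℝ → JetSp n, Z 0 = 0 ∧ HasDerivAt Z (hg.freeJet hT.le) 0 ∧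
      ∀ᶠ ε in nhds (0 : ℝ), IsJetSolution hT hg ε (Z ε) := by
  obtain ⟨Z, h0, h1, h2⟩ := exists_jet_solution hT.le (hg.isSymField_freeJet hT.le)
  exact ⟨Z, h0, h1, h2.mono fun ε h => ⟨h.1, h.2⟩⟩

end GaussData

/-! ### The second variation of a flow map -/

noncomputable section SecondVariation

open Filter Topology

/-- The second variation along rays of a `C²` map is bounded by a multiple of the squared norm. -/
theorem ContDiffWithinAt.exists_second_variation_bound {X Y : Type*} [NormedAddCommGroup X]
    [NormedSpace ℝ X] [NormedAddCommGroup Y] [NormedSpace ℝ Y] {Φ : X → Y} {S : Set X}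
    (h : ContDiffWithinAt ℝ 2 Φ S 0) (h0 : Φ 0 = 0) :
    ∃ C, 0 ≤ C ∧ ∀ x : X, (∀ᶠ ε in 𝓝 (0 : ℝ), ε • x ∈ S) →
      ∀ (W : Type) [NormedAddCommGroup W] [NormedSpace ℝ W] (l : Y →L[ℝ] W), ‖l‖ ≤ 1 →
      ∀ m : W, Tendsto (fun ε : ℝ => (ε ^ 2)⁻¹ • l (Φ (ε • x))) (𝓝[≠] 0) (𝓝 m) →
      ‖m‖ ≤ C * ‖x‖ ^ 2 := by
  obtain ⟨u, hu, p, hp⟩ := contDiffWithinAt_nat.1 (show ContDiffWithinAt ℝ (2 : ℕ) Φ S 0 by exact_mod_cast h)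
  refine ⟨‖p 0 2‖, norm_nonneg _, fun x hx W _ _ l hl m hm => ?_⟩
  set L := ContinuousLinearMap.toSpanSingleton ℝ x with hL
  -- The Taylor series is only given on a relative neighbourhood. Since εx stays in S for small ε,
  -- its preimage under the line ε ↦ εx is a full neighbourhood of 0 in ℝ.
  have hLu : L ⁻¹' u ∈ 𝓝 (0 : ℝ) := by
    have ht : Tendsto L (𝓝 0) (𝓝[insert 0 S] 0) := by
      refine tendsto_nhdsWithin_iff.2 ⟨?_, ?_⟩
      · simpa using L.continuous.tendsto 0
      · filter_upwards [hx] with ε hε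
        exact Or.inr (by simpa [hL] using hε)
    exact ht hu
  obtain ⟨δ, hδ, hδu⟩ := Metric.mem_nhds_iff.1 hLu
  set I := Metric.ball (0 : ℝ) δ
  have hf := ((hp.compContinuousLinearMap L).continuousLinearMap_comp l).mono hδu
  set f : ℝ → W := l ∘ Φ ∘ L with hfdef
  have hI : Convex ℝ I := convex_ball _ _
  have hI0 : (0 : ℝ) ∈ I := Metric.mem_ball_self hδ
  have hID : UniqueDiffOn ℝ I := Metric.isOpen_ball.uniqueDiffOn
  have hIn : 𝓝[I] (0 : ℝ) = 𝓝 0 := Metric.isOpen_ball.nhdsWithin_eq hI0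
  have hD : iteratedDerivWithin 2 f I 0 = l (p 0 2 fun _ => x) := by
    rw [iteratedDerivWithin, ← hf.eq_iteratedFDerivWithin_of_uniqueDiffOn le_rfl hID hI0]
    simp [hL]
  have hT := taylor_tendsto hI hI0 (n := 2) (by exact_mod_cast hf.contDiffOn)
  rw [hIn] at hT
  have hf0 : f 0 = 0 := by simp [hfdef, h0]
  -- Adding the values at ε and -ε removes the linear Taylor term. After division by ε² this leaves
  -- the second derivative on one side and 2m on the other.
  have hneg : Tendsto (fun ε : ℝ => -ε) (𝓝 0) (𝓝 0) := by
    simpa using (continuous_neg (G := ℝ)).tendsto 0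
  have hneg' : Tendsto (fun ε : ℝ => -ε) (𝓝[≠] 0) (𝓝[≠] 0) := by
    refine tendsto_nhdsWithin_iff.2 ⟨hneg.mono_left nhdsWithin_le_nhds, ?_⟩
    filter_upwards [self_mem_nhdsWithin] with ε hε
    simpa using hε
  have h1 := ((hT.add (hT.comp hneg)).mono_left (nhdsWithin_le_nhds (s := {0}ᶜ)))
  have h2 := hm.add (hm.comp hneg')
  have h3 := h2.sub h1
  have h4 : Tendsto (fun _ : ℝ => l (p 0 2 fun _ => x)) (𝓝[≠] 0) (𝓝 (m + m - (0 + 0))) := by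
    refine h3.congr' ?_
    filter_upwards [self_mem_nhdsWithin] with ε hε
    have hε : ε ≠ 0 := hε
    have e1 : ∀ ε : ℝ, l (Φ (ε • x)) = f ε := fun ε => by simp [hfdef, hL]
    have e2 : taylorWithinEval f 2 I 0 ε + taylorWithinEval f 2 I 0 (-ε) =
        ε ^ 2 • iteratedDerivWithin 2 f I 0 := by
      rw [taylorWithinEval_succ, taylorWithinEval_succ, taylorWithinEval_succ,
        taylorWithinEval_succ, taylor_within_zero_eval, taylor_within_zero_eval, hf0]
      norm_num
      module
    simp only [Function.comp_apply, e1, sub_zero, neg_sq]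
    rw [← hD, ← smul_add, ← smul_add, ← smul_sub]
    rw [show f ε + f (-ε) - (f ε - taylorWithinEval f 2 I 0 ε +
        (f (-ε) - taylorWithinEval f 2 I 0 (-ε))) =
        taylorWithinEval f 2 I 0 ε + taylorWithinEval f 2 I 0 (-ε) by abel, e2, smul_smul,
      inv_mul_cancel₀ (by positivity), one_smul]
  have h5 : l (p 0 2 fun _ => x) = m + m := by
    have := tendsto_nhds_unique tendsto_const_nhds h4
    simpa using this
  have h6 : ‖l (p 0 2 fun _ => x)‖ ≤ ‖p 0 2‖ * ‖x‖ ^ 2 := by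
    refine (l.le_opNorm _).trans ((mul_le_of_le_one_left (norm_nonneg _) hl).trans ?_)
    simpa using (p 0 2).le_opNorm fun _ => x
  rw [h5, ← two_smul ℝ, norm_smul] at h6
  norm_num at h6
  linarith [norm_nonneg m]

variable {n : ℕ} {T : ℝ} {g : Fin 3 → Fin n → Fin n → Space → ℂ}

theorem brM_smul (c d : ℝ) (X Y : MatAlg n) : brM (c • X) (d • Y) = (c * d) • brM X Y := by
  ext1 i; ext1 j
  simp only [brM, Pi.smul_apply, map_smul, smul_apply, Finset.smul_sum, smul_sub, smul_smul]
  simp only [mul_comm d c]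

theorem continuous_brM : Continuous fun q : MatAlg n × MatAlg n => brM q.1 q.2 := by
  have h : ∀ f f' : MatAlg n × MatAlg n → Alg, Continuous f → Continuous f' →
      Continuous fun q => convL (f q) (f' q) := fun f f' hf hf' =>
    (convL.continuous.comp hf).clm_apply hf'
  unfold brM
  refine continuous_pi fun i => continuous_pi fun j => continuous_finsetSum _ fun k _ => ?_
  exact (h _ _ (by fun_prop) (by fun_prop)).sub (h _ _ (by fun_prop) (by fun_prop))

/-- The quadratic part of the source of `A_ν`. -/
def quadA (Z : JetSp n) (ν : Fin 4) : MatAlg n :=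
  ∑ l, minkowski l •
    (-(2 : ℝ) • brM (Z none (.inl l)) (Z (some l) (.inl ν))
      + brM (Z none (.inl l)) (Z (some ν) (.inl l)))

/-- The cubic part of the source of `A_ν`. -/
def cubA (Z : JetSp n) (ν : Fin 4) : MatAlg n :=
  ∑ l, minkowski l • brM (Z none (.inl l)) (brM (Z none (.inl l)) (Z none (.inl ν)))

/-- Separates the degrees of homogeneity. With c = ε and Z replaced by ε⁻¹ Z(ε), division by ε²
leaves the quadratic part and a cubic part that tends to 0. -/
theorem nlA_smul (c : ℝ) (Z : JetSp n) (ν : Fin 4) :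
    nlA (c • Z) ν = c ^ 2 • (quadA Z ν - c • cubA Z ν) := by
  simp only [nlA, quadA, cubA, Pi.smul_apply, brM_smul, Finset.smul_sum, ← Finset.sum_sub_distrib]
  refine Finset.sum_congr rfl fun l _ => ?_
  module

theorem continuous_quadA (ν : Fin 4) : Continuous fun Z : JetSp n => quadA Z ν := by
  have h : ∀ (o o' : Option (Fin 4)) (k k' : FieldIdx),
      Continuous fun Z : JetSp n => brM (Z o k) (Z o' k') := fun o o' k k' =>
    continuous_brM.comp (f := fun Z : JetSp n => (Z o k, Z o' k')) (by fun_prop)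
  unfold quadA
  refine continuous_finsetSum _ fun l _ => ?_
  have h1 := h none (some l) (.inl l) (.inl ν)
  have h2 := h none (some ν) (.inl l) (.inl l)
  fun_prop

theorem continuous_cubA (ν : Fin 4) : Continuous fun Z : JetSp n => cubA Z ν := by
  have h : ∀ (o o' : Option (Fin 4)) (k k' : FieldIdx),
      Continuous fun Z : JetSp n => brM (Z o k) (Z o' k') := fun o o' k k' =>
    continuous_brM.comp (f := fun Z : JetSp n => (Z o k, Z o' k')) (by fun_prop)
  unfold cubA
  refine continuous_finsetSum _ fun l _ => ?_
  have h1 := continuous_brM.comp (f := fun Z : JetSp n =>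
    (Z none (.inl l), brM (Z none (.inl l)) (Z none (.inl ν))))
    ((by fun_prop : Continuous fun Z : JetSp n => Z none (.inl l)).prodMk (h _ _ _ _))
  have h2 : Continuous fun Z : JetSp n =>
    brM (Z none (.inl l)) (brM (Z none (.inl l)) (Z none (.inl ν))) := h1
  fun_prop

/-- The quadratic source of `A_0` produced by free waves with the data `g`. -/
def IsGaussData.source (hg : IsGaussData g) (hT : 0 ≤ T) : MatAlg n :=
  ∑ i : Fin 3, brM (hg.freeJet hT none (.inl i.succ)) (hg.freeJet hT (some 0) (.inl i.succ))

theorem IsGaussData.freeJet_inl_zero (hg : IsGaussData g) (hT : 0 ≤ T) (o : Option (Fin 4)) :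
    hg.freeJet hT o (.inl 0) = 0 := by
  ext1 a; ext1 b
  refine dens_ext fun t ξ => ?_
  have e : hg.freeJet hT o (.inl 0) a b = freeAlg hT (hg.isTestFreq_pos _ a b)
    (hg.isTestFreq_vel _ a b) o := rfl
  rw [e, dens_freeAlg]
  have hp : initPos g (.inl 0) a b = 0 := rfl
  have hq : initVel g (.inl 0) a b = 0 := rfl
  simp only [hp, hq, Pi.zero_apply, dens_zero]
  rcases o with _ | μ
  · simp [freeDens_none]
  · refine Fin.cases ?_ (fun j => ?_) μ
    · simp [freeDens_zero]
    · simp [freeDens_succ, freeDens_none]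

theorem brM_zero_right (X : MatAlg n) : brM X 0 = 0 := by
  simpa using brM_smul 1 (0 : ℝ) X X

/-- The free A_0 vanishes, so neither the terms [A^l, ∂_l A_0] nor the summand l = 0 contributes. -/
theorem IsGaussData.quadA_freeJet (hg : IsGaussData g) (hT : 0 ≤ T) :
    quadA (hg.freeJet hT) 0 = hg.source hT := by
  rw [quadA, Fin.sum_univ_succ, hg.freeJet_inl_zero]
  simp only [hg.freeJet_inl_zero, brM_zero_right, smul_zero, zero_add]
  exact Finset.sum_congr rfl fun i _ => by simp [minkowski, Fin.succ_ne_zero]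

/-- A flow map which is `C²` at the origin controls the second iterate of `A_0`. -/
theorem exists_source_bound {s r : ℝ} (hT : 0 < T) {U : Set (DataSpace n s r)}
    (hU : U ∈ 𝓝 (0 : DataSpace n s r)) {Φ : DataSpace n s r → C(Icc (-T) T, DataSpace n s r)}
    (hΦ : IsFlowMap n s r hT U Φ) (hC : ContDiffWithinAt ℝ 2 Φ (smoothData n s r hT) 0) :
    ∃ C, 0 ≤ C ∧ ∀ (g : Fin 3 → Fin n → Fin n → Space → ℂ) (hg : IsGaussData g),
      ∀ t ∈ Icc (-T) T, ∀ a b,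
      ‖sob s t (duhL hT.le (isMultiplier_jetMul none) (hg.source hT.le a b))‖ ≤
        C * ‖hg.initial hT s r‖ ^ 2 := by
  have key : ∀ (g : Fin 3 → Fin n → Fin n → Space → ℂ) (hg : IsGaussData g),
      ∃ Z : ℝ → JetSp n, Z 0 = 0 ∧ HasDerivAt Z (hg.freeJet hT.le) 0 ∧
        ∀ᶠ ε in 𝓝 (0 : ℝ), IsJetSolution hT hg ε (Z ε) ∧
          ε • hg.initial hT s r ∈ smoothData n s r hT ∧
          Φ (ε • hg.initial hT s r) = trajectory s r T (Z ε none) := by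
    intro g hg
    obtain ⟨Z, h0, h1, h2⟩ := exists_isJetSolution hT hg
    refine ⟨Z, h0, h1, ?_⟩
    have hs : ∀ᶠ ε : ℝ in 𝓝 0, ε • hg.initial hT s r ∈ U := by
      have : Tendsto (fun ε : ℝ => ε • hg.initial hT s r) (𝓝 0) (𝓝 0) := by
        have := (continuous_id (X := ℝ)).smul (continuous_const (y := hg.initial hT s r))
        simpa using! this.tendsto 0
      exact this hU
    filter_upwards [h2, hs] with ε hε hεU
    have e1 := hε.trajectory_zero s r
    have e2 := hε.isSmoothTrajectory s r
    refine ⟨hε, ⟨_, e2, e1⟩, ?_⟩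
    rw [← e1]
    exact hΦ _ e2 (by rwa [e1])
  -- The value at the origin is read off from the zero solution, obtained as the case g = 0, ε = 0.
  have hΦ0 : Φ 0 = 0 := by
    have hg : IsGaussData (fun (_ : Fin 3) (_ _ : Fin n) (_ : Space) => (0 : ℂ)) :=
      ⟨fun _ _ _ => IsTestFreq.zero, by simp, by simp, by simp⟩
    obtain ⟨Z, h0, -, h2⟩ := key _ hg
    have h3 := h2.self_of_nhds.2.2
    rw [zero_smul, h0] at h3
    rw [h3]
    ext1 t
    refine Prod.ext ?_ ?_
    · ext1 μ; ext1 i; ext1 j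
      exact map_zero (sob s t)
    · ext1 μ; ext1 ν; ext1 i; ext1 j
      exact map_zero (sob r t)
  obtain ⟨C, hC0, hCb⟩ := hC.exists_second_variation_bound hΦ0
  refine ⟨C, hC0, fun g hg t ht a b => ?_⟩
  obtain ⟨Z, h0, h1, h2⟩ := key g hg
  -- The component A_0 is singled out because its free part vanishes; this is what lets the quotient
  -- by ε² converge.
  let l : C(Icc (-T) T, DataSpace n s r) →L[ℝ] SobolevH s :=
    LinearMap.mkContinuous
      { toFun := fun y => (y ⟨t, ht⟩).1 0 a b
        map_add' := fun _ _ => rfl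
        map_smul' := fun _ _ => rfl } 1 fun y => by
      rw [one_mul]
      refine le_trans ?_ (y.norm_coe_le_norm ⟨t, ht⟩)
      exact (norm_le_pi_norm _ b).trans ((norm_le_pi_norm _ a).trans
        ((norm_le_pi_norm _ (0 : Fin 4)).trans (norm_fst_le _)))
  have hl : ‖l‖ ≤ 1 := LinearMap.mkContinuous_norm_le _ zero_le_one _
  have hm : Tendsto (fun ε : ℝ => (ε ^ 2)⁻¹ • l (Φ (ε • hg.initial hT s r))) (𝓝[≠] 0)
      (𝓝 (-sob s t (duhL hT.le (isMultiplier_jetMul none) (hg.source hT.le a b)))) := by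
    -- These are the difference quotients of Z at 0.
    have hY : Tendsto (fun ε : ℝ => ε⁻¹ • Z ε) (𝓝[≠] 0) (𝓝 (hg.freeJet hT.le)) := by
      have := h1.tendsto_slope
      refine this.congr fun ε => ?_
      simp [slope, h0]
    have hq : Tendsto (fun ε : ℝ => quadA (ε⁻¹ • Z ε) 0 - ε • cubA (ε⁻¹ • Z ε) 0) (𝓝[≠] 0)
        (𝓝 (hg.source hT.le)) := by
      have h3 := ((continuous_quadA (n := n) 0).tendsto _).comp hY
      have h4 := ((continuous_cubA (n := n) 0).tendsto _).comp hY
      have h5 := h3.sub ((tendsto_id.mono_left (nhdsWithin_le_nhds (s := {(0 : ℝ)}ᶜ))).smul h4)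
      simpa [hg.quadA_freeJet] using! h5
    have hq' := ((continuous_apply b).comp (continuous_apply (A := fun _ => Fin n → Alg) a)).tendsto
      _ |>.comp hq
    have h6 := ((((sob s t).comp (duhL hT.le (isMultiplier_jetMul none))).continuous.tendsto _).comp
      hq').neg
    refine h6.congr' ?_
    filter_upwards [self_mem_nhdsWithin, h2.filter_mono nhdsWithin_le_nhds] with ε hε hε2
    have hε : ε ≠ 0 := hε
    rw [hε2.2.2]
    change _ = (ε ^ 2)⁻¹ • sob s t (Z ε none (.inl 0) a b)
    have e : Z ε none (.inl 0) a b = -(ε ^ 2) • duhL hT.le (isMultiplier_jetMul none)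
        ((quadA (ε⁻¹ • Z ε) 0 - ε • cubA (ε⁻¹ • Z ε) 0) a b) := by
      have e1 : Z ε none (.inl 0) a b = ε • hg.freeJet hT.le none (.inl 0) a b -
          duhL hT.le (isMultiplier_jetMul none) (nlA (Z ε) 0 a b) :=
        congrFun (congrFun (congrFun (congrFun hε2.1.eq none) (.inl 0)) a) b
      have e2 := nlA_smul ε (ε⁻¹ • Z ε) 0
      rw [smul_smul, mul_inv_cancel₀ hε, one_smul] at e2
      rw [e1, hg.freeJet_inl_zero, e2, Pi.smul_apply, Pi.smul_apply, map_smul]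
      simp
    rw [e, map_smul, smul_smul]
    have : (ε ^ 2)⁻¹ * -ε ^ 2 = -1 := by field_simp
    rw [this, neg_one_smul]
    rfl
  have := hCb _ (h2.mono fun ε h => h.2.1) _ l hl _ hm
  rwa [norm_neg] at this

end SecondVariation

/-! ### The interaction of two free waves -/

noncomputable section Packets

variable {n : ℕ} {T : ℝ}

/-- The spatial Fourier transforms, taken to be real, of the components of a divergence free vector
field. -/
structure IsPacket (w : Fin 3 → Space → ℝ) : Prop where
  cont : ∀ i, Continuous (w i)
  supp : ∀ i, HasCompactSupport (w i)
  div : ∀ ξ, ∑ i, ξ i * w i ξ = 0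

/-- The `su(n)`-valued data with the entries `w` at `(a₀, b₀)`. -/
def pairData (a₀ b₀ : Fin n) (w : Fin 3 → Space → ℝ) (i : Fin 3) (a b : Fin n) (ξ : Space) : ℂ :=
  if a = a₀ ∧ b = b₀ then (w i ξ : ℂ) else if a = b₀ ∧ b = a₀ then -(w i (-ξ) : ℂ) else 0

variable {a₀ b₀ : Fin n} {w : Fin 3 → Space → ℝ}

/-- The transposed entry -w(-ξ) is dictated by skew-Hermitian symmetry for real w, and the trace
vanishes because both entries lie off the diagonal. -/
theorem IsPacket.isGaussData (hw : IsPacket w) (h : a₀ ≠ b₀) : IsGaussData (pairData a₀ b₀ w) where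
  test i a b := by
    have h1 : IsTestFreq fun ξ => (w i ξ : ℂ) :=
      ⟨Complex.continuous_ofReal.comp (hw.cont i), (hw.supp i).comp_left (g := Complex.ofReal) rfl⟩
    have h2 : IsTestFreq fun ξ => -(w i (-ξ) : ℂ) := by
      refine ⟨(h1.cont.comp continuous_neg).neg, ?_⟩
      have := h1.supp.comp_homeomorph (Homeomorph.neg Space)
      exact this.comp_left (g := fun z : ℂ => -z) (by simp)
    by_cases e1 : a = a₀ ∧ b = b₀
    · have : pairData a₀ b₀ w i a b = fun ξ => (w i ξ : ℂ) := by
        ext ξ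
        simp only [pairData, if_pos e1]
      rw [this]
      exact h1
    · by_cases e2 : a = b₀ ∧ b = a₀
      · have : pairData a₀ b₀ w i a b = fun ξ => -(w i (-ξ) : ℂ) := by
          ext ξ
          simp only [pairData, if_neg e1, if_pos e2]
        rw [this]
        exact h2
      · have : pairData a₀ b₀ w i a b = fun ξ => 0 := by
          ext ξ
          simp only [pairData, if_neg e1, if_neg e2]
        rw [this]
        exact IsTestFreq.zero
  skew i a b ξ := by
    by_cases e1 : a = a₀ ∧ b = b₀
    · simp [pairData, e1, h, h.symm]
    · by_cases e2 : a = b₀ ∧ b = a₀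
      · simp [pairData, e2, h, h.symm]
      · have e3 : ¬(b = a₀ ∧ a = b₀) := fun e => e2 e.symm
        have e4 : ¬(b = b₀ ∧ a = a₀) := fun e => e1 e.symm
        simp only [pairData, if_neg e1, if_neg e2, if_neg e3, if_neg e4]
        simp
  trace i ξ := by
    refine Finset.sum_eq_zero fun a _ => ?_
    have e1 : ¬(a = a₀ ∧ a = b₀) := fun e => h (e.1.symm.trans e.2)
    have e2 : ¬(a = b₀ ∧ a = a₀) := fun e => e1 e.symm
    simp only [pairData, if_neg e1, if_neg e2]
  div a b ξ := by
    have key : ∀ ξ, ∑ i, freqMul i ξ * (w i ξ : ℂ) = 0 := by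
      intro ξ
      have := congrArg (fun x : ℝ => 2 * Real.pi * Complex.I * (x : ℂ)) (hw.div ξ)
      simp only [Complex.ofReal_sum, Complex.ofReal_mul, Finset.mul_sum, Complex.ofReal_zero,
        mul_zero] at this
      rw [← this]
      refine Finset.sum_congr rfl fun i _ => ?_
      simp only [freqMul]
      ring
    by_cases e1 : a = a₀ ∧ b = b₀
    · simpa only [pairData, if_pos e1] using key ξ
    · by_cases e2 : a = b₀ ∧ b = a₀
      · simp only [pairData, if_neg e1, if_pos e2]
        rw [← key (-ξ)]
        refine Finset.sum_congr rfl fun i _ => ?_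
        simp [freqMul]
      · simp only [pairData, if_neg e1, if_neg e2, mul_zero, Finset.sum_const_zero]

/-- The interaction of two free waves of frequencies `a` and `b` at time `s`. -/
def interaction (a b s : ℝ) : ℝ :=
  Real.cos (a * s) * sinOver b s - sinOver a s * Real.cos (b * s)

/-- The contribution of two free waves of frequencies `a` and `b` to a wave of frequency `l`. -/
def waveKernel (t l a b : ℝ) : ℝ := ∫ s in (0 : ℝ)..t, sinOver l (t - s) * interaction a b s

/-- The product of the amplitudes of the two interacting waves. -/
def packetProduct (w : Fin 3 → Space → ℝ) (ξ η : Space) : ℝ := ∑ i, w i η * w i (η - ξ)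

/-- In a diagonal entry of the commutator only the intermediate index b₀ survives. The transposed
entry turns w(ξ - η) into -w(η - ξ), so the output at ξ comes from the difference of two frequencies
η and η - ξ in the support of w. This allows ξ to be nearly parallel to both. -/
theorem IsPacket.dens_source (hw : IsPacket w) (h : a₀ ≠ b₀) (hT : 0 ≤ T) {s : ℝ}
    (hs : s ∈ Icc (-T) T) (ξ : Space) :
    dens ((hw.isGaussData h).source hT a₀ a₀) s ξ =
      ((∫ η, interaction (disp η) (disp (η - ξ)) s * packetProduct w ξ η : ℝ) : ℂ) := by
  set hg := hw.isGaussData h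
  have e : ∀ (i : Fin 3) a b η, dens (hg.freeJet hT none (.inl i.succ) a b) s η =
      mulSin s η * pairData a₀ b₀ w i a b η := fun i a b η => by
    rw [IsGaussData.freeJet, dens_freeAlg, clampTime_of_mem hs, freeDens_none]
    simp [initPos, initVel, spatialForm]
  have e' : ∀ (i : Fin 3) a b η, dens (hg.freeJet hT (some 0) (.inl i.succ) a b) s η =
      mulCos s η * pairData a₀ b₀ w i a b η := fun i a b η => by
    rw [IsGaussData.freeJet, dens_freeAlg, clampTime_of_mem hs, freeDens_zero]
    simp [initPos, initVel, spatialForm]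
  have e1 : hg.source hT a₀ a₀ = ∑ i : Fin 3,
      ∑ k, (convL (hg.freeJet hT none (.inl i.succ) a₀ k)
          (hg.freeJet hT (some 0) (.inl i.succ) k a₀) -
        convL (hg.freeJet hT (some 0) (.inl i.succ) a₀ k)
          (hg.freeJet hT none (.inl i.succ) k a₀)) := by
    simp only [IsGaussData.source, Finset.sum_apply, brM]
  have z : ∀ (i : Fin 3) k η, k ≠ b₀ → pairData a₀ b₀ w i a₀ k η = 0 := fun i k η hk => by
    simp [pairData, hk, h]
  have p : ∀ (i : Fin 3) η, pairData a₀ b₀ w i a₀ b₀ η = w i η := fun i η => by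
    simp [pairData]
  have q : ∀ (i : Fin 3) η, pairData a₀ b₀ w i b₀ a₀ η = -(w i (-η) : ℂ) := fun i η => by
    simp [pairData, h, h.symm]
  have e2 : ∀ i : Fin 3, dens (∑ k, (convL (hg.freeJet hT none (.inl i.succ) a₀ k)
          (hg.freeJet hT (some 0) (.inl i.succ) k a₀) -
        convL (hg.freeJet hT (some 0) (.inl i.succ) a₀ k)
          (hg.freeJet hT none (.inl i.succ) k a₀))) s ξ =
      ((∫ η, interaction (disp η) (disp (η - ξ)) s * (w i η * w i (η - ξ)) : ℝ) : ℂ) := by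
    intro i
    rw [dens_sum, Finset.sum_eq_single b₀]
    · rw [dens_sub, dens_convL, dens_convL, ← integral_sub (integrable_dens_mul_dens _ _ _ _)
        (integrable_dens_mul_dens _ _ _ _), ← integral_complex_ofReal]
      refine integral_congr_ae (Filter.Eventually.of_forall fun η => ?_)
      simp only [e, e', p, q, neg_sub, mulSin, mulCos, interaction]
      rw [← neg_sub η ξ, disp_neg]
      push_cast
      ring
    · intro k _ hk
      rw [dens_sub, dens_convL, dens_convL]
      simp [e, e', z _ _ _ hk]
    · simp
  have hint : ∀ i : Fin 3, Integrable fun η =>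
      interaction (disp η) (disp (η - ξ)) s * (w i η * w i (η - ξ)) := by
    intro i
    have h1 := hw.cont i
    have h2 := continuous_disp
    have h3 := continuous_sinOver
    refine Continuous.integrable_of_hasCompactSupport ?_ ?_
    · have h4 : Continuous fun η : Space => sinOver (disp η) s :=
        h3.comp (h2.prodMk continuous_const)
      have h5 : Continuous fun η : Space => sinOver (disp (η - ξ)) s :=
        h3.comp ((h2.comp (by fun_prop)).prodMk continuous_const)
      unfold interaction
      fun_prop
    · exact ((hw.supp i).mul_right).mul_left
  rw [e1, dens_sum]
  simp only [e2]
  rw [← Complex.ofReal_sum, ← integral_finsetSum _ fun i _ => hint i]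
  simp only [packetProduct, Finset.mul_sum]

theorem IsPacket.continuous_product (hw : IsPacket w) (ξ : Space) :
    Continuous (packetProduct w ξ) := by
  have := hw.cont
  unfold packetProduct
  fun_prop

theorem IsPacket.integrable_product (hw : IsPacket w) (ξ : Space) :
    Integrable (packetProduct w ξ) := by
  unfold packetProduct
  refine integrable_finsetSum _ fun i _ => Continuous.integrable_of_hasCompactSupport ?_
    (hw.supp i).mul_right
  have := hw.cont i
  fun_prop

theorem abs_interaction_le (a b s : ℝ) : |interaction a b s| ≤ 2 * |s| := by
  have h1 := Real.abs_cos_le_one (a * s)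
  have h2 := Real.abs_cos_le_one (b * s)
  have h3 := abs_sinOver_le a s
  have h4 := abs_sinOver_le b s
  calc |interaction a b s| ≤ |Real.cos (a * s)| * |sinOver b s| + |sinOver a s| * |Real.cos (b * s)| := by
        rw [← abs_mul, ← abs_mul]; exact abs_sub _ _
    _ ≤ 1 * |s| + |s| * 1 := by gcongr
    _ = _ := by ring

/-- Prepares the exchange of the integrals in time and frequency. For 0 < s ≤ t the time factors are
at most (t - s) · 2s ≤ 2t², so a multiple of the integrable amplitude product dominates. -/
theorem IsPacket.integrable_kernel_integrand (hw : IsPacket w) {t : ℝ} (ht : 0 ≤ t) (ξ : Space) :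
    Integrable (Function.uncurry fun s η => sinOver (disp ξ) (t - s) *
      (interaction (disp η) (disp (η - ξ)) s * packetProduct w ξ η))
      ((volume.restrict (uIoc 0 t)).prod volume) := by
  have h1 : Integrable (fun _ : ℝ => 2 * t ^ 2) (volume.restrict (uIoc 0 t)) :=
    integrableOn_const (by simp [uIoc_of_le ht])
  refine (h1.mul_prod (hw.integrable_product ξ).norm).mono' ?_ ?_
  · refine Continuous.aestronglyMeasurable ?_
    have h1 := hw.continuous_product ξ
    have h2 := continuous_disp
    have h3 := continuous_sinOver
    have h4 : Continuous fun q : ℝ × Space => sinOver (disp q.2) q.1 :=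
      h3.comp ((h2.comp continuous_snd).prodMk continuous_fst)
    have h5 : Continuous fun q : ℝ × Space => sinOver (disp (q.2 - ξ)) q.1 :=
      h3.comp ((h2.comp (by fun_prop)).prodMk continuous_fst)
    have h6 : Continuous fun q : ℝ × Space => sinOver (disp ξ) (t - q.1) :=
      h3.comp (continuous_const.prodMk (by fun_prop))
    unfold interaction Function.uncurry
    fun_prop
  · have hae : ∀ᵐ q ∂((volume.restrict (uIoc 0 t)).prod (volume : Measure Space)),
        q.1 ∈ uIoc 0 t := by
      have : ∀ᵐ s ∂(volume.restrict (uIoc 0 t)), s ∈ uIoc 0 t :=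
        ae_restrict_mem measurableSet_uIoc
      exact Measure.quasiMeasurePreserving_fst.ae this
    filter_upwards [hae] with q hq
    rw [uIoc_of_le ht] at hq
    have i1 := abs_interaction_le (disp q.2) (disp (q.2 - ξ)) q.1
    have i2 := abs_sinOver_le (disp ξ) (t - q.1)
    rw [abs_of_nonneg hq.1.le] at i1
    rw [abs_of_nonneg (by linarith [hq.2] : 0 ≤ t - q.1)] at i2
    simp only [Function.uncurry, norm_mul, Real.norm_eq_abs, ← mul_assoc]
    have hq2 := hq.2
    have hq1 := hq.1
    refine mul_le_mul_of_nonneg_right ?_ (abs_nonneg _)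
    calc _ ≤ (t - q.1) * (2 * q.1) := by gcongr
      _ ≤ t * (2 * t) := by gcongr; linarith
      _ = _ := by ring

theorem IsPacket.integrable_kernel (hw : IsPacket w) {t : ℝ} (ht : 0 ≤ t) (ξ : Space) :
    Integrable fun η => waveKernel t (disp ξ) (disp η) (disp (η - ξ)) * packetProduct w ξ η := by
  have := (hw.integrable_kernel_integrand ht ξ).integral_prod_right
  refine this.congr (Filter.Eventually.of_forall fun η => ?_)
  simp only [Function.uncurry, waveKernel, intervalIntegral.integral_of_le ht, uIoc_of_le ht,
    ← integral_mul_const, mul_assoc]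

theorem IsPacket.dens_duh_source (hw : IsPacket w) (h : a₀ ≠ b₀) (hT : 0 ≤ T) {t : ℝ}
    (ht : t ∈ Icc 0 T) (ξ : Space) :
    dens (duhL hT (isMultiplier_jetMul none) ((hw.isGaussData h).source hT a₀ a₀)) t ξ =
      ((∫ η, waveKernel t (disp ξ) (disp η) (disp (η - ξ)) * packetProduct w ξ η : ℝ) : ℂ) := by
  have ht' : t ∈ Icc (-T) T := ⟨by linarith [ht.1], ht.2⟩
  rw [dens_duhL, clampTime_of_mem ht']
  have e : ∀ s ∈ uIcc 0 t, jetMul none (t - s) ξ *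
      dens ((hw.isGaussData h).source hT a₀ a₀) s ξ =
      ((∫ η, sinOver (disp ξ) (t - s) *
        (interaction (disp η) (disp (η - ξ)) s * packetProduct w ξ η) : ℝ) : ℂ) := by
    intro s hs
    rw [uIcc_of_le ht.1] at hs
    rw [hw.dens_source h hT ⟨by linarith [hs.1], hs.2.trans ht.2⟩, integral_const_mul, jetMul_none,
      mulSin]
    push_cast
    rfl
  rw [intervalIntegral.integral_congr e, intervalIntegral.integral_ofReal,
    intervalIntegral_integral_swap (hw.integrable_kernel_integrand ht.1 ξ)]
  simp only [waveKernel, ← intervalIntegral.integral_mul_const, mul_assoc]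

end Packets

/-! ### Resonant and non-resonant forcing of an oscillator -/

noncomputable section Resonance

/-- The response at time `t` of an oscillator of frequency `l` to a force of frequency `k`. -/
def forcedOscillation (t l k : ℝ) : ℝ := ∫ s in (0 : ℝ)..t, Real.sin (l * (t - s)) * Real.sin (k * s)

/-- Off resonance, the product of sines is half a difference of cosines oscillating in s at the
frequencies l + k and k - l. Integration gains the inverse frequencies, of which 1 / (k - l) is the
larger. -/
theorem abs_forcedOscillation_le {t l k : ℝ} (hl : 0 < l) (hk : l < k) :
    |forcedOscillation t l k| ≤ 2 / (k - l) := by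
  set F : ℝ → ℝ := fun s => (-(Real.sin (l * t - (l + k) * s) / (l + k)) -
    Real.sin (l * t + (k - l) * s) / (k - l)) / 2 with hF
  have h1 : 0 < l + k := by linarith
  have h2 : 0 < k - l := by linarith
  have hd : ∀ s ∈ uIcc 0 t, HasDerivAt F (Real.sin (l * (t - s)) * Real.sin (k * s)) s := by
    intro s _
    have d1 : HasDerivAt (fun s => l * t - (l + k) * s) (-(l + k)) s := by
      simpa using ((hasDerivAt_id s).const_mul (l + k)).const_sub (l * t)
    have d2 : HasDerivAt (fun s => l * t + (k - l) * s) (k - l) s := by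
      simpa using ((hasDerivAt_id s).const_mul (k - l)).const_add (l * t)
    refine (((d1.sin.div_const (l + k)).neg.sub (d2.sin.div_const (k - l))).div_const 2).congr_deriv
      ?_
    have e1 : l * t - (l + k) * s = l * (t - s) - k * s := by ring
    have e2 : l * t + (k - l) * s = l * (t - s) + k * s := by ring
    rw [e1, e2, Real.cos_sub, Real.cos_add]
    field_simp
    ring
  have hc : Continuous fun s => Real.sin (l * (t - s)) * Real.sin (k * s) := by fun_prop
  rw [forcedOscillation, intervalIntegral.integral_eq_sub_of_hasDerivAt hd
    (hc.intervalIntegrable _ _)]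
  have hb : ∀ s, |F s| ≤ 1 / (k - l) := by
    intro s
    have b1 : |Real.sin (l * t - (l + k) * s) / (l + k)| ≤ 1 / (k - l) := by
      rw [abs_div, abs_of_pos h1]
      exact div_le_div₀ zero_le_one (Real.abs_sin_le_one _) h2 (by linarith)
    have b2 : |Real.sin (l * t + (k - l) * s) / (k - l)| ≤ 1 / (k - l) := by
      rw [abs_div, abs_of_pos h2]
      gcongr
      exact Real.abs_sin_le_one _
    rw [hF]
    rw [abs_le] at b1 b2 ⊢
    constructor <;> linarith [b1.1, b1.2, b2.1, b2.2]
  calc |F t - F 0| ≤ |F t| + |F 0| := abs_sub _ _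
    _ ≤ 1 / (k - l) + 1 / (k - l) := add_le_add (hb _) (hb _)
    _ = _ := by ring

/-- At resonance one of the two cosines is constant in s; its integral is the secular term t
cos(lt). -/
theorem forcedOscillation_self {l : ℝ} (hl : l ≠ 0) (t : ℝ) :
    forcedOscillation t l l = (Real.sin (l * t) / l - t * Real.cos (l * t)) / 2 := by
  set F : ℝ → ℝ := fun s => (-(Real.sin (l * t - 2 * l * s) / (2 * l)) -
    s * Real.cos (l * t)) / 2 with hF
  have hd : ∀ s ∈ uIcc 0 t, HasDerivAt F (Real.sin (l * (t - s)) * Real.sin (l * s)) s := by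
    intro s _
    have d1 : HasDerivAt (fun s => l * t - 2 * l * s) (-(2 * l)) s := by
      simpa using ((hasDerivAt_id s).const_mul (2 * l)).const_sub (l * t)
    have d2 : HasDerivAt (fun s => s * Real.cos (l * t)) (Real.cos (l * t)) s := by
      simpa using (hasDerivAt_id s).mul_const (Real.cos (l * t))
    refine (((d1.sin.div_const (2 * l)).neg.sub d2).div_const 2).congr_deriv ?_
    have e1 : l * t - 2 * l * s = l * (t - s) - l * s := by ring
    have e2 : l * t = l * (t - s) + l * s := by ring
    rw [e1, e2, Real.cos_sub, Real.cos_add]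
    field_simp
    ring
  have hc : Continuous fun s => Real.sin (l * (t - s)) * Real.sin (l * s) := by fun_prop
  rw [forcedOscillation, intervalIntegral.integral_eq_sub_of_hasDerivAt hd
    (hc.intervalIntegrable _ _)]
  have e : l * t - 2 * l * t = -(l * t) := by ring
  simp only [hF, e, Real.sin_neg, mul_zero, sub_zero, zero_mul]
  field_simp
  ring

/-- Since the sine is 1-Lipschitz, detuning the force changes the integrand by at most |k - l| s. -/
theorem abs_forcedOscillation_sub_le {t l k : ℝ} (ht : 0 ≤ t) :
    |forcedOscillation t l k - forcedOscillation t l l| ≤ |k - l| * t ^ 2 := by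
  have hc : ∀ k : ℝ, Continuous fun s => Real.sin (l * (t - s)) * Real.sin (k * s) :=
    fun k => by fun_prop
  rw [forcedOscillation, forcedOscillation, ← intervalIntegral.integral_sub
    ((hc k).intervalIntegrable _ _) ((hc l).intervalIntegrable _ _), ← Real.norm_eq_abs]
  refine (intervalIntegral.norm_integral_le_of_norm_le_const (C := |k - l| * t) ?_).trans ?_
  · intro s hs
    rw [uIoc_of_le ht] at hs
    rw [← mul_sub, norm_mul]
    have h1 : ‖Real.sin (l * (t - s))‖ ≤ 1 := Real.abs_sin_le_one _
    have h2 : ‖Real.sin (k * s) - Real.sin (l * s)‖ ≤ |k * s - l * s| :=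
      Real.abs_sin_sub_sin_le _ _
    calc _ ≤ 1 * |k * s - l * s| := by gcongr
      _ = |k - l| * s := by rw [one_mul, ← sub_mul, abs_mul, abs_of_pos hs.1]
      _ ≤ _ := by gcongr; exact hs.2
  · rw [sub_zero, abs_of_nonneg ht]
    exact le_of_eq (by ring)

/-- Product-to-sum formulas split `interaction` into oscillations at the frequencies a + b and a -
b. In the application a - b is close to l, while a + b stays far from it. -/
theorem waveKernel_eq {t l a b : ℝ} (hl : l ≠ 0) (ha : a ≠ 0) (hb : b ≠ 0) :
    waveKernel t l a b = ((1 / b - 1 / a) * forcedOscillation t l (a + b) -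
      (1 / a + 1 / b) * forcedOscillation t l (a - b)) / (2 * l) := by
  have hc : ∀ k : ℝ, IntervalIntegrable (fun s => Real.sin (l * (t - s)) * Real.sin (k * s))
      volume 0 t := fun k => Continuous.intervalIntegrable (by fun_prop) _ _
  rw [forcedOscillation, forcedOscillation, waveKernel, ← intervalIntegral.integral_const_mul,
    ← intervalIntegral.integral_const_mul, ← intervalIntegral.integral_sub
      ((hc _).const_mul _) ((hc _).const_mul _), ← intervalIntegral.integral_div]
  refine intervalIntegral.integral_congr fun s _ => ?_
  simp only [sinOver_of_ne_zero hl, interaction, sinOver_of_ne_zero ha, sinOver_of_ne_zero hb,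
    add_mul, sub_mul, Real.sin_add, Real.sin_sub]
  field_simp
  ring

/-- If the frequencies are nearly resonant, the kernel grows linearly in time. -/
theorem abs_waveKernel_sub_le {t l a b d N : ℝ} (ht : 0 ≤ t) (hN : 0 < N) (hl : N ≤ l)
    (ha : 0 < a) (hb : 0 < b) (hd : |a - b - l| ≤ d) (hab : l + N ≤ a + b) :
    |waveKernel t l a b - (1 / a + 1 / b) / (2 * l) * (t * Real.cos (l * t) / 2)| ≤
      (1 / a + 1 / b) / (2 * l) * (3 / N + d * t ^ 2) := by
  have hl0 : 0 < l := hN.trans_le hl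
  set P := 1 / a + 1 / b with hP
  have hP0 : 0 < P := by positivity
  have hPm : |1 / b - 1 / a| ≤ P := by
    have h1 : 0 < 1 / a := by positivity
    have h2 : 0 < 1 / b := by positivity
    rw [abs_le]
    constructor <;> linarith
  -- The sum frequency is off resonance by at least N. The difference frequency is compared with
  -- exact resonance, whose bounded part sin(lt) / (2l) is a further error. Together the errors are
  -- 2/N + 1/N + d t².
  have i1 : |forcedOscillation t l (a + b)| ≤ 2 / N :=
    (abs_forcedOscillation_le hl0 (by linarith)).trans (by gcongr; linarith)
  have i2 : |forcedOscillation t l (a - b) - forcedOscillation t l l| ≤ d * t ^ 2 :=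
    (abs_forcedOscillation_sub_le ht).trans (by gcongr)
  have i3 : |forcedOscillation t l l + t * Real.cos (l * t) / 2| ≤ 1 / N := by
    rw [forcedOscillation_self hl0.ne']
    have : (Real.sin (l * t) / l - t * Real.cos (l * t)) / 2 + t * Real.cos (l * t) / 2 =
      Real.sin (l * t) / (2 * l) := by field_simp; ring
    rw [this, abs_div, abs_of_pos (by positivity : 0 < 2 * l)]
    exact div_le_div₀ zero_le_one (Real.abs_sin_le_one _) hN (by linarith)
  have e : waveKernel t l a b - P / (2 * l) * (t * Real.cos (l * t) / 2) =
      ((1 / b - 1 / a) * forcedOscillation t l (a + b) -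
        P * ((forcedOscillation t l (a - b) - forcedOscillation t l l) +
          (forcedOscillation t l l + t * Real.cos (l * t) / 2))) / (2 * l) := by
    rw [waveKernel_eq hl0.ne' ha.ne' hb.ne']
    ring
  rw [e, abs_div, abs_of_pos (by positivity : 0 < 2 * l), div_mul_eq_mul_div]
  gcongr
  calc _ ≤ |(1 / b - 1 / a) * forcedOscillation t l (a + b)| +
        |P * ((forcedOscillation t l (a - b) - forcedOscillation t l l) +
          (forcedOscillation t l l + t * Real.cos (l * t) / 2))| := abs_sub _ _
    _ ≤ P * (2 / N) + P * (d * t ^ 2 + 1 / N) := by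
        rw [abs_mul, abs_mul, abs_of_pos hP0]
        gcongr
        exact (abs_add_le _ _).trans (add_le_add i2 i3)
    _ = _ := by ring

end Resonance

/-! ### Packets concentrated on thin tubes -/

noncomputable section Knapp

/-- The box with the sides `[c i, d i]`. -/
def cuboid (c d : Fin 3 → ℝ) : Set Space := {ξ | ∀ i, ξ i ∈ Icc (c i) (d i)}

theorem cuboid_eq (c d : Fin 3 → ℝ) :
    cuboid c d = (fun ξ : Space => (WithLp.ofLp ξ : Fin 3 → ℝ)) ⁻¹' Icc c d := by
  ext ξ
  simp [cuboid, Pi.le_def, forall_and]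

theorem measurableSet_cuboid (c d : Fin 3 → ℝ) : MeasurableSet (cuboid c d) := by
  rw [cuboid_eq]
  exact (PiLp.volume_preserving_ofLp (Fin 3)).measurable measurableSet_Icc

theorem volume_cuboid (c d : Fin 3 → ℝ) :
    volume (cuboid c d) = ∏ i, ENNReal.ofReal (d i - c i) := by
  rw [cuboid_eq, (PiLp.volume_preserving_ofLp (Fin 3)).measure_preimage
    measurableSet_Icc.nullMeasurableSet, Real.volume_Icc_pi]

theorem volume_cuboid_ne_top (c d : Fin 3 → ℝ) : volume (cuboid c d) ≠ ⊤ := by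
  rw [volume_cuboid]
  exact ENNReal.prod_ne_top fun i _ => ENNReal.ofReal_ne_top

theorem volume_real_cuboid {c d : Fin 3 → ℝ} (h : ∀ i, c i ≤ d i) :
    volume.real (cuboid c d) = (d 0 - c 0) * (d 1 - c 1) * (d 2 - c 2) := by
  rw [Measure.real, volume_cuboid, ENNReal.toReal_prod, Fin.prod_univ_three,
    ENNReal.toReal_ofReal (by linarith [h 0]), ENNReal.toReal_ofReal (by linarith [h 1]),
    ENNReal.toReal_ofReal (by linarith [h 2])]

theorem integrable_indicator_cuboid (c d : Fin 3 → ℝ) (k : ℝ) :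
    Integrable ((cuboid c d).indicator fun _ => k) :=
  (integrable_indicator_iff (measurableSet_cuboid c d)).2
    (integrableOn_const (volume_cuboid_ne_top c d))

theorem integral_indicator_cuboid {c d : Fin 3 → ℝ} (h : ∀ i, c i ≤ d i) (k : ℝ) :
    ∫ ξ, (cuboid c d).indicator (fun _ => k) ξ =
      (d 0 - c 0) * (d 1 - c 1) * (d 2 - c 2) * k := by
  rw [integral_indicator (measurableSet_cuboid c d), setIntegral_const, volume_real_cuboid h,
    smul_eq_mul]

/-- A vector that nearly points in the first coordinate direction has nearly the length of its
first coordinate. -/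
theorem norm_mem_Icc_of_nearly_aligned {ξ : Space} {y : ℝ} (h0 : 0 ≤ ξ 0) (hy : 0 ≤ y)
    (h : ξ 1 ^ 2 + ξ 2 ^ 2 ≤ 2 * (ξ 0 * y)) : ‖ξ‖ ∈ Icc (ξ 0) (ξ 0 + y) := by
  have e : ‖ξ‖ ^ 2 = ξ 0 ^ 2 + ξ 1 ^ 2 + ξ 2 ^ 2 := by
    rw [EuclideanSpace.norm_sq_eq, Fin.sum_univ_three]
    simp [sq_abs]
  constructor
  · refine (pow_le_pow_iff_left₀ h0 (norm_nonneg ξ) two_ne_zero).1 ?_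
    rw [e]
    nlinarith [sq_nonneg (ξ 1), sq_nonneg (ξ 2)]
  · refine (pow_le_pow_iff_left₀ (norm_nonneg ξ) (by positivity) two_ne_zero).1 ?_
    rw [e]
    nlinarith [sq_nonneg y]

/-- A continuous function that is `1` on `[-1, 1]` and `0` outside of `[-2, 2]`. -/
def plateau (x : ℝ) : ℝ := max 0 (min 1 (2 - |x|))

theorem continuous_plateau : Continuous plateau := by unfold plateau; fun_prop

theorem plateau_nonneg (x : ℝ) : 0 ≤ plateau x := le_max_left _ _

theorem plateau_le_one (x : ℝ) : plateau x ≤ 1 := max_le zero_le_one (min_le_left _ _)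

theorem plateau_eq_one {x : ℝ} (h : |x| ≤ 1) : plateau x = 1 := by
  rw [plateau, min_eq_left (by linarith), max_eq_right zero_le_one]

theorem abs_le_of_plateau_ne_zero {x : ℝ} (h : plateau x ≠ 0) : |x| ≤ 2 := by
  by_contra! hx
  exact h (max_eq_left ((min_le_right _ _).trans (by linarith)))

/-- A cutoff function to a tube of length comparable to `N` and width comparable to `ρ`. -/
def tubeCutoff (N ρ : ℝ) (ξ : Space) : ℝ :=
  plateau ((ξ 0 - 5 / 2 * N) / N) * (plateau (ξ 1 / ρ) * plateau (ξ 2 / ρ))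

/-- A divergence free vector field whose Fourier transform is concentrated on a tube. -/
def tubePacket (N ρ : ℝ) (i : Fin 3) (ξ : Space) : ℝ := ![-ξ 1, ξ 0, 0] i * tubeCutoff N ρ ξ

variable {N ρ : ℝ}

theorem continuous_tubeCutoff (N ρ : ℝ) : Continuous (tubeCutoff N ρ) := by
  have := continuous_plateau
  unfold tubeCutoff
  fun_prop

theorem tubeCutoff_nonneg (N ρ : ℝ) (ξ : Space) : 0 ≤ tubeCutoff N ρ ξ :=
  mul_nonneg (plateau_nonneg _) (mul_nonneg (plateau_nonneg _) (plateau_nonneg _))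

theorem tubeCutoff_le_one (N ρ : ℝ) (ξ : Space) : tubeCutoff N ρ ξ ≤ 1 :=
  mul_le_one₀ (plateau_le_one _) (mul_nonneg (plateau_nonneg _) (plateau_nonneg _))
    (mul_le_one₀ (plateau_le_one _) (plateau_nonneg _) (plateau_le_one _))

theorem tubeCutoff_eq_one (hN : 0 < N) (hρ : 0 < ρ) {ξ : Space} (h0 : |ξ 0 - 5 / 2 * N| ≤ N)
    (h1 : |ξ 1| ≤ ρ) (h2 : |ξ 2| ≤ ρ) : tubeCutoff N ρ ξ = 1 := by
  rw [tubeCutoff, plateau_eq_one, plateau_eq_one, plateau_eq_one]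
  · norm_num
  · rwa [abs_div, abs_of_pos hρ, div_le_one hρ]
  · rwa [abs_div, abs_of_pos hρ, div_le_one hρ]
  · rwa [abs_div, abs_of_pos hN, div_le_one hN]

theorem bounds_of_tubeCutoff_ne_zero (hN : 0 < N) (hρ : 0 < ρ) {ξ : Space}
    (h : tubeCutoff N ρ ξ ≠ 0) :
    ξ 0 ∈ Icc (N / 2) (9 / 2 * N) ∧ |ξ 1| ≤ 2 * ρ ∧ |ξ 2| ≤ 2 * ρ := by
  have h0 := abs_le_of_plateau_ne_zero (left_ne_zero_of_mul h)
  have h1 := abs_le_of_plateau_ne_zero (left_ne_zero_of_mul (right_ne_zero_of_mul h))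
  have h2 := abs_le_of_plateau_ne_zero (right_ne_zero_of_mul (right_ne_zero_of_mul h))
  rw [abs_div, abs_of_pos hN, div_le_iff₀ hN, abs_le] at h0
  rw [abs_div, abs_of_pos hρ, div_le_iff₀ hρ] at h1 h2
  exact ⟨⟨by linarith [h0.1], by linarith [h0.2]⟩, h1, h2⟩

/-- The length and the width of the tubes are related by `ρ = √N / 100`. -/
structure IsTubeScale (N ρ : ℝ) : Prop where
  one_le : 1 ≤ N
  pos : 0 < ρ
  sq_eq : ρ ^ 2 = N / 10000

namespace IsTubeScale

theorem N_pos (h : IsTubeScale N ρ) : 0 < N := by linarith [h.one_le]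

/-- The reason for ρ² = N / 10000: the transverse squares add up to at most 8ρ² = N / 1250, while ξ
0 ≥ N / 2, so |ξ| exceeds ξ 0 by at most 1/1250, whatever N is. -/
theorem norm_mem (h : IsTubeScale N ρ) {ξ : Space} (h0 : N / 2 ≤ ξ 0) (h1 : |ξ 1| ≤ 2 * ρ)
    (h2 : |ξ 2| ≤ 2 * ρ) : ‖ξ‖ ∈ Icc (ξ 0) (ξ 0 + 1 / 1250) := by
  have hρ := h.pos
  have hN := h.N_pos
  refine norm_mem_Icc_of_nearly_aligned (by linarith) (by norm_num) ?_
  have e1 : ξ 1 ^ 2 ≤ (2 * ρ) ^ 2 := sq_le_sq' (by linarith [neg_abs_le (ξ 1)])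
    ((le_abs_self _).trans h1)
  have e2 : ξ 2 ^ 2 ≤ (2 * ρ) ^ 2 := sq_le_sq' (by linarith [neg_abs_le (ξ 2)])
    ((le_abs_self _).trans h2)
  rw [mul_pow, h.sq_eq] at e1 e2
  linarith

theorem rho_le (h : IsTubeScale N ρ) : ρ ≤ N / 100 := by
  refine (pow_le_pow_iff_left₀ h.pos.le (by linarith [h.N_pos]) two_ne_zero).1 ?_
  rw [h.sq_eq]
  nlinarith [h.one_le]

theorem isPacket (h : IsTubeScale N ρ) : IsPacket (tubePacket N ρ) where
  cont i := by
    refine Continuous.mul ?_ (continuous_tubeCutoff N ρ)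
    fin_cases i <;> simp <;> fun_prop
  supp i := by
    refine HasCompactSupport.of_support_subset_isCompact (isCompact_closedBall 0 (5 * N)) ?_
    intro ξ hξ
    obtain ⟨h0, h1, h2⟩ := bounds_of_tubeCutoff_ne_zero h.N_pos h.pos (right_ne_zero_of_mul hξ)
    have := (h.norm_mem h0.1 h1 h2).2
    rw [mem_closedBall_zero_iff]
    linarith [h0.2, h.one_le]
  div ξ := by
    simp [Fin.sum_univ_three, tubePacket]
    ring

end IsTubeScale

theorem packetProduct_tubePacket (ξ η : Space) : packetProduct (tubePacket N ρ) ξ η =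
    (η 1 * (η - ξ) 1 + η 0 * (η - ξ) 0) * (tubeCutoff N ρ η * tubeCutoff N ρ (η - ξ)) := by
  simp only [packetProduct, tubePacket, Fin.sum_univ_three]
  simp
  ring

/-- The frequencies of the output wave that are considered. -/
def outBox (N ρ : ℝ) : Set Space := cuboid ![N, -(ρ / 2), -(ρ / 2)] ![3 / 2 * N, ρ / 2, ρ / 2]

/-- The frequencies of the input waves that are responsible for the main part of the output. -/
def inBox (N ρ : ℝ) : Set Space := cuboid ![3 * N, -(ρ / 2), -(ρ / 2)] ![7 / 2 * N, ρ / 2, ρ / 2]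

theorem mem_outBox {ξ : Space} : ξ ∈ outBox N ρ ↔
    ξ 0 ∈ Icc N (3 / 2 * N) ∧ |ξ 1| ≤ ρ / 2 ∧ |ξ 2| ≤ ρ / 2 := by
  simp [outBox, cuboid, Fin.forall_fin_succ, abs_le]

theorem mem_inBox {ξ : Space} : ξ ∈ inBox N ρ ↔
    ξ 0 ∈ Icc (3 * N) (7 / 2 * N) ∧ |ξ 1| ≤ ρ / 2 ∧ |ξ 2| ≤ ρ / 2 := by
  simp [inBox, cuboid, Fin.forall_fin_succ, abs_le]

/-- The waves whose frequencies lie in the tubes are nearly resonant. -/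
theorem IsTubeScale.resonance (h : IsTubeScale N ρ) {ξ η : Space} (hξ : ξ ∈ outBox N ρ)
    (h1 : tubeCutoff N ρ η ≠ 0) (h2 : tubeCutoff N ρ (η - ξ) ≠ 0) :
    N ≤ disp ξ ∧ disp ξ ≤ 11 * N ∧ 0 < disp η ∧ 0 < disp (η - ξ) ∧
      |disp η - disp (η - ξ) - disp ξ| ≤ 1 / 50 ∧ disp ξ + N ≤ disp η + disp (η - ξ) := by
  have hN := h.one_le
  have hρ := h.pos
  have hp := Real.pi_gt_three
  have hp' := Real.pi_lt_d2
  obtain ⟨⟨x1, x2⟩, x3, x4⟩ := mem_outBox.1 hξ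
  obtain ⟨y1, y2, y3⟩ := bounds_of_tubeCutoff_ne_zero h.N_pos hρ h1
  obtain ⟨z1, z2, z3⟩ := bounds_of_tubeCutoff_ne_zero h.N_pos hρ h2
  obtain ⟨a1, a2⟩ := h.norm_mem (by linarith : N / 2 ≤ ξ 0) (by linarith) (by linarith)
  obtain ⟨b1, b2⟩ := h.norm_mem y1.1 y2 y3
  obtain ⟨c1, c2⟩ := h.norm_mem z1.1 z2 z3
  have e : (η - ξ) 0 = η 0 - ξ 0 := rfl
  have z4 := z1.1
  have y4 := y1.1
  rw [e] at c1 c2 z4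
  simp only [disp]
  refine ⟨by nlinarith, by nlinarith, by nlinarith, by nlinarith, ?_, by nlinarith⟩
  rw [← mul_sub, ← mul_sub, abs_mul, abs_of_pos (by positivity : 0 < 2 * Real.pi)]
  -- The first coordinates satisfy η 0 - (η - ξ) 0 = ξ 0 exactly, and each norm exceeds its first
  -- coordinate by at most 1/1250. Moreover 2π · 2/1250 < 1/50.
  have : |‖η‖ - ‖η - ξ‖ - ‖ξ‖| ≤ 2 / 1250 := by
    rw [abs_le]
    constructor <;> linarith
  nlinarith

/-- On the support the longitudinal product is at least N²/4, against a transverse product of at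
most 4ρ². The amplitudes therefore never cancel, and part of the frequency integral may be discarded
in a lower bound. -/
theorem IsTubeScale.packetProduct_nonneg (h : IsTubeScale N ρ) (ξ η : Space) :
    0 ≤ packetProduct (tubePacket N ρ) ξ η := by
  rw [packetProduct_tubePacket]
  have hN := h.one_le
  have hρ := h.pos
  by_cases h1 : tubeCutoff N ρ η = 0
  · simp [h1]
  by_cases h2 : tubeCutoff N ρ (η - ξ) = 0
  · simp [h2]
  refine mul_nonneg ?_ (mul_nonneg (tubeCutoff_nonneg _ _ _) (tubeCutoff_nonneg _ _ _))
  obtain ⟨y1, y2, y3⟩ := bounds_of_tubeCutoff_ne_zero h.N_pos hρ h1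
  obtain ⟨z1, z2, z3⟩ := bounds_of_tubeCutoff_ne_zero h.N_pos hρ h2
  have e1 : |η 1 * (η - ξ) 1| ≤ (2 * ρ) * (2 * ρ) := by rw [abs_mul]; gcongr
  have e2 : (N / 2) * (N / 2) ≤ η 0 * (η - ξ) 0 :=
    mul_le_mul y1.1 z1.1 (by linarith) (by linarith [y1.1])
  have e3 := neg_abs_le (η 1 * (η - ξ) 1)
  have e4 := h.sq_eq
  nlinarith

/-- The boxes are matched to the cutoff: both η 0 ∈ [3N, 7N/2] and η 0 - ξ 0 ∈ [3N/2, 5N/2] lie in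
[3N/2, 7N/2], where the longitudinal plateau equals 1. The longitudinal product 3N · 3N/2 leaves
room for the transverse error ρ²/2. -/
theorem IsTubeScale.le_packetProduct (h : IsTubeScale N ρ) {ξ η : Space} (hξ : ξ ∈ outBox N ρ)
    (hη : η ∈ inBox N ρ) : tubeCutoff N ρ η ≠ 0 ∧ tubeCutoff N ρ (η - ξ) ≠ 0 ∧
      4 * N ^ 2 ≤ packetProduct (tubePacket N ρ) ξ η := by
  have hN := h.one_le
  have hρ := h.pos
  obtain ⟨⟨x1, x2⟩, x3, x4⟩ := mem_outBox.1 hξ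
  obtain ⟨⟨y1, y2⟩, y3, y4⟩ := mem_inBox.1 hη
  have e : ∀ i, (η - ξ) i = η i - ξ i := fun i => rfl
  have z1 : |(η - ξ) 1| ≤ ρ := by rw [e]; exact (abs_sub _ _).trans (by linarith)
  have z2 : |(η - ξ) 2| ≤ ρ := by rw [e]; exact (abs_sub _ _).trans (by linarith)
  have c1 : tubeCutoff N ρ η = 1 :=
    tubeCutoff_eq_one h.N_pos hρ (abs_le.2 ⟨by linarith, by linarith⟩) (by linarith) (by linarith)
  have c2 : tubeCutoff N ρ (η - ξ) = 1 :=
    tubeCutoff_eq_one h.N_pos hρ (by rw [e]; exact abs_le.2 ⟨by linarith, by linarith⟩) z1 z2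
  refine ⟨by simp [c1], by simp [c2], ?_⟩
  rw [packetProduct_tubePacket, c1, c2, mul_one, mul_one]
  have e1 : |η 1 * (η - ξ) 1| ≤ (ρ / 2) * ρ := by rw [abs_mul]; gcongr
  have e2 : (3 * N) * (3 / 2 * N) ≤ η 0 * (η - ξ) 0 :=
    mul_le_mul y1 (by rw [e]; linarith) (by linarith) (by linarith)
  have e3 := neg_abs_le (η 1 * (η - ξ) 1)
  have e4 := h.sq_eq
  nlinarith

/-- The output has a large amplitude. -/
theorem IsTubeScale.le_abs_integral (h : IsTubeScale N ρ) {t : ℝ} (ht : 0 ≤ t) {ξ : Space}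
    (hξ : ξ ∈ outBox N ρ) :
    (t * |Real.cos (disp ξ * t)| / 2 - (3 / N + 1 / 50 * t ^ 2)) * (N ^ 2 / 20000 / 200) ≤
      |∫ η, waveKernel t (disp ξ) (disp η) (disp (η - ξ)) *
        packetProduct (tubePacket N ρ) ξ η| := by
  have hN := h.one_le
  have hN0 := h.N_pos
  have hρ := h.pos
  set q := t * |Real.cos (disp ξ * t)| / 2 - (3 / N + 1 / 50 * t ^ 2) with hq
  set X := ∫ η, waveKernel t (disp ξ) (disp η) (disp (η - ξ)) *
    packetProduct (tubePacket N ρ) ξ η with hX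
  rcases le_or_gt q 0 with hq0 | hq0
  · exact (mul_nonpos_of_nonpos_of_nonneg hq0 (by positivity)).trans (abs_nonneg _)
  -- The sign σ of the cosine does not depend on η, so lower bounds for σ times the integrand hold
  -- pointwise and can be integrated.
  obtain ⟨σ, hσ, hσ'⟩ : ∃ σ : ℝ, |σ| = 1 ∧ σ * Real.cos (disp ξ * t) = |Real.cos (disp ξ * t)| := by
    rcases le_total 0 (Real.cos (disp ξ * t)) with hc | hc
    · exact ⟨1, by simp, by rw [abs_of_nonneg hc, one_mul]⟩
    · exact ⟨-1, by simp, by rw [abs_of_nonpos hc, neg_one_mul]⟩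
  have key : ∀ η, (inBox N ρ).indicator (fun _ => q / 200) η ≤
      σ * (waveKernel t (disp ξ) (disp η) (disp (η - ξ)) *
        packetProduct (tubePacket N ρ) ξ η) := by
    intro η
    have hW := h.packetProduct_nonneg ξ η
    by_cases hc : tubeCutoff N ρ η ≠ 0 ∧ tubeCutoff N ρ (η - ξ) ≠ 0
    · obtain ⟨r1, r2, r3, r4, r5, r6⟩ := h.resonance hξ hc.1 hc.2
      have hk := abs_waveKernel_sub_le ht hN0 r1 r3 r4 r5 r6
      set P := (1 / disp η + 1 / disp (η - ξ)) / (2 * disp ξ) with hP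
      have hl0 : 0 < disp ξ := by linarith
      have hP0 : 0 ≤ P := by positivity
      set k := waveKernel t (disp ξ) (disp η) (disp (η - ξ))
      have hk2 : P * q ≤ σ * k := by
        have h1 : |σ * (k - P * (t * Real.cos (disp ξ * t) / 2))| ≤
            P * (3 / N + 1 / 50 * t ^ 2) := by rwa [abs_mul, hσ, one_mul]
        have h2 := (abs_le.1 h1).1
        have h3 : σ * (k - P * (t * Real.cos (disp ξ * t) / 2)) =
            σ * k - P * (t * |Real.cos (disp ξ * t)| / 2) := by rw [← hσ']; ring
        rw [h3] at h2
        rw [hq, mul_sub]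
        linarith
      have hk3 : P * q * packetProduct (tubePacket N ρ) ξ η ≤
          σ * (k * packetProduct (tubePacket N ρ) ξ η) := by
        rw [← mul_assoc]
        gcongr
      refine le_trans ?_ hk3
      by_cases hη : η ∈ inBox N ρ
      · rw [indicator_of_mem hη]
        have hW4 := (h.le_packetProduct hξ hη).2.2
        obtain ⟨⟨y1, y2⟩, y3, y4⟩ := mem_inBox.1 hη
        have b2 := (h.norm_mem (by linarith : N / 2 ≤ η 0) (by linarith) (by linarith)).2
        have hη1 : disp η ≤ 23 * N := by
          have := Real.pi_lt_d2
          have := Real.pi_gt_three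
          simp only [disp]
          nlinarith
        have hP1 : 1 / (23 * N) / (2 * (11 * N)) ≤ P := by
          rw [hP]
          have : 0 < 1 / disp (η - ξ) := by positivity
          have : 1 / (23 * N) ≤ 1 / disp η := by gcongr
          gcongr
          linarith
        -- From disp η ≤ 23N, disp ξ ≤ 11N and the amplitude 4N² comes the factor 4/506, which
        -- exceeds 1/200.
        calc q / 200 ≤ 1 / (23 * N) / (2 * (11 * N)) * q * (4 * N ^ 2) := by
              have : 1 / (23 * N) / (2 * (11 * N)) * q * (4 * N ^ 2) = q * (4 / 506) := by
                field_simp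
                norm_num
              rw [this]
              linarith
          _ ≤ _ := by gcongr
      · rw [indicator_of_notMem hη]
        positivity
    · have hη : η ∉ inBox N ρ := fun hη =>
        hc ⟨(h.le_packetProduct hξ hη).1, (h.le_packetProduct hξ hη).2.1⟩
      have hW0 : packetProduct (tubePacket N ρ) ξ η = 0 := by
        rw [packetProduct_tubePacket]
        rw [not_and_or, not_not, not_not] at hc
        rcases hc with hc | hc <;> simp [hc]
      rw [indicator_of_notMem hη, hW0]
      simp
  have hi := integral_mono (integrable_indicator_cuboid _ _ _)
    ((h.isPacket.integrable_kernel ht ξ).const_mul σ) key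
  rw [integral_const_mul, integral_indicator_cuboid] at hi
  · have hs : σ * X ≤ |X| := (le_abs_self _).trans (by rw [abs_mul, hσ, one_mul])
    refine le_trans (le_of_eq ?_) (hi.trans hs)
    simp
    -- The volume of `inBox` is (N/2) ρ² = N² / 20000.
    have := h.sq_eq
    linear_combination (-(N * q / 400)) * this
  · intro i
    fin_cases i <;> simp <;> linarith

/-- The inequality (a - e)² ≥ a²/2 - e² amounts to (a - 2e)² ≥ 0. If a < e the hypothesis cannot be
squared, but then the left-hand side is nonpositive. -/
theorem sq_ge_of_sub_mul_le {X a e K : ℝ} (ha : 0 ≤ a) (he : 0 ≤ e) (hK : 0 ≤ K)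
    (h : (a - e) * K ≤ X) : K ^ 2 * (a ^ 2 / 2 - e ^ 2) ≤ X ^ 2 := by
  rcases le_total e a with hae | hae
  · have h1 : ((a - e) * K) ^ 2 ≤ X ^ 2 :=
      pow_le_pow_left₀ (mul_nonneg (by linarith) hK) h 2
    nlinarith [mul_nonneg (sq_nonneg K) (sq_nonneg (a - 2 * e))]
  · have h1 : a ^ 2 / 2 - e ^ 2 ≤ 0 := by nlinarith
    exact (mul_nonpos_of_nonneg_of_nonpos (sq_nonneg K) h1).trans (sq_nonneg X)

/-- At one of two times the output is large. -/
theorem IsTubeScale.le_sum_sq (h : IsTubeScale N ρ) {t : ℝ} (ht : 0 < t) (ht1 : t ≤ 1)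
    (hNt : 100 / t ≤ N) {ξ : Space} (hξ : ξ ∈ outBox N ρ) :
    (N ^ 2 / 20000 / 200) ^ 2 * (t ^ 2 / 200) ≤
      (∫ η, waveKernel t (disp ξ) (disp η) (disp (η - ξ)) *
        packetProduct (tubePacket N ρ) ξ η) ^ 2 +
      (∫ η, waveKernel (t / 2) (disp ξ) (disp η) (disp (η - ξ)) *
        packetProduct (tubePacket N ρ) ξ η) ^ 2 := by
  have hN0 := h.N_pos
  have h1 := h.le_abs_integral ht.le hξ
  have h2 := h.le_abs_integral (by positivity : 0 ≤ t / 2) hξ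
  set X₁ := ∫ η, waveKernel t (disp ξ) (disp η) (disp (η - ξ)) *
    packetProduct (tubePacket N ρ) ξ η
  set X₂ := ∫ η, waveKernel (t / 2) (disp ξ) (disp η) (disp (η - ξ)) *
    packetProduct (tubePacket N ρ) ξ η
  set K := N ^ 2 / 20000 / 200 with hK
  have hK0 : 0 ≤ K := by positivity
  have h3 : 3 / N ≤ 3 / 100 * t := by
    rw [div_le_iff₀ ht] at hNt
    rw [div_le_iff₀ hN0]
    linarith
  -- The secular term is lost where cos(disp ξ · t) vanishes, so no single time serves all ξ. By the
  -- double-angle formula the cosines at t/2 and t are y and 2y² - 1, which cannot both be small.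
  set y := Real.cos (disp ξ * (t / 2)) with hy
  have hc : Real.cos (disp ξ * t) = 2 * y ^ 2 - 1 := by
    rw [hy, ← Real.cos_two_mul]
    congr 1
    ring
  rw [hc] at h1
  -- As N ≥ 100/t and t ≤ 1, the error 3/N + t²/50 is at most 3t/100 + t/50 = t/20; the same bound
  -- serves at time t/2.
  have b1 : (t * |2 * y ^ 2 - 1| / 2 - t / 20) * K ≤ |X₁| :=
    le_trans (by gcongr; nlinarith) h1
  have b2 : (t / 2 * |y| / 2 - t / 20) * K ≤ |X₂| :=
    le_trans (by gcongr; nlinarith) h2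
  have c1 := sq_ge_of_sub_mul_le (by positivity) (by positivity) hK0 b1
  have c2 := sq_ge_of_sub_mul_le (by positivity) (by positivity) hK0 b2
  rw [sq_abs] at c1 c2
  have d1 : (t * |2 * y ^ 2 - 1| / 2) ^ 2 = t ^ 2 * (2 * y ^ 2 - 1) ^ 2 / 4 := by
    rw [div_pow, mul_pow, sq_abs]; norm_num
  have d2 : (t / 2 * |y| / 2) ^ 2 = t ^ 2 * y ^ 2 / 16 := by
    rw [div_pow, mul_pow, sq_abs]; ring
  rw [d1] at c1
  rw [d2] at c2
  refine le_trans ?_ (add_le_add c1 c2)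
  rw [← mul_add]
  refine mul_le_mul_of_nonneg_left ?_ (sq_nonneg K)
  -- In z = y² the right-hand side is 16z² - 15z + 4, with minimum 31/64 at z = 15/32.
  have e : (2 / 5 : ℝ) ≤ 4 * (2 * y ^ 2 - 1) ^ 2 + y ^ 2 := by
    nlinarith [sq_nonneg (y ^ 2 - 15 / 32)]
  nlinarith [mul_le_mul_of_nonneg_left e (sq_nonneg t)]

/-- Writing 1 + |ξ|² = Y N² with |log Y| ≤ log 64, the factor Y^{σ/2} lies between 8^{-|σ|} and
8^{|σ|}; passing to logarithms treats both signs of σ at once. -/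
theorem jap_mem_Icc (σ : ℝ) (hN : 0 < N) {ξ : Space} (h1 : N ^ 2 / 64 ≤ 1 + ‖ξ‖ ^ 2)
    (h2 : 1 + ‖ξ‖ ^ 2 ≤ 64 * N ^ 2) :
    jap σ ξ ∈ Icc ((8 ^ |σ|)⁻¹ * N ^ σ) (8 ^ |σ| * N ^ σ) := by
  set Y := (1 + ‖ξ‖ ^ 2) / N ^ 2 with hY
  have hY0 : 0 < Y := by positivity
  have hY1 : (64 : ℝ)⁻¹ ≤ Y := by rw [hY, le_div_iff₀ (by positivity)]; linarith
  have hY2 : Y ≤ 64 := by rw [hY, div_le_iff₀ (by positivity)]; linarith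
  have e : jap σ ξ = Y ^ (σ / 2) * N ^ σ := by
    have h3 : 1 + ‖ξ‖ ^ 2 = Y * N ^ 2 := by rw [hY]; field_simp
    rw [jap, h3, Real.mul_rpow hY0.le (by positivity), ← Real.rpow_natCast N 2,
      ← Real.rpow_mul hN.le]
    congr 2
    push_cast
    ring
  have h8 : (8 : ℝ) ^ |σ| = 64 ^ (|σ| / 2) := by
    rw [show (64 : ℝ) = 8 ^ (2 : ℝ) by norm_num, ← Real.rpow_mul (by norm_num)]
    congr 1
    ring
  have hl : |Real.log Y| ≤ Real.log 64 := by
    rw [abs_le]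
    constructor
    · rw [← Real.log_inv]
      exact Real.log_le_log (by norm_num) hY1
    · exact Real.log_le_log hY0 hY2
  have hb : |Real.log Y * (σ / 2)| ≤ Real.log 64 * (|σ| / 2) := by
    rw [abs_mul, abs_div, abs_two]
    gcongr
  rw [abs_le] at hb
  have hNσ : 0 < N ^ σ := Real.rpow_pos_of_pos hN σ
  rw [e, h8, Real.rpow_def_of_pos hY0, Real.rpow_def_of_pos (by norm_num : (0 : ℝ) < 64),
    ← Real.exp_neg]
  constructor
  · exact mul_le_mul_of_nonneg_right (Real.exp_le_exp.2 hb.1) hNσ.le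
  · exact mul_le_mul_of_nonneg_right (Real.exp_le_exp.2 hb.2) hNσ.le

theorem IsTubeScale.norm_tubePacket_le (h : IsTubeScale N ρ) (i : Fin 3) (ξ : Space) :
    |tubePacket N ρ i ξ| ≤ 5 * N := by
  have hN := h.one_le
  by_cases hc : tubeCutoff N ρ ξ = 0
  · simp [tubePacket, hc]
    linarith
  obtain ⟨h0, h1, -⟩ := bounds_of_tubeCutoff_ne_zero h.N_pos h.pos hc
  have h2 := h.rho_le
  rw [tubePacket, abs_mul, abs_of_nonneg (tubeCutoff_nonneg _ _ _)]
  refine (mul_le_of_le_one_right (abs_nonneg _) (tubeCutoff_le_one _ _ _)).trans ?_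
  have h3 := abs_of_nonneg (by linarith [h0.1] : 0 ≤ ξ 0)
  fin_cases i
  · simp; linarith
  · simp [h3]; linarith [h0.2]
  · simp; linarith

end Knapp

/-! ### Comparison of the second iterate with the data -/

noncomputable section Illposedness

variable {n : ℕ} {T N ρ : ℝ} {a₀ b₀ : Fin n}

/-- A box that contains the frequencies of the initial data. -/
def dataBox (N ρ : ℝ) : Set Space :=
  cuboid ![-(9 / 2 * N), -(2 * ρ), -(2 * ρ)] ![9 / 2 * N, 2 * ρ, 2 * ρ]

theorem mem_dataBox {ξ : Space} : ξ ∈ dataBox N ρ ↔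
    |ξ 0| ≤ 9 / 2 * N ∧ |ξ 1| ≤ 2 * ρ ∧ |ξ 2| ≤ 2 * ρ := by
  simp [dataBox, cuboid, Fin.forall_fin_succ, abs_le]

theorem jap_neg_arg (r : ℝ) (ξ : Space) : jap r (-ξ) = jap r ξ := by simp [jap]

theorem IsTubeScale.jap_mul_tubePacket_le (h : IsTubeScale N ρ) (r : ℝ) (i : Fin 3) (ξ : Space) :
    jap r ξ * |tubePacket N ρ i ξ| ≤
      (dataBox N ρ).indicator (fun _ => 8 ^ |r| * N ^ r * (5 * N)) ξ := by
  have hN := h.one_le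
  have hN0 := h.N_pos
  by_cases hc : tubeCutoff N ρ ξ = 0
  · rw [tubePacket, hc]
    simp only [mul_zero, abs_zero]
    exact indicator_nonneg (fun _ _ => by positivity) _
  obtain ⟨h0, h1, h2⟩ := bounds_of_tubeCutoff_ne_zero h.N_pos h.pos hc
  obtain ⟨k1, k2⟩ := h.norm_mem h0.1 h1 h2
  have hm : ξ ∈ dataBox N ρ := mem_dataBox.2 ⟨by
    rw [abs_of_nonneg (by linarith [h0.1])]; exact h0.2, h1, h2⟩
  rw [indicator_of_mem hm]
  have k3 : N / 2 ≤ ‖ξ‖ := h0.1.trans k1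
  have k4 : ‖ξ‖ ≤ 5 * N := by linarith [h0.2]
  have hj := (jap_mem_Icc r hN0 (ξ := ξ) (by nlinarith) (by nlinarith)).2
  gcongr
  exact h.norm_tubePacket_le i ξ

/-- The transposed entry lives on the reflected tube, which is why `dataBox` is symmetric about the
origin. -/
theorem IsTubeScale.jap_mul_initPos_le (h : IsTubeScale N ρ) (r : ℝ) (μ ν : Fin 4)
    (a b : Fin n) (ξ : Space) :
    jap r ξ * ‖initPos (pairData a₀ b₀ (tubePacket N ρ)) (.inr (μ, ν)) a b ξ‖ ≤
      (dataBox N ρ).indicator (fun _ => 8 ^ |r| * N ^ r * (5 * N)) ξ := by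
  have hN0 := h.N_pos
  have hnn : 0 ≤ (dataBox N ρ).indicator (fun _ => 8 ^ |r| * N ^ r * (5 * N)) ξ :=
    indicator_nonneg (fun _ _ => by positivity) _
  have hneg : ∀ ξ : Space, (dataBox N ρ).indicator (fun _ => 8 ^ |r| * N ^ r * (5 * N)) (-ξ) =
      (dataBox N ρ).indicator (fun _ => 8 ^ |r| * N ^ r * (5 * N)) ξ := by
    intro ξ
    have : -ξ ∈ dataBox N ρ ↔ ξ ∈ dataBox N ρ := by simp [mem_dataBox]
    by_cases hm : ξ ∈ dataBox N ρ
    · rw [indicator_of_mem hm, indicator_of_mem (this.2 hm)]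
    · rw [indicator_of_notMem hm, indicator_of_notMem fun h => hm (this.1 h)]
  have hpair : ∀ i, jap r ξ * ‖pairData a₀ b₀ (tubePacket N ρ) i a b ξ‖ ≤
      (dataBox N ρ).indicator (fun _ => 8 ^ |r| * N ^ r * (5 * N)) ξ := by
    intro i
    by_cases e1 : a = a₀ ∧ b = b₀
    · rw [pairData, if_pos e1, Complex.norm_real]
      exact h.jap_mul_tubePacket_le r i ξ
    · by_cases e2 : a = b₀ ∧ b = a₀
      · rw [pairData, if_neg e1, if_pos e2, norm_neg, Complex.norm_real, ← hneg, ← jap_neg_arg]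
        exact h.jap_mul_tubePacket_le r i (-ξ)
      · rw [pairData, if_neg e1, if_neg e2]
        simpa using hnn
  have hform : ∀ μ, jap r ξ * ‖spatialForm (pairData a₀ b₀ (tubePacket N ρ)) μ a b ξ‖ ≤
      (dataBox N ρ).indicator (fun _ => 8 ^ |r| * N ^ r * (5 * N)) ξ := by
    intro μ
    refine Fin.cases ?_ (fun i => ?_) μ
    · simpa [spatialForm] using hnn
    · exact hpair i
  simp only [initPos, Sum.elim_inr]
  by_cases hμ : μ = 0
  · by_cases hν : ν = 0
    · simpa [hμ, hν] using hnn
    · simpa [hμ, hν, spatialForm] using hform ν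
  · by_cases hν : ν = 0
    · simpa [hμ, hν, spatialForm] using hform μ
    · simpa [hμ, hν] using hnn

theorem IsGaussData.dens_freeJet_zero {g : Fin 3 → Fin n → Fin n → Space → ℂ}
    (hg : IsGaussData g) (hT : 0 ≤ T) (k : FieldIdx) (a b : Fin n) (ξ : Space) :
    dens (hg.freeJet hT none k a b) 0 ξ = initPos g k a b ξ := by
  rw [IsGaussData.freeJet, dens_freeAlg, clampTime_of_mem ⟨by linarith, hT⟩, freeDens_none]
  simp [mulCos, mulSin]

theorem integrable_jap_sq_mul_dens_sq (σ t : ℝ) (b : Alg) :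
    Integrable fun ξ => jap σ ξ ^ 2 * ‖dens b t ξ‖ ^ 2 := by
  have h := memLp_jap_mul_dens σ b t
  have h2 := (memLp_two_iff_integrable_sq_norm h.aestronglyMeasurable).1 h
  refine h2.congr (Filter.Eventually.of_forall fun ξ => ?_)
  simp only [norm_mul, Complex.norm_real, Real.norm_of_nonneg (jap_pos σ ξ).le, mul_pow]

/-- Only f contributes, as a vanishes. Its weighted transform is at most of order N^{r+1} on a box
of volume 9N (4ρ)² = 144 N² / 10000, so the norm is at most of order N^{r+2}. -/
theorem IsTubeScale.norm_initial_sq_le (h : IsTubeScale N ρ) (hab : a₀ ≠ b₀) (hT : 0 < T)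
    (s r : ℝ) : ‖(h.isPacket.isGaussData hab).initial hT s r‖ ^ 2 ≤
      (8 ^ |r| * N ^ r * (5 * N)) ^ 2 * (144 * N ^ 2 / 10000) := by
  have hN0 := h.N_pos
  set hg := h.isPacket.isGaussData hab
  set R := (8 ^ |r| * N ^ r * (5 * N)) ^ 2 * (144 * N ^ 2 / 10000) with hR
  have hR0 : 0 ≤ R := by positivity
  have key : ∀ (σ : ℝ) k a b, (∫ ξ, jap σ ξ ^ 2 * ‖initPos (pairData a₀ b₀ (tubePacket N ρ))
      k a b ξ‖ ^ 2 ≤ R) → ‖sob σ 0 (hg.freeJet hT.le none k a b)‖ ≤ √R := by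
    intro σ k a b hk
    refine Real.le_sqrt_of_sq_le ?_
    rw [norm_sob_sq]
    simpa only [hg.dens_freeJet_zero] using hk
  have hsq : ‖hg.initial hT s r‖ ≤ √R := by
    have hs := Real.sqrt_nonneg R
    refine norm_prod_le_iff.2 ⟨?_, ?_⟩
    · refine (pi_norm_le_iff_of_nonneg hs).2 fun μ => (pi_norm_le_iff_of_nonneg hs).2 fun a =>
        (pi_norm_le_iff_of_nonneg hs).2 fun b => key s _ a b ?_
      simpa [initPos] using hR0
    · refine (pi_norm_le_iff_of_nonneg hs).2 fun μ => (pi_norm_le_iff_of_nonneg hs).2 fun ν =>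
        (pi_norm_le_iff_of_nonneg hs).2 fun a => (pi_norm_le_iff_of_nonneg hs).2 fun b =>
        key r _ a b ?_
      have hpt : ∀ ξ, jap r ξ ^ 2 * ‖initPos (pairData a₀ b₀ (tubePacket N ρ))
          (.inr (μ, ν)) a b ξ‖ ^ 2 ≤
          (dataBox N ρ).indicator (fun _ => (8 ^ |r| * N ^ r * (5 * N)) ^ 2) ξ := by
        intro ξ
        have h1 := h.jap_mul_initPos_le (a₀ := a₀) (b₀ := b₀) r μ ν a b ξ
        rw [← mul_pow]
        have h0 : 0 ≤ jap r ξ * ‖initPos (pairData a₀ b₀ (tubePacket N ρ)) (.inr (μ, ν)) a b ξ‖ :=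
          mul_nonneg (jap_pos r ξ).le (norm_nonneg _)
        refine (pow_le_pow_left₀ h0 h1 2).trans (le_of_eq ?_)
        by_cases hm : ξ ∈ dataBox N ρ <;> simp [hm]
      refine (integral_mono_of_nonneg (Filter.Eventually.of_forall fun ξ => by positivity)
        (integrable_indicator_cuboid _ _ _) (Filter.Eventually.of_forall hpt)).trans ?_
      rw [integral_indicator_cuboid]
      · refine le_of_eq ?_
        have := h.sq_eq
        simp only [Matrix.cons_val_zero, Matrix.cons_val_one, Matrix.cons_val]
        rw [hR]
        linear_combination (144 * N * (8 ^ |r| * N ^ r * (5 * N)) ^ 2) * this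
      · intro i
        have := h.pos
        fin_cases i <;> simp <;> linarith
  calc ‖hg.initial hT s r‖ ^ 2 ≤ √R ^ 2 := by gcongr
    _ = R := Real.sq_sqrt hR0

/-- On `outBox`, of volume N² / 20000, the squared amplitudes at the two times add up to at least a
multiple of t² N⁴, and the Sobolev weight is comparable to N^s. The sum of the squared norms is thus
at least of order t² N^{2s+6}. -/
theorem IsTubeScale.le_norm_sq_add_norm_sq (h : IsTubeScale N ρ) (hab : a₀ ≠ b₀) (hT : 0 < T)
    (s : ℝ) {t : ℝ} (ht : 0 < t) (ht1 : t ≤ 1) (htT : t ≤ T) (hNt : 100 / t ≤ N) :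
    ((8 ^ |s|)⁻¹ * N ^ s) ^ 2 * ((N ^ 2 / 20000 / 200) ^ 2 * (t ^ 2 / 200)) * (N ^ 2 / 20000) ≤
      ‖sob s t (duhL hT.le (isMultiplier_jetMul none)
        ((h.isPacket.isGaussData hab).source hT.le a₀ a₀))‖ ^ 2 +
      ‖sob s (t / 2) (duhL hT.le (isMultiplier_jetMul none)
        ((h.isPacket.isGaussData hab).source hT.le a₀ a₀))‖ ^ 2 := by
  have hN := h.one_le
  have hN0 := h.N_pos
  have hρ := h.pos
  set D := duhL hT.le (isMultiplier_jetMul none)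
    ((h.isPacket.isGaussData hab).source hT.le a₀ a₀) with hD
  set c := ((8 ^ |s|)⁻¹ * N ^ s) ^ 2 * ((N ^ 2 / 20000 / 200) ^ 2 * (t ^ 2 / 200)) with hc
  rw [norm_sob_sq, norm_sob_sq, ← integral_add (integrable_jap_sq_mul_dens_sq s t D)
    (integrable_jap_sq_mul_dens_sq s (t / 2) D)]
  have hpt : ∀ ξ, (outBox N ρ).indicator (fun _ => c) ξ ≤
      jap s ξ ^ 2 * ‖dens D t ξ‖ ^ 2 + jap s ξ ^ 2 * ‖dens D (t / 2) ξ‖ ^ 2 := by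
    intro ξ
    by_cases hm : ξ ∈ outBox N ρ
    · rw [indicator_of_mem hm, ← mul_add, hD, h.isPacket.dens_duh_source hab hT.le ⟨ht.le, htT⟩,
        h.isPacket.dens_duh_source hab hT.le ⟨by positivity, by linarith⟩, Complex.norm_real,
        Complex.norm_real, Real.norm_eq_abs, Real.norm_eq_abs, sq_abs, sq_abs]
      have h1 := h.le_sum_sq ht ht1 hNt hm
      obtain ⟨⟨x1, x2⟩, x3, x4⟩ := mem_outBox.1 hm
      obtain ⟨k1, k2⟩ := h.norm_mem (by linarith : N / 2 ≤ ξ 0) (by linarith) (by linarith)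
      have hj := (jap_mem_Icc s hN0 (ξ := ξ) (by nlinarith) (by nlinarith)).1
      rw [hc]
      gcongr
    · rw [indicator_of_notMem hm]
      positivity
  have hi := integral_mono (integrable_indicator_cuboid _ _ _)
    ((integrable_jap_sq_mul_dens_sq s t D).add (integrable_jap_sq_mul_dens_sq s (t / 2) D)) hpt
  rw [integral_indicator_cuboid] at hi
  · refine le_trans (le_of_eq ?_) hi
    have := h.sq_eq
    simp only [Matrix.cons_val_zero, Matrix.cons_val_one, Matrix.cons_val]
    linear_combination (-(c * N / 2)) * this
  · intro i
    fin_cases i <;> simp <;> linarith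

/-- If `s - 1 > 2r`, the second iterate is not bounded by the square of the data. -/
theorem not_exists_source_bound (hn : 2 ≤ n) {s r : ℝ} (hsr : 2 * r < s - 1) (hT : 0 < T) :
    ¬∃ C, 0 ≤ C ∧ ∀ (g : Fin 3 → Fin n → Fin n → Space → ℂ) (hg : IsGaussData g),
      ∀ t ∈ Icc (-T) T, ∀ a b,
      ‖sob s t (duhL hT.le (isMultiplier_jetMul none) (hg.source hT.le a b))‖ ≤
        C * ‖hg.initial hT s r‖ ^ 2 := by
  rintro ⟨C, hC0, hC⟩
  set t := min T 1
  have ht : 0 < t := lt_min hT one_pos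
  have ht1 : t ≤ 1 := min_le_right _ _
  have htT : t ≤ T := min_le_left _ _
  -- The excess of the exponent 2s + 6 of the squared output over the exponent 4r + 8 of the fourth
  -- power of the data; it is positive exactly when s - 1 > 2r.
  set p := 2 * s - 4 * r - 2 with hp
  have hp0 : 0 < p := by rw [hp]; linarith
  set c₁ := ((8 : ℝ) ^ |s|)⁻¹ ^ 2 * ((1 / 20000 / 200) ^ 2 * (t ^ 2 / 200)) * (1 / 20000) with hc₁
  set c₂ := 2 * C ^ 2 * (((8 : ℝ) ^ |r| * 5) ^ 2 * (144 / 10000)) ^ 2 with hc₂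
  have hc₁0 : 0 < c₁ := by positivity
  obtain ⟨N, hN1, hNt, hNp⟩ : ∃ N : ℝ, 1 ≤ N ∧ 100 / t ≤ N ∧ c₂ / c₁ < N ^ p :=
    ((Filter.eventually_ge_atTop 1).and ((Filter.eventually_ge_atTop (100 / t)).and
      ((tendsto_rpow_atTop hp0).eventually_gt_atTop (c₂ / c₁)))).exists
  have hN0 : 0 < N := by linarith
  have h : IsTubeScale N (√(N / 10000)) :=
    ⟨hN1, Real.sqrt_pos.2 (by positivity), Real.sq_sqrt (by positivity)⟩
  have hab : (⟨0, by omega⟩ : Fin n) ≠ ⟨1, by omega⟩ := by simp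
  have hl := h.le_norm_sq_add_norm_sq hab hT s ht ht1 htT hNt
  have hu := h.norm_initial_sq_le hab hT s r
  set hg := h.isPacket.isGaussData hab
  set R := (8 ^ |r| * N ^ r * (5 * N)) ^ 2 * (144 * N ^ 2 / 10000) with hR
  have hb : ∀ τ ∈ Icc (-T) T, ‖sob s τ (duhL hT.le (isMultiplier_jetMul none)
      (hg.source hT.le ⟨0, by omega⟩ ⟨0, by omega⟩))‖ ^ 2 ≤ (C * R) ^ 2 := fun τ hτ =>
    pow_le_pow_left₀ (norm_nonneg _)
      ((hC _ hg τ hτ _ _).trans (mul_le_mul_of_nonneg_left hu hC0)) 2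
  have hfin := hl.trans (add_le_add (hb t ⟨by linarith, htT⟩)
    (hb (t / 2) ⟨by linarith, by linarith⟩))
  have e1 : ((8 ^ |s|)⁻¹ * N ^ s) ^ 2 * ((N ^ 2 / 20000 / 200) ^ 2 * (t ^ 2 / 200)) *
      (N ^ 2 / 20000) = c₁ * ((N ^ s) ^ 2 * N ^ 6) := by rw [hc₁]; ring
  have e2 : (C * R) ^ 2 + (C * R) ^ 2 = c₂ * ((N ^ r) ^ 4 * N ^ 8) := by rw [hc₂, hR]; ring
  have e3 : (N ^ s) ^ 2 * N ^ 6 = N ^ p * ((N ^ r) ^ 4 * N ^ 8) := by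
    simp only [← Real.rpow_natCast, ← Real.rpow_mul hN0.le, ← Real.rpow_add hN0]
    congr 1
    push_cast
    rw [hp]
    ring
  rw [e1, e2, e3, ← mul_assoc] at hfin
  have hpos : 0 < (N ^ r) ^ 4 * N ^ 8 := by
    have := Real.rpow_pos_of_pos hN0 r
    positivity
  have := le_of_mul_le_mul_right hfin hpos
  rw [div_lt_iff₀ hc₁0] at hNp
  linarith

end Illposedness

/-- If `s - 1 > 2r`, no flow map of the Yang-Mills system in the Lorenz gauge, defined near the
origin of `H^s × H^r`, is `C²` at the origin, not even along the set of smooth compatible data. -/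
theorem theorem1p3 (n : ℕ) (hn : 2 ≤ n) (s r : ℝ) (hsr : 2 * r < s - 1) (T : ℝ) (hT : 0 < T)
    (U : Set (DataSpace n s r)) (hU : U ∈ nhds (0 : DataSpace n s r))
    (Φ : DataSpace n s r → C(Set.Icc (-T) T, DataSpace n s r)) (hΦ : IsFlowMap n s r hT U Φ) :
    ¬ ContDiffWithinAt ℝ 2 Φ (smoothData n s r hT) 0 :=
  fun hC => not_exists_source_bound hn hsr hT (exists_source_bound hT hU hΦ hC)
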